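/- Let $d\ge 1$, $n\ge 3$, $\gamma>0$, and let $\mathbb T^d=(\mathbb R/2\pi\mathbb Z)^d$ with Lebesgue measure of total mass $(2\pi)^d$. Let $\sigma_1:\mathbb T^d\to[0,\infty)$ be $C^\infty$ and even, $\sigma_1(-x)=\sigma_1(x)$ (for instance radially symmetric), with $\langle\sigma_1\rangle:=\int_{\mathbb T^d}\sigma_1\,dx\neq 0$. Let $\sigma_2:\mathbb R^n\to[0,\infty)$ be $C^\infty$, radially symmetric and compactly supported, with $\widehat\sigma_2(\xi):=\int_{\mathbb R^n}\sigma_2(z)e^{-i\xi\cdot z}\,dz\neq 0$ for all $\xi\in\mathbb R^n$ and $\xi\mapsto\widehat\sigma_2(\xi)/|\xi|\in L^2(\mathbb R^n)$. Put $\Sigma=\sigma_1\star\sigma_1$ and $$\kappa=\int_{\mathbb R^n}\frac{|\widehat\sigma_2(\xi)|^2}{|\xi|^2}\,\frac{d\xi}{(2\pi)^n}.$$ Let $k\in\mathbb Z^d$ and $\omega\in\mathbb R$ satisfy the dispersion relation $$\omega+\frac{|k|^2}{2}-\gamma^2\kappa\langle\sigma_1\rangle^2=0,$$ and suppose that the smallness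 condition $4\gamma^2\kappa\|\sigma_1\|_{L^1(\mathbb T^d)}^2<1$ holds. Consider the shifted Hartree equation $$i\partial_t u+\tfrac12\Delta u-\tfrac{|k|^2}{2}u+ik\cdot\nabla u=-\gamma^2\kappa\,(\Sigma\star|u|^2)\,u ,\qquad t\ge 0,\ x\in\mathbb T^d, \qquad (\ast)$$ whose solutions are understood as functions in $C^0([0,\infty);H^1(\mathbb T^d;\mathbb C))$ satisfying $(\ast)$ in the sense of distributions in $x$, for every $t\ge0$. Then the plane wave $u_\omega(t,x)=e^{i\omega t}\mathbf 1(x)$ solves $(\ast)$; for every $v^{\mathrm{Init}}\in H^1(\mathbb T^d;\mathbb C)$ there is exactly one solution $v$ of $(\ast)$ with $v(0)=v^{\mathrm{Init}}$; and $u_\omega$ is orbitally stable: for every $\varepsilon>0$ there is $\delta>0$ such that for all $v^{\mathrm{Init}}\in H^1(\mathbb T^d;\mathbb C)$, $$\|v^{\mathrm{Init}}-\mathbf 1\|_{H^1}<\delta\ \Longrightarrow\ \sup_{t\ge0}\ \inf_{\theta\in\mathbb R}\|v(t)-e^{i\theta}\mathbf 1\|_{H^1}<\varepsilon,$$ where $v$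 is the solution of $(\ast)$ with $v(0)=v^{\mathrm{Init}}$. -/

import Mathlib

open MeasureTheory Set
open scoped Real ENNReal

noncomputable section

namespace HartreeTorus

/-! ### The torus, smooth functions and their partial derivatives -/

instance factTwoPiPos : Fact (0 < 2 * π) := ⟨Real.two_pi_pos⟩

/-- The torus `𝕋^d = (ℝ / 2πℤ)^d`. Its `volume` is Lebesgue measure, of total mass `(2π)^d`. -/
abbrev Torus (d : ℕ) : Type := Fin d → AddCircle (2 * π)

/-- The projection `ℝ^d → 𝕋^d`. -/
def proj (d : ℕ) (x : Fin d → ℝ) : Torus d := fun j => (x j : AddCircle (2 * π))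

/-- `C^∞` functions on the torus: their periodic lift to `ℝ^d` is `C^∞`. -/
def IsSmooth {d : ℕ} {F : Type} [NormedAddCommGroup F] [NormedSpace ℝ F]
    (f : Torus d → F) : Prop :=
  ContDiff ℝ (⊤ : ℕ∞) (fun x : Fin d → ℝ => f (proj d x))

/-- The classical partial derivative `∂_j φ` on the torus. -/
def pderiv {d : ℕ} (j : Fin d) (φ : Torus d → ℂ) : Torus d → ℂ :=
  fun x => deriv (fun s : ℝ => φ (x + Pi.single j (s : AddCircle (2 * π)))) 0

/-- The classical Laplacian `Δ φ` on the torus. -/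
def laplacian {d : ℕ} (φ : Torus d → ℂ) : Torus d → ℂ :=
  fun x => ∑ j, pderiv j (pderiv j φ) x

lemma proj_surjective (d : ℕ) : Function.Surjective (proj d) := by
  intro x
  choose y hy using fun j => QuotientAddGroup.mk_surjective (x j)
  exact ⟨y, funext hy⟩

lemma isOpenQuotientMap_proj (d : ℕ) : IsOpenQuotientMap (proj d) :=
  IsOpenQuotientMap.piMap (f := fun _ : Fin d => fun s : ℝ => (s : AddCircle (2 * π)))
    fun _ => QuotientAddGroup.isOpenQuotientMap_mk

lemma IsSmooth.continuous {d : ℕ} {F : Type} [NormedAddCommGroup F] [NormedSpace ℝ F]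
    {f : Torus d → F} (hf : IsSmooth f) : Continuous f :=
  (isOpenQuotientMap_proj d).isQuotientMap.continuous_iff.2 (ContDiff.continuous hf)

lemma proj_add_single {d : ℕ} (x : Fin d → ℝ) (j : Fin d) (s : ℝ) :
    proj d x + Pi.single j (s : AddCircle (2 * π)) = proj d (x + s • Pi.single j (1 : ℝ)) := by
  funext i
  rcases eq_or_ne i j with rfl | h
  · simp [proj]
  · simp [proj, h]

lemma IsSmooth.hasDerivAt_single {d : ℕ} {φ : Torus d → ℂ} (hφ : IsSmooth φ) (j : Fin d)
    (x : Torus d) (s : ℝ) :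
    HasDerivAt (fun r : ℝ => φ (x + Pi.single j (r : AddCircle (2 * π))))
      (pderiv j φ (x + Pi.single j (s : AddCircle (2 * π)))) s := by
  obtain ⟨y, rfl⟩ := proj_surjective d x
  have hd : Differentiable ℝ (fun r : ℝ =>
      φ (proj d y + Pi.single j (r : AddCircle (2 * π)))) := by
    simp only [proj_add_single]
    have h1 : Differentiable ℝ (fun x : Fin d → ℝ => φ (proj d x)) :=
      ContDiff.differentiable hφ (by simp)
    have h2 : Differentiable ℝ (fun r : ℝ => y + r • (Pi.single j (1 : ℝ) : Fin d → ℝ)) := by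
      fun_prop
    exact h1.comp h2
  have key : pderiv j φ (proj d y + Pi.single j (s : AddCircle (2 * π)))
      = deriv (fun r : ℝ => φ (proj d y + Pi.single j (r : AddCircle (2 * π)))) s := by
    unfold pderiv
    have : (fun r : ℝ => φ (proj d y + Pi.single j (s : AddCircle (2 * π))
          + Pi.single j (r : AddCircle (2 * π))))
        = fun r : ℝ => (fun r : ℝ => φ (proj d y + Pi.single j (r : AddCircle (2 * π)))) (s + r) := by
      funext r
      simp only [AddCircle.coe_add, Pi.single_add, add_assoc]
    rw [this]
    generalize (fun r : ℝ => φ (proj d y + Pi.single j (r : AddCircle (2 * π)))) = f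
    simpa using deriv_comp_const_add f s (0 : ℝ)
  rw [key]
  exact (hd s).hasDerivAt

lemma IsSmooth.pderiv {d : ℕ} {φ : Torus d → ℂ} (hφ : IsSmooth φ) (j : Fin d) :
    IsSmooth (pderiv j φ) := by
  have h0 : ContDiff ℝ (⊤ : ℕ∞) (fun x : Fin d → ℝ => φ (proj d x)) := hφ
  have h : (fun x : Fin d → ℝ => HartreeTorus.pderiv j φ (proj d x))
      = fun x => fderiv ℝ (fun x : Fin d → ℝ => φ (proj d x)) x (Pi.single j 1) := by
    funext x
    have h1 : HasFDerivAt (fun x : Fin d → ℝ => φ (proj d x))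
        (fderiv ℝ (fun x : Fin d → ℝ => φ (proj d x)) x) (x + (0 : ℝ) • Pi.single j (1 : ℝ)) := by
      simpa using (h0.differentiable (by simp) x).hasFDerivAt
    have h2 : HasDerivAt (fun s : ℝ => x + s • (Pi.single j (1 : ℝ) : Fin d → ℝ))
        (Pi.single j (1 : ℝ)) 0 := by
      simpa using ((hasDerivAt_id (0 : ℝ)).smul_const
        (Pi.single j (1 : ℝ) : Fin d → ℝ)).const_add x
    have h3 := h1.comp_hasDerivAt (0 : ℝ) h2
    unfold HartreeTorus.pderiv
    simp only [proj_add_single]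
    exact h3.deriv
  unfold IsSmooth
  rw [h]
  exact (h0.fderiv_right (by simp)).clm_apply contDiff_const

lemma IsSmooth.integrable_mul {d : ℕ} {φ : Torus d → ℂ} (hφ : IsSmooth φ)
    (f : Lp ℂ 2 (volume : Measure (Torus d))) : Integrable (fun x => f x * φ x) volume := by
  obtain ⟨C, hC⟩ := (isCompact_univ (X := Torus d)).exists_bound_of_continuousOn
    hφ.continuous.continuousOn
  exact ((Lp.memLp f).integrable (by norm_num)).mul_bdd
    hφ.continuous.aestronglyMeasurable (Filter.Eventually.of_forall fun x => hC x (mem_univ x))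

lemma IsSmooth.integral_pderiv {d : ℕ} {φ : Torus d → ℂ} (hφ : IsSmooth φ) (j : Fin d) :
    ∫ x, HartreeTorus.pderiv j φ x = 0 := by
  obtain ⟨C, hC⟩ := (isCompact_univ (X := Torus d)).exists_bound_of_continuousOn
    (hφ.pderiv j).continuous.continuousOn
  obtain ⟨e, he⟩ : ∃ e : ℝ → Torus d,
      e = fun s : ℝ => (Pi.single j (s : AddCircle (2 * π)) : Torus d) :=
    ⟨_, rfl⟩
  have he0 : e 0 = 0 := by simp [he]
  have hd : ∀ (x : Torus d) (s : ℝ), HasDerivAt (fun r : ℝ => φ (x + e r))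
      (HartreeTorus.pderiv j φ (x + e s)) s := by
    intro x s
    rw [he]
    exact hφ.hasDerivAt_single j x s
  clear he
  have hcont : ∀ s : ℝ, Continuous fun x : Torus d => φ (x + e s) := fun s =>
    hφ.continuous.comp (continuous_id.add continuous_const)
  have hint : Integrable (fun x : Torus d => φ (x + e 0)) :=
    Continuous.integrable_of_hasCompactSupport (hcont 0) (HasCompactSupport.of_compactSpace _)
  have hmeas : AEStronglyMeasurable (fun x : Torus d => HartreeTorus.pderiv j φ (x + e 0))
      volume :=
    ((hφ.pderiv j).continuous.comp (continuous_id.add continuous_const)).aestronglyMeasurable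
  have h := hasDerivAt_integral_of_dominated_loc_of_deriv_le
    (μ := (volume : Measure (Torus d))) (s := univ) (x₀ := (0 : ℝ))
    (F := fun (s : ℝ) (x : Torus d) => φ (x + e s))
    (F' := fun (s : ℝ) (x : Torus d) => HartreeTorus.pderiv j φ (x + e s))
    (bound := fun _ => C) Filter.univ_mem
    (Filter.Eventually.of_forall fun s => (hcont s).aestronglyMeasurable)
    hint hmeas
    (Filter.Eventually.of_forall fun x s _ => hC _ (mem_univ _))
    (integrable_const C)
    (Filter.Eventually.of_forall fun x s _ => hd x s)
  have hconst : (fun s : ℝ => ∫ x : Torus d, φ (x + e s)) = fun _ => ∫ x : Torus d, φ x := by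
    funext s
    exact integral_add_right_eq_self φ _
  have h2 := h.2
  rw [hconst] at h2
  simpa [he0] using h2.unique (hasDerivAt_const (0 : ℝ) _)

/-! ### The Sobolev space `H¹(𝕋^d; ℂ)` -/

/-- `g` is the weak partial derivative `∂_j f`. -/
def IsWeakPDeriv {d : ℕ} (j : Fin d) (f g : Lp ℂ 2 (volume : Measure (Torus d))) : Prop :=
  ∀ φ : Torus d → ℂ, IsSmooth φ → ∫ x, f x * pderiv j φ x = - ∫ x, g x * φ x

/-- The Hilbert space `L² × (L²)^d`, with `‖(f, g)‖² = ‖f‖² + ∑ j, ‖g j‖²`. -/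
abbrev L2Jet (d : ℕ) : Type :=
  WithLp 2 (Lp ℂ 2 (volume : Measure (Torus d)) ×
    PiLp 2 (fun _ : Fin d => Lp ℂ 2 (volume : Measure (Torus d))))

/-- The pairs `(f, ∇f)` with `f` and its weak gradient in `L²`. -/
def sobolevH1 (d : ℕ) : Submodule ℂ (L2Jet d) where
  carrier := {u | ∀ j, IsWeakPDeriv j u.fst (u.snd j)}
  zero_mem' := by
    intro j φ hφ
    have h0 : ∀ ψ : Torus d → ℂ,
        ∫ x, (0 : Lp ℂ 2 (volume : Measure (Torus d))) x * ψ x = 0 := by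
      intro ψ
      rw [integral_congr_ae (g := fun _ => (0 : ℂ)), integral_zero]
      filter_upwards [Lp.coeFn_zero ℂ 2 (volume : Measure (Torus d))] with x hx
      simp
    simp
  add_mem' := by
    intro u v hu hv j φ hφ
    have key : ∀ (a b : Lp ℂ 2 (volume : Measure (Torus d))) (ψ : Torus d → ℂ), IsSmooth ψ →
        ∫ x, (a + b) x * ψ x = (∫ x, a x * ψ x) + ∫ x, b x * ψ x := by
      intro a b ψ hψ
      rw [← integral_add (hψ.integrable_mul a) (hψ.integrable_mul b)]
      refine integral_congr_ae ?_
      filter_upwards [Lp.coeFn_add a b] with x hx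
      rw [hx, Pi.add_apply, add_mul]
    simp only [WithLp.add_fst, WithLp.add_snd, PiLp.add_apply]
    rw [key _ _ _ (hφ.pderiv j), key _ _ _ hφ, hu j φ hφ, hv j φ hφ, neg_add]
  smul_mem' := by
    intro c u hu j φ hφ
    have key : ∀ (a : Lp ℂ 2 (volume : Measure (Torus d))) (ψ : Torus d → ℂ),
        ∫ x, (c • a) x * ψ x = c * ∫ x, a x * ψ x := by
      intro a ψ
      rw [← integral_const_mul]
      refine integral_congr_ae ?_
      filter_upwards [Lp.coeFn_smul c a] with x hx
      rw [hx, Pi.smul_apply, smul_eq_mul, mul_assoc]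
    simp only [WithLp.smul_fst, WithLp.smul_snd, PiLp.smul_apply]
    rw [key, key, hu j φ hφ, mul_neg]

/-- The Sobolev space `H¹(𝕋^d; ℂ)`. An element is stored together with its (unique) weak gradient,
so that the norm is `‖u‖²_{H¹} = ‖u‖²_{L²} + ∑ j, ‖∂_j u‖²_{L²}`. -/
abbrev H1 (d : ℕ) : Type := sobolevH1 d

/-- The underlying function of an element of `H¹`. -/
def H1.toFun {d : ℕ} (u : H1 d) : Torus d → ℂ := fun x => (u : L2Jet d).fst x

/-- The constant function `𝟏`, as an element of `H¹`. -/
def H1.one (d : ℕ) : H1 d :=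
  ⟨WithLp.toLp 2 (Lp.const 2 (volume : Measure (Torus d)) (1 : ℂ), 0), by
    intro j φ hφ
    have h1 : ∫ x, (Lp.const 2 (volume : Measure (Torus d)) (1 : ℂ)) x * pderiv j φ x
        = ∫ x, pderiv j φ x := by
      refine integral_congr_ae ?_
      filter_upwards [Lp.coeFn_const (p := 2) (μ := (volume : Measure (Torus d)))
        (c := (1 : ℂ))] with x hx
      simp
    have h0 : ∫ x, (0 : Lp ℂ 2 (volume : Measure (Torus d))) x * φ x = 0 := by
      rw [integral_congr_ae (g := fun _ => (0 : ℂ)), integral_zero]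
      filter_upwards [Lp.coeFn_zero ℂ 2 (volume : Measure (Torus d))] with x hx
      simp
    simpa [h0] using h1.trans (hφ.integral_pderiv j)⟩

/-- The phase orbit `{e^{iθ} 𝟏 : θ ∈ ℝ}` in `H¹`. -/
def phaseOrbit (d : ℕ) : Set (H1 d) :=
  range fun θ : ℝ => Complex.exp (Complex.I * θ) • H1.one d

/-! ### The coefficients of the equation -/

/-- Convolution of real functions on the torus. -/
def conv {d : ℕ} (f g : Torus d → ℝ) : Torus d → ℝ :=
  convolution f g (ContinuousLinearMap.mul ℝ ℝ) volume

/-- The Fourier transform on `ℝ^n`, normalised as `σ̂(ξ) = ∫ σ(z) e^{-iξ·z} dz`. -/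
def fourierHat {n : ℕ} (σ : EuclideanSpace ℝ (Fin n) → ℝ) (ξ : EuclideanSpace ℝ (Fin n)) : ℂ :=
  ∫ z, (σ z : ℂ) * Complex.exp (-(Complex.I * (inner ℝ ξ z : ℝ)))

/-- `κ = ∫ σ₂ (-Δ)⁻¹ σ₂ dz = (2π)^{-n} ∫ |σ̂₂(ξ)|² / |ξ|² dξ`. -/
def kappa {n : ℕ} (σ₂ : EuclideanSpace ℝ (Fin n) → ℝ) : ℝ :=
  (∫ ξ, ‖fourierHat σ₂ ξ‖ ^ 2 / ‖ξ‖ ^ 2) / (2 * π) ^ n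

/-- `|k|² = ∑ j, k_j²`. -/
def normSq {d : ℕ} (k : Fin d → ℤ) : ℝ := ∑ j, (k j : ℝ) ^ 2

/-! ### The shifted Hartree equation -/

/-- The potential `-g (Σ ⋆ |u|²)`, where `Σ = σ₁ ⋆ σ₁` and `g` is the coupling constant. -/
def potential {d : ℕ} (g : ℝ) (σ₁ : Torus d → ℝ) (u : H1 d) : Torus d → ℝ :=
  fun x => -g * conv (conv σ₁ σ₁) (fun y => ‖u.toFun y‖ ^ 2) x

/-- `v ∈ C⁰([0,∞); H¹(𝕋^d))` solves, in the sense of distributions on `𝕋^d` for all `t ≥ 0`,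
`i ∂_t v + ½ Δ v - (|k|²/2) v + i k·∇v = -g (Σ ⋆ |v|²) v`, `v(0) = v₀`, where `Σ = σ₁ ⋆ σ₁`.
Only the values of `v` on `[0,∞)` matter. Tested against `φ ∈ C^∞(𝕋^d)`, and with all the space
derivatives moved onto `φ`, the equation reads `d/dt ∫ v φ = -i ∫ v A φ`, where
`A φ = -½ Δ φ + (|k|²/2) φ + i k·∇φ - g (Σ ⋆ |v|²) φ`. -/
structure IsSolution {d : ℕ} (k : Fin d → ℤ) (g : ℝ) (σ₁ : Torus d → ℝ) (v₀ : H1 d)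
    (v : ℝ → H1 d) : Prop where
  continuousOn : ContinuousOn v (Ici 0)
  initial : v 0 = v₀
  equation : ∀ φ : Torus d → ℂ, IsSmooth φ → ∀ t : ℝ, 0 ≤ t →
    HasDerivWithinAt (fun s : ℝ => ∫ x, (v s).toFun x * φ x)
      (-Complex.I * ∫ x, (v t).toFun x *
        (-(1 / 2) * laplacian φ x + (normSq k / 2 : ℝ) * φ x
          + Complex.I * ∑ j, (k j : ℂ) * pderiv j φ x
          + (potential g σ₁ (v t) x : ℂ) * φ x))
      (Ici 0) t

/-- The plane wave `u_ω(t) = e^{iωt} 𝟏`. -/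
def planeWave (d : ℕ) (ω : ℝ) (t : ℝ) : H1 d :=
  Complex.exp (Complex.I * (ω * t : ℝ)) • H1.one d

end HartreeTorus

end

/-! Take `x m = ⟨m⟩ û(m)` with `⟨m⟩ = (1 + |m|²)^{1/2}`. By Parseval this is an isometry `toSeq` of
`H¹` onto `ℓ²(ℤ^d)`. The linear part becomes the multiplier `|m + k|²/2`, and removing its unitary
flow leaves an ordinary differential equation with field `interactionField`; `isSolution_iff` shows
that distributional solutions are exactly its solutions. The coefficients of `Σ = σ₁ ⋆ σ₁` are
squares `|σ̂₁(p)|²`, up to normalisation, because `σ₁` is even, and they are summable against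
`⟨p⟩²`. Multiplication by `e^{ip·x}` has norm at most `2⟨p⟩²` on `H¹`, so the field is locally
Lipschitz. Its size is at most a constant times mass times `‖x‖`; mass is conserved, so Gronwall
gives global solutions (`exists_solvesODE`).

For stability, write `M = ‖u‖²` and `y = ‖∇u‖`, both in `L²`, and `g = γ²κ`. Mass is conserved, and
so is `y²/4 - (g/4) ∫ (Σ ⋆ |u|²)|u|²`; the `k`-dependent terms drop out by conservation of momentum
and mass. With `s` the coefficients of `Σ`, the potential energy is `∑ s_p |ρ_p|²`, where `ρ_p` are
the Fourier coefficients of `|u|²`. It is at least its term `s_0 M²` (`le_potEnergy`) and at most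
`s_0 M² + y² (4σM + o(1))` as `y → 0`, where `σ` bounds `s` (`potEnergy_le`, through Poincaré).
Equating the energies at times `0` and `t`, the `s_0` terms cancel:

`y(t)² (1 - 4gσM - o(1)) ≤ y(0)²`.

For `M` near `(2π)^d` and `σ = ‖σ₁‖²_{L¹}/(2π)^d` the smallness condition makes the bracket positive
for small `y`, and a continuity argument keeps `y(t)` small. A small gradient and a mass near
`(2π)^d` force `u` close to some `e^{iθ}𝟏` in `H¹` (`exists_phase_norm_sub_sq_le`). -/

noncomputable section

namespace HartreeTorus

/-! ### Global solutions of ordinary differential equations -/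

section GlobalODE

open scoped NNReal

variable {E F : Type*} [NormedAddCommGroup E]

/-- A cutoff at radius `R`. -/
def radialCutoff (R : ℝ) (x : E) : ℝ := max 0 (min 1 (R + 1 - ‖x‖))

lemma radialCutoff_nonneg (R : ℝ) (x : E) : 0 ≤ radialCutoff R x := le_max_left _ _

lemma radialCutoff_le_one (R : ℝ) (x : E) : radialCutoff R x ≤ 1 :=
  max_le zero_le_one (min_le_left _ _)

lemma radialCutoff_of_le {R : ℝ} {x : E} (h : ‖x‖ ≤ R) : radialCutoff R x = 1 := by
  rw [radialCutoff, min_eq_left (by linarith), max_eq_right zero_le_one]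

lemma radialCutoff_of_ge {R : ℝ} {x : E} (h : R + 1 ≤ ‖x‖) : radialCutoff R x = 0 :=
  max_eq_left ((min_le_right _ _).trans (by linarith))

lemma abs_radialCutoff_sub_le (R : ℝ) (x y : E) :
    |radialCutoff R x - radialCutoff R y| ≤ ‖x - y‖ := by
  unfold radialCutoff
  calc |max 0 (min 1 (R + 1 - ‖x‖)) - max 0 (min 1 (R + 1 - ‖y‖))|
      ≤ |min 1 (R + 1 - ‖x‖) - min 1 (R + 1 - ‖y‖)| := by
        simpa using abs_max_sub_max_le_max (0 : ℝ) (min 1 (R + 1 - ‖x‖)) 0 (min 1 (R + 1 - ‖y‖))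
    _ ≤ |(R + 1 - ‖x‖) - (R + 1 - ‖y‖)| := by
        simpa using abs_min_sub_min_le_max (1 : ℝ) (R + 1 - ‖x‖) 1 (R + 1 - ‖y‖)
    _ = |‖x‖ - ‖y‖| := by rw [abs_sub_comm]; congr 1; ring
    _ ≤ ‖x - y‖ := abs_norm_sub_norm_le x y

variable [NormedSpace ℝ E] [NormedAddCommGroup F] [InnerProductSpace ℝ F]

/-- `w` solves `w' = f(t, w)` on `[0, ∞)`. -/
def SolvesODE (f : ℝ → E → E) (w : ℝ → E) : Prop :=
  ∀ t, 0 ≤ t → HasDerivWithinAt w (f t (w t)) (Ici 0) t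

lemma SolvesODE.continuousOn {f : ℝ → E → E} {w : ℝ → E} (h : SolvesODE f w) :
    ContinuousOn w (Ici 0) := fun t ht => (h t ht).continuousWithinAt

lemma ode_unique_Icc {f : ℝ → E → E}
    (hlip : ∀ R : ℝ, ∃ K : ℝ≥0, ∀ t, LipschitzOnWith K (f t) (Metric.closedBall 0 R))
    {v w : ℝ → E} {T : ℝ}
    (hv : ∀ t ∈ Icc 0 T, HasDerivWithinAt v (f t (v t)) (Icc 0 T) t)
    (hw : ∀ t ∈ Icc 0 T, HasDerivWithinAt w (f t (w t)) (Icc 0 T) t) (h0 : v 0 = w 0) :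
    EqOn v w (Icc 0 T) := by
  have hvc : ContinuousOn v (Icc 0 T) := fun t ht => (hv t ht).continuousWithinAt
  have hwc : ContinuousOn w (Icc 0 T) := fun t ht => (hw t ht).continuousWithinAt
  obtain ⟨A, hA⟩ := isCompact_Icc.exists_bound_of_continuousOn hvc
  obtain ⟨B, hB⟩ := isCompact_Icc.exists_bound_of_continuousOn hwc
  obtain ⟨K, hK⟩ := hlip (max A B)
  have key : ∀ {u : ℝ → E}, (∀ t ∈ Icc 0 T, HasDerivWithinAt u (f t (u t)) (Icc 0 T) t) →
      ∀ t ∈ Ico 0 T, HasDerivWithinAt u (f t (u t)) (Ici t) t := fun hu t ht =>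
    ((hu t (Ico_subset_Icc_self ht)).mono (Icc_subset_Icc_left ht.1)).mono_of_mem_nhdsWithin
      (Icc_mem_nhdsGE ht.2)
  refine ODE_solution_unique_of_mem_Icc_right (v := f)
    (s := fun _ => Metric.closedBall 0 (max A B)) (K := K) (fun t _ => hK t) hvc
    (key hv) (fun t ht => ?_) hwc (key hw) (fun t ht => ?_) h0
  · simpa using Or.inl (hA t (Ico_subset_Icc_self ht))
  · simpa using Or.inr (hB t (Ico_subset_Icc_self ht))

lemma SolvesODE.unique {f : ℝ → E → E}
    (hlip : ∀ R : ℝ, ∃ K : ℝ≥0, ∀ t, LipschitzOnWith K (f t) (Metric.closedBall 0 R))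
    {v w : ℝ → E} (hv : SolvesODE f v) (hw : SolvesODE f w) (h0 : v 0 = w 0) :
    EqOn v w (Ici 0) := fun _ ht =>
  ode_unique_Icc hlip (fun s hs => (hv s hs.1).mono Icc_subset_Ici_self)
    (fun s hs => (hw s hs.1).mono Icc_subset_Ici_self) h0 (right_mem_Icc.2 ht)

/-- The cutoff is 1-Lipschitz and acts on values bounded by `L`, which adds `L` to the constant `K`.
If one point lies beyond `R + 1`, its product vanishes and only the variation of the cutoff counts.
-/
lemma lipschitzWith_radialCutoff_smul {f : E → E} {R : ℝ} {K L : ℝ≥0}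
    (hf : LipschitzOnWith K f (Metric.closedBall 0 (R + 1)))
    (hL : ∀ x, ‖x‖ ≤ R + 1 → ‖f x‖ ≤ L) :
    LipschitzWith (K + L) (fun x => radialCutoff R x • f x) := by
  have out : ∀ x y : E, R + 1 ≤ ‖y‖ →
      ‖radialCutoff R x • f x - radialCutoff R y • f y‖ ≤ (K + L) * ‖x - y‖ := by
    intro x y hy
    have h := abs_radialCutoff_sub_le R x y
    rw [radialCutoff_of_ge hy, sub_zero] at h
    rw [radialCutoff_of_ge hy, zero_smul, sub_zero, norm_smul, Real.norm_eq_abs]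
    rcases le_total ‖x‖ (R + 1) with hx | hx
    · have h1 := mul_le_mul h (hL x hx) (norm_nonneg _) (norm_nonneg _)
      nlinarith [norm_nonneg (x - y), K.2]
    · rw [radialCutoff_of_ge hx]
      simp only [abs_zero, zero_mul]
      positivity
  refine LipschitzWith.of_dist_le_mul fun x y => ?_
  rw [dist_eq_norm, dist_eq_norm, NNReal.coe_add]
  rcases le_total ‖y‖ (R + 1) with hy | hy
  · rcases le_total ‖x‖ (R + 1) with hx | hx
    · have h1 := hf.dist_le_mul x (by simpa using hx) y (by simpa using hy)
      rw [dist_eq_norm, dist_eq_norm] at h1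
      have h2 : radialCutoff R x • f x - radialCutoff R y • f y
          = radialCutoff R x • (f x - f y) + (radialCutoff R x - radialCutoff R y) • f y := by
        module
      rw [h2]
      refine (norm_add_le _ _).trans ?_
      rw [norm_smul, norm_smul, Real.norm_eq_abs, Real.norm_eq_abs,
        abs_of_nonneg (radialCutoff_nonneg R x)]
      have h3 := mul_le_mul (radialCutoff_le_one R x) h1 (norm_nonneg _) zero_le_one
      have h4 := mul_le_mul (abs_radialCutoff_sub_le R x y) (hL y hy) (norm_nonneg _)
        (norm_nonneg _)
      linarith
    · rw [norm_sub_rev, norm_sub_rev x]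
      exact out y x hx
  · exact out x y hy

lemma norm_sq_eq_of_orthogonal_field {w w' : ℝ → E} {s : Set ℝ} (hs : Convex ℝ s)
    {J : E →L[ℝ] F}
    (hw : ∀ t ∈ s, HasDerivWithinAt w (w' t) s t)
    (ho : ∀ t ∈ s, inner ℝ (J (w t)) (J (w' t)) = 0) {a b : ℝ} (ha : a ∈ s) (hb : b ∈ s) :
    ‖J (w a)‖ ^ 2 = ‖J (w b)‖ ^ 2 := by
  have hd : ∀ t ∈ s, HasDerivWithinAt (fun t => ‖J (w t)‖ ^ 2) 0 s t := by
    intro t ht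
    have h := (J.hasFDerivAt.comp_hasDerivWithinAt t (hw t ht)).norm_sq
    simp only [Function.comp_apply, ho t ht, mul_zero] at h
    exact h
  have := hs.norm_image_sub_le_of_norm_hasDerivWithin_le (C := 0) hd (by simp) hb ha
  simp only [zero_mul, norm_le_zero_iff, sub_eq_zero] at this
  exact this

/-- A locally Lipschitz field that conserves a seminorm `‖J x‖`, and whose growth is linear on the
level sets of this seminorm, has global solutions. -/
theorem exists_solvesODE [CompleteSpace E] {f : ℝ → E → E} {J : E →L[ℝ] F} {C : ℝ}
    (hC : 0 ≤ C) (hcont : ∀ x, Continuous fun t => f t x)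
    (hlip : ∀ R : ℝ, ∃ K : ℝ≥0, ∀ t, LipschitzOnWith K (f t) (Metric.closedBall 0 R))
    (ho : ∀ t x, inner ℝ (J x) (J (f t x)) = 0)
    (hgrowth : ∀ t x, ‖f t x‖ ≤ C * ‖J x‖ ^ 2 * ‖x‖) (x₀ : E) :
    ∃ w, SolvesODE f w ∧ w 0 = x₀ := by
  have local_sol : ∀ T : ℝ, 0 ≤ T → ∃ w : ℝ → E, w 0 = x₀ ∧
      ∀ t ∈ Icc 0 T, HasDerivWithinAt w (f t (w t)) (Icc 0 T) t := by
    intro T hT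
    -- The Gronwall bound at time `T`. The truncated field is a multiple of `f`, so it conserves `‖J
    -- x‖` as well; its solution then stays in the ball of radius `R`, where the cutoff equals 1.
    set R : ℝ := ‖x₀‖ * Real.exp (C * ‖J x₀‖ ^ 2 * T) with hR
    have hR0 : 0 ≤ R := by positivity
    obtain ⟨K, hK⟩ := hlip (R + 1)
    obtain ⟨L, hL⟩ : ∃ L : ℝ≥0, ∀ t x, ‖x‖ ≤ R + 1 → ‖f t x‖ ≤ L := by
      refine ⟨⟨C * (‖J‖ * (R + 1)) ^ 2 * (R + 1), by positivity⟩, fun t x hx => ?_⟩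
      refine (hgrowth t x).trans ?_
      have h1 : ‖J x‖ ≤ ‖J‖ * (R + 1) :=
        (J.le_opNorm x).trans (mul_le_mul_of_nonneg_left hx (norm_nonneg _))
      have h2 : C * ‖J x‖ ^ 2 ≤ C * (‖J‖ * (R + 1)) ^ 2 := by gcongr
      exact mul_le_mul h2 hx (norm_nonneg _) (by positivity)
    have hbound : ∀ t x, ‖radialCutoff R x • f t x‖ ≤ L := by
      intro t x
      rcases le_total ‖x‖ (R + 1) with hx | hx
      · rw [norm_smul, Real.norm_eq_abs, abs_of_nonneg (radialCutoff_nonneg R x)]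
        have := mul_le_mul (radialCutoff_le_one R x) (hL t x hx) (norm_nonneg _) zero_le_one
        linarith
      · rw [radialCutoff_of_ge hx, zero_smul, norm_zero]
        exact L.2
    -- The truncated field is bounded and Lipschitz on the whole space, so the ball of radius `L *
    -- T` imposes no restriction on `T`.
    have hPL : IsPicardLindelof (fun t x => radialCutoff R x • f t x)
        (⟨0, left_mem_Icc.2 hT⟩ : Icc (0 : ℝ) T) x₀ (L * T.toNNReal) 0 L (K + L) := by
      refine ⟨fun t _ => (lipschitzWith_radialCutoff_smul (hK t) (hL t)).lipschitzOnWith,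
        fun x _ => ((hcont x).const_smul _).continuousOn, fun t _ x _ => hbound t x, ?_⟩
      simp [hT]
    obtain ⟨w, hw0, hw⟩ := hPL.exists_eq_forall_mem_Icc_hasDerivWithinAt₀
    have hw0 : w 0 = x₀ := hw0
    refine ⟨w, hw0, fun t ht => ?_⟩
    have hmass : ∀ t ∈ Icc 0 T, ‖J (w t)‖ ^ 2 = ‖J x₀‖ ^ 2 := by
      intro t ht
      rw [← hw0]
      refine norm_sq_eq_of_orthogonal_field (convex_Icc 0 T) hw (fun t _ => ?_) ht
        (left_mem_Icc.2 hT)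
      rw [map_smul, inner_smul_right, ho, mul_zero]
    have hnorm : ‖w t‖ ≤ R := by
      have h := norm_le_gronwallBound_of_norm_deriv_right_le (f := w)
        (f' := fun t => radialCutoff R (w t) • f t (w t)) (δ := ‖x₀‖) (K := C * ‖J x₀‖ ^ 2)
        (ε := 0) (a := 0) (b := t)
        (fun s hs => (hw s ⟨hs.1, hs.2.trans ht.2⟩).continuousWithinAt.mono
          (Icc_subset_Icc_right ht.2))
        (fun s hs => ((hw s ⟨hs.1, (hs.2.trans_le ht.2).le⟩).mono
          (Icc_subset_Icc_left hs.1)).mono_of_mem_nhdsWithin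
            (Icc_mem_nhdsGE (hs.2.trans_le ht.2)))
        (by rw [hw0])
        (fun s hs => by
          rw [norm_smul, Real.norm_eq_abs, abs_of_nonneg (radialCutoff_nonneg _ _), add_zero]
          have h1 := hgrowth s (w s)
          rw [hmass s ⟨hs.1, (hs.2.trans_le ht.2).le⟩] at h1
          refine le_trans ?_ h1
          exact mul_le_of_le_one_left (norm_nonneg _) (radialCutoff_le_one _ _))
        t (right_mem_Icc.2 ht.1)
      rw [gronwallBound_ε0, sub_zero] at h
      refine h.trans ?_
      rw [hR]
      gcongr
      exact ht.2
    have := hw t ht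
    rwa [radialCutoff_of_le hnorm, one_smul] at this
  choose! W hW0 hW using local_sol
  -- The horizon `t + 1` makes `[0, t + 1]` a neighbourhood of `t` in `[0, ∞)`; uniqueness makes the
  -- different horizons agree.
  refine ⟨fun t => W (t + 1) t, ?_, hW0 _ (by norm_num)⟩
  intro t ht
  have heq : ∀ s ∈ Icc 0 (t + 1), W (s + 1) s = W (t + 1) s := by
    intro s hs
    have hm : 0 ≤ min (s + 1) (t + 1) := le_min (by linarith [hs.1]) (by linarith)
    refine ode_unique_Icc hlip (T := min (s + 1) (t + 1))
      (fun r hr => (hW (s + 1) (by linarith [hs.1]) r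
        ⟨hr.1, hr.2.trans (min_le_left _ _)⟩).mono (Icc_subset_Icc_right (min_le_left _ _)))
      (fun r hr => (hW (t + 1) (by linarith) r
        ⟨hr.1, hr.2.trans (min_le_right _ _)⟩).mono (Icc_subset_Icc_right (min_le_right _ _)))
      ?_ ⟨hs.1, le_min (by linarith) hs.2⟩
    rw [hW0 _ (by linarith [hs.1]), hW0 _ (by linarith)]
  have h1 : HasDerivWithinAt (W (t + 1)) (f t (W (t + 1) t)) (Icc 0 (t + 1)) t :=
    hW (t + 1) (by linarith) t ⟨ht, by linarith⟩
  have h2 := h1.congr heq rfl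
  refine h2.mono_of_mem_nhdsWithin ?_
  have : Icc 0 (t + 1) = Ici 0 ∩ Iic (t + 1) := Ici_inter_Iic.symm
  rw [this]
  exact Filter.inter_mem self_mem_nhdsWithin (mem_nhdsWithin_of_mem_nhds (Iic_mem_nhds (by linarith)))

end GlobalODE

/-! ### Weighted shifts on square-summable sequences -/

open Filter Topology
open scoped ComplexConjugate NNReal

/-- Frequencies of Fourier series on `𝕋^d`. -/
abbrev Freq (d : ℕ) : Type := Fin d → ℤ

/-- The Hilbert space `ℓ²(ℤ^d; ℂ)`. -/
abbrev Seq (d : ℕ) : Type := lp (fun _ : Freq d => ℂ) 2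

variable {d : ℕ}

lemma hasSum_seq_inner (x y : Seq d) :
    HasSum (fun m => conj (x m) * y m) (inner ℂ x y) := by
  simpa [mul_comm] using lp.hasSum_inner (𝕜 := ℂ) x y

lemma hasSum_seq_norm_sq (x : Seq d) : HasSum (fun m => ‖x m‖ ^ 2) (‖x‖ ^ 2) := by
  simpa using lp.hasSum_norm (p := 2) (by norm_num) x

lemma memlp_of_summable_sq {f : Freq d → ℂ} (hf : Summable fun m => ‖f m‖ ^ 2) :
    Memℓp f 2 := memℓp_gen (by simpa using hf)

lemma hasSum_norm_sq_shift (p : Freq d) (x : Seq d) :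
    HasSum (fun m => ‖x (m - p)‖ ^ 2) (‖x‖ ^ 2) :=
  (Equiv.subRight p).hasSum_iff.2 (hasSum_seq_norm_sq x)

lemma norm_sq_weight_le {a : Freq d → ℂ} {C : ℝ} (ha : ∀ m, ‖a m‖ ≤ C) (p : Freq d) (x : Seq d)
    (m : Freq d) : ‖a m * x (m - p)‖ ^ 2 ≤ C ^ 2 * ‖x (m - p)‖ ^ 2 := by
  rw [norm_mul, mul_pow]
  gcongr
  exact ha m

lemma summable_norm_sq_weight {a : Freq d → ℂ} {C : ℝ} (ha : ∀ m, ‖a m‖ ≤ C) (p : Freq d)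
    (x : Seq d) : Summable fun m => ‖a m * x (m - p)‖ ^ 2 :=
  ((hasSum_norm_sq_shift p x).summable.mul_left (C ^ 2)).of_nonneg_of_le
    (fun _ => by positivity) (norm_sq_weight_le ha p x)

/-- The sequence `(a_m x_{m - p})`, for a bounded weight `a`. -/
def weightedShift {a : Freq d → ℂ} {C : ℝ} (ha : ∀ m, ‖a m‖ ≤ C) (p : Freq d) (x : Seq d) :
    Seq d := ⟨fun m => a m * x (m - p), memlp_of_summable_sq (summable_norm_sq_weight ha p x)⟩

lemma norm_weightedShift_le {a : Freq d → ℂ} {C : ℝ} (ha : ∀ m, ‖a m‖ ≤ C) (p : Freq d)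
    (x : Seq d) : ‖weightedShift ha p x‖ ≤ C * ‖x‖ := by
  have hC : 0 ≤ C := (norm_nonneg _).trans (ha 0)
  refine le_of_sq_le_sq ?_ (by positivity)
  rw [mul_pow]
  exact hasSum_le (norm_sq_weight_le ha p x) (hasSum_seq_norm_sq (weightedShift ha p x))
    ((hasSum_norm_sq_shift p x).mul_left (C ^ 2))

open Classical in
/-- The operator `(x_m) ↦ (a_m x_{m - p})`, for a bounded weight `a` (and `0` otherwise). -/
def wshift (a : Freq d → ℂ) (p : Freq d) : Seq d →L[ℂ] Seq d :=
  if h : ∃ C, ∀ m, ‖a m‖ ≤ C then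
    LinearMap.mkContinuous
      { toFun := weightedShift h.choose_spec p
        map_add' := fun x y => lp.ext (funext fun m => mul_add (a m) (x (m - p)) (y (m - p)))
        map_smul' := fun c x => lp.ext (funext fun m => mul_left_comm (a m) c (x (m - p))) }
      h.choose (norm_weightedShift_le h.choose_spec p)
  else 0

lemma wshift_apply {a : Freq d → ℂ} (h : ∃ C, ∀ m, ‖a m‖ ≤ C) (p : Freq d) (x : Seq d)
    (m : Freq d) : wshift a p x m = a m * x (m - p) := by
  rw [wshift, dif_pos h]
  rfl

lemma norm_wshift_apply_le {a : Freq d → ℂ} {C : ℝ} (ha : ∀ m, ‖a m‖ ≤ C) (p : Freq d)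
    (x : Seq d) : ‖wshift a p x‖ ≤ C * ‖x‖ := by
  have h : wshift a p x = weightedShift ha p x :=
    lp.ext (funext fun m => wshift_apply ⟨C, ha⟩ p x m)
  rw [h]
  exact norm_weightedShift_le ha p x

lemma norm_wshift_le {a : Freq d → ℂ} {C : ℝ} (ha : ∀ m, ‖a m‖ ≤ C) (p : Freq d) :
    ‖wshift a p‖ ≤ C :=
  ContinuousLinearMap.opNorm_le_bound _ ((norm_nonneg _).trans (ha 0))
    (norm_wshift_apply_le ha p)

lemma inner_wshift_left {a b : Freq d → ℂ} (ha : ∃ C, ∀ m, ‖a m‖ ≤ C)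
    (hb : ∃ C, ∀ m, ‖b m‖ ≤ C) (p : Freq d) (hab : ∀ m, b m = conj (a (m + p))) (x y : Seq d) :
    inner ℂ (wshift a p x) y = inner ℂ x (wshift b (-p) y) := by
  refine (hasSum_seq_inner _ _).unique ?_
  refine ((Equiv.subRight p).hasSum_iff.2 (hasSum_seq_inner x (wshift b (-p) y))).congr_fun ?_
  intro m
  simp only [Function.comp_apply, Equiv.subRight_apply, wshift_apply ha, wshift_apply hb, hab,
    map_mul, sub_add_cancel, sub_neg_eq_add]
  ring

/-- Pointwise convergence of uniformly bounded weights gives strong convergence of the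
multiplication operators. -/
lemma tendsto_wshift {ι : Type*} {l : Filter ι} {a : ι → Freq d → ℂ} {b : Freq d → ℂ} {C : ℝ}
    (ha : ∀ i m, ‖a i m‖ ≤ C) (hb : ∀ m, ‖b m‖ ≤ C)
    (hab : ∀ m, Tendsto (fun i => a i m) l (𝓝 (b m))) (x : Seq d) :
    Tendsto (fun i => wshift (a i) 0 x) l (𝓝 (wshift b 0 x)) := by
  rw [tendsto_iff_norm_sub_tendsto_zero]
  have h : Tendsto (fun i => ‖wshift (a i) 0 x - wshift b 0 x‖ ^ 2) l (𝓝 0) := by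
    have h1 : ∀ i, ‖wshift (a i) 0 x - wshift b 0 x‖ ^ 2
        = ∑' m, ‖(a i m - b m) * x m‖ ^ 2 := by
      intro i
      rw [← (hasSum_seq_norm_sq _).tsum_eq]
      refine tsum_congr fun m => ?_
      rw [lp.coeFn_sub, Pi.sub_apply, wshift_apply ⟨C, ha i⟩, wshift_apply ⟨C, hb⟩, sub_zero,
        sub_mul]
    simp only [h1]
    have h2 := tendsto_tsum_of_dominated_convergence (𝓕 := l)
      (f := fun i m => ‖(a i m - b m) * x m‖ ^ 2) (g := fun _ => (0 : ℝ))
      (bound := fun m => (C + C) ^ 2 * ‖x m‖ ^ 2)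
      ((hasSum_seq_norm_sq x).summable.mul_left _)
      (fun m => by
        have := (((hab m).sub_const (b m)).mul_const (x m)).norm.pow 2
        simpa using this)
      (Eventually.of_forall fun i m => by
        rw [norm_pow, norm_norm, norm_mul, mul_pow]
        gcongr
        exact (norm_sub_le _ _).trans (add_le_add (ha i m) (hb m)))
    simpa using h2
  have h3 := (Real.continuous_sqrt.tendsto 0).comp h
  simpa [Function.comp_def, Real.sqrt_sq] using h3

/-! ### Sobolev weights -/

/-- `⟨m⟩ = (1 + |m|²)^{1/2}`. -/
def br (m : Freq d) : ℝ := √(1 + normSq m)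

lemma normSq_nonneg (m : Freq d) : 0 ≤ normSq m := Finset.sum_nonneg fun _ _ => sq_nonneg _

lemma br_sq (m : Freq d) : br m ^ 2 = 1 + normSq m :=
  Real.sq_sqrt (by linarith [normSq_nonneg m])

lemma one_le_br (m : Freq d) : 1 ≤ br m :=
  Real.one_le_sqrt.2 (by linarith [normSq_nonneg m])

lemma br_pos (m : Freq d) : 0 < br m := zero_lt_one.trans_le (one_le_br m)

lemma br_ne_zero (m : Freq d) : (br m : ℂ) ≠ 0 := Complex.ofReal_ne_zero.2 (br_pos m).ne'

lemma normSq_add_le (m p : Freq d) : normSq (m + p) ≤ 2 * normSq m + 2 * normSq p := by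
  simp only [normSq, Finset.mul_sum, ← Finset.sum_add_distrib]
  refine Finset.sum_le_sum fun j _ => ?_
  push_cast [Pi.add_apply]
  nlinarith [sq_nonneg ((m j : ℝ) - p j)]

/-- Peetre's inequality with a crude constant. It bounds multiplication by `e^{ip·x}` on `H¹`. -/
lemma br_le (m p : Freq d) : br m ≤ 2 * br p ^ 2 * br (m - p) := by
  have h := normSq_add_le (m - p) p
  rw [sub_add_cancel] at h
  have h0 := normSq_nonneg p
  have h1 := normSq_nonneg (m - p)
  refine le_of_sq_le_sq ?_ (by have := br_pos (m - p); positivity)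
  rw [mul_pow, mul_pow, br_sq, br_sq, br_sq]
  nlinarith [mul_nonneg h0 h1, mul_nonneg h0 h0, mul_nonneg (mul_nonneg h0 h0) h1]

/-- `k · m`. -/
def freqDot (k m : Freq d) : ℝ := ∑ j, (k j : ℝ) * m j

lemma freqDot_sub (k m p : Freq d) : freqDot k (m - p) = freqDot k m - freqDot k p := by
  simp [freqDot, mul_sub]

lemma freqDot_neg (k m : Freq d) : freqDot k (-m) = -freqDot k m := by
  simp [freqDot]

/-- The symbol `|m + k|² / 2` of `-½ Δ - i k·∇ + |k|²/2`. -/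
def disp (k m : Freq d) : ℝ := normSq m / 2 + freqDot k m + normSq k / 2

lemma abs_freqDot_le (k m : Freq d) : |freqDot k m| ≤ (normSq k + normSq m) / 2 := by
  rw [freqDot, normSq, normSq, ← Finset.sum_add_distrib, Finset.sum_div]
  refine (Finset.abs_sum_le_sum_abs _ _).trans (Finset.sum_le_sum fun j _ => ?_)
  rw [abs_le]
  constructor <;> nlinarith [sq_nonneg ((k j : ℝ) - m j), sq_nonneg ((k j : ℝ) + m j)]

/-- A weight is bounded. -/
def BddWeight (a : Freq d → ℂ) : Prop := ∃ C, ∀ m, ‖a m‖ ≤ C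

lemma bddWeight_inv_br : BddWeight fun m : Freq d => ((br m)⁻¹ : ℂ) :=
  ⟨1, fun m => by
    rw [norm_inv, Complex.norm_real, Real.norm_of_nonneg (br_pos m).le]
    exact inv_le_one_of_one_le₀ (one_le_br m)⟩

lemma bddWeight_div_br_sq {a : Freq d → ℝ} {C : ℝ} (ha : ∀ m, |a m| ≤ C * br m ^ 2) :
    BddWeight fun m : Freq d => ((a m / br m ^ 2 : ℝ) : ℂ) :=
  ⟨C, fun m => by
    have := br_pos m
    rw [Complex.norm_real, Real.norm_eq_abs, abs_div, abs_of_pos (pow_pos this 2),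
      div_le_iff₀ (by positivity)]
    exact ha m⟩

lemma abs_normSq_half_le (m : Freq d) : |normSq m / 2| ≤ 1 * br m ^ 2 := by
  rw [br_sq, abs_of_nonneg (by linarith [normSq_nonneg m])]
  linarith [normSq_nonneg m]

lemma abs_freqDot_le_br (k m : Freq d) : |freqDot k m| ≤ (1 + normSq k) * br m ^ 2 := by
  have h := abs_freqDot_le k m
  rw [br_sq]
  nlinarith [normSq_nonneg m, normSq_nonneg k, mul_nonneg (normSq_nonneg k) (normSq_nonneg m)]

lemma abs_disp_le_br (k m : Freq d) : |disp k m| ≤ (2 + 2 * normSq k) * br m ^ 2 := by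
  have h := abs_freqDot_le k m
  have h1 := normSq_nonneg m
  have h2 := normSq_nonneg k
  have h3 := mul_nonneg h1 h2
  rw [br_sq, disp]
  rw [abs_le] at h ⊢
  constructor <;> nlinarith

lemma bddWeight_div_br (p : Freq d) :
    BddWeight fun m : Freq d => ((br m / br (m - p) : ℝ) : ℂ) :=
  ⟨2 * br p ^ 2, fun m => by
    have h1 := br_pos m
    have h2 := br_pos (m - p)
    rw [Complex.norm_real, Real.norm_of_nonneg (by positivity), div_le_iff₀ h2]
    exact br_le m p⟩

lemma bddWeight_one : BddWeight fun _ : Freq d => (1 : ℂ) := ⟨1, fun m => by simp⟩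

/-! ### Operators on `H¹` in weighted Fourier coordinates -/

/-- The inclusion of `H¹` into `L²`. -/
def embL2 : Seq d →L[ℂ] Seq d := wshift (fun m => ((br m)⁻¹ : ℂ)) 0

/-- The operator of `H¹` with quadratic form `a(-i∇)`, for a real symbol `a`. -/
def formOp (a : Freq d → ℝ) : Seq d →L[ℂ] Seq d := wshift (fun m => ((a m / br m ^ 2 : ℝ) : ℂ)) 0

/-- The operator of `H¹` representing the `L²` inner product. -/
def gramL2 : Seq d →L[ℂ] Seq d := formOp fun _ => 1

/-- Multiplication by the exponential of frequency `p`, on `L²`. -/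
def modL2 (p : Freq d) : Seq d →L[ℂ] Seq d := wshift (fun _ => 1) p

/-- Multiplication by the exponential of frequency `p`, on `H¹`. -/
def modH1 (p : Freq d) : Seq d →L[ℂ] Seq d :=
  wshift (fun m => ((br m / br (m - p) : ℝ) : ℂ)) p

lemma embL2_apply (x : Seq d) (m : Freq d) : embL2 x m = (br m : ℂ)⁻¹ * x m := by
  rw [embL2, wshift_apply bddWeight_inv_br, sub_zero]

lemma formOp_apply {a : Freq d → ℝ} {C : ℝ} (ha : ∀ m, |a m| ≤ C * br m ^ 2) (x : Seq d)
    (m : Freq d) : formOp a x m = ((a m / br m ^ 2 : ℝ) : ℂ) * x m := by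
  rw [formOp, wshift_apply (bddWeight_div_br_sq ha), sub_zero]

lemma abs_one_le_br (m : Freq d) : |(1 : ℝ)| ≤ 1 * br m ^ 2 := by
  rw [br_sq, abs_one]
  linarith [normSq_nonneg m]

lemma gramL2_apply (x : Seq d) (m : Freq d) : gramL2 x m = (br m : ℂ)⁻¹ ^ 2 * x m := by
  rw [gramL2, formOp_apply abs_one_le_br]
  push_cast
  rw [one_div, inv_pow]

lemma modL2_apply (p : Freq d) (x : Seq d) (m : Freq d) : modL2 p x m = x (m - p) := by
  rw [modL2, wshift_apply bddWeight_one, one_mul]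

lemma modH1_apply (p : Freq d) (x : Seq d) (m : Freq d) :
    modH1 p x m = (br m / br (m - p) : ℂ) * x (m - p) := by
  rw [modH1, wshift_apply (bddWeight_div_br p), Complex.ofReal_div]

lemma embL2_modH1 (p : Freq d) (x : Seq d) : embL2 (modH1 p x) = modL2 p (embL2 x) := by
  ext m
  rw [embL2_apply, modH1_apply, modL2_apply, embL2_apply]
  have := br_ne_zero m
  field_simp

lemma norm_embL2_le (x : Seq d) : ‖embL2 x‖ ≤ ‖x‖ := by
  have := norm_wshift_apply_le (C := 1) (a := fun m : Freq d => ((br m)⁻¹ : ℂ)) (fun m => by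
    rw [norm_inv, Complex.norm_real, Real.norm_of_nonneg (br_pos m).le]
    exact inv_le_one_of_one_le₀ (one_le_br m)) 0 x
  simpa [embL2] using this

lemma norm_modL2_le (p : Freq d) (x : Seq d) : ‖modL2 p x‖ ≤ ‖x‖ := by
  have h := norm_wshift_apply_le (C := 1) (a := fun _ : Freq d => (1 : ℂ)) (fun m => by simp) p x
  rwa [one_mul] at h

lemma norm_modH1_le (p : Freq d) : ‖modH1 p‖ ≤ 2 * br p ^ 2 :=
  norm_wshift_le (fun m => by
    have h1 := br_pos m
    have h2 := br_pos (m - p)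
    rw [Complex.norm_real, Real.norm_of_nonneg (by positivity), div_le_iff₀ h2]
    exact br_le m p) p

lemma inner_formOp_left {a : Freq d → ℝ} {C : ℝ} (ha : ∀ m, |a m| ≤ C * br m ^ 2)
    (x y : Seq d) : inner ℂ (formOp a x) y = inner ℂ x (formOp a y) := by
  have h := inner_wshift_left (bddWeight_div_br_sq ha) (bddWeight_div_br_sq ha) 0
    (fun m => by rw [Complex.conj_ofReal, add_zero]) x y
  rwa [neg_zero] at h

lemma inner_embL2_left (x y : Seq d) : inner ℂ (embL2 x) y = inner ℂ x (embL2 y) := by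
  have h := inner_wshift_left (d := d) bddWeight_inv_br bddWeight_inv_br 0
    (fun m => by rw [map_inv₀, Complex.conj_ofReal, add_zero]) x y
  rwa [neg_zero] at h

lemma embL2_embL2 (x : Seq d) : embL2 (embL2 x) = gramL2 x := by
  ext m
  rw [embL2_apply, embL2_apply, gramL2_apply]
  ring

lemma inner_gramL2_right (x y : Seq d) :
    inner ℂ x (gramL2 y) = inner ℂ (embL2 x) (embL2 y) := by
  rw [inner_embL2_left, embL2_embL2]

lemma inner_gramL2_left (x y : Seq d) :
    inner ℂ (gramL2 x) y = inner ℂ (embL2 x) (embL2 y) := by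
  rw [← inner_gramL2_right, gramL2, inner_formOp_left abs_one_le_br]

lemma inner_modL2_left (p : Freq d) (x y : Seq d) :
    inner ℂ (modL2 p x) y = inner ℂ x (modL2 (-p) y) :=
  inner_wshift_left bddWeight_one bddWeight_one p (fun m => by simp) x y

/-- Multiplication by `e^{ip·x}` has adjoint `e^{-ip·x}` in `L²` but not in `H¹`; inserting `gramL2`
turns the `H¹` product into the `L²` one. -/
lemma inner_gramL2_modH1 (p : Freq d) (x y : Seq d) :
    inner ℂ (gramL2 x) (modH1 p y) = inner ℂ (modH1 (-p) x) (gramL2 y) := by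
  rw [inner_gramL2_left, inner_gramL2_right, embL2_modH1, embL2_modH1, inner_modL2_left, neg_neg]

/-! ### The Hartree nonlinearity on sequences -/

/-- The Fourier coefficients of the density `|u|²`. -/
def rho (p : Freq d) (x : Seq d) : ℂ := inner ℂ (modH1 p x) (gramL2 x)

lemma rho_eq (p : Freq d) (x : Seq d) :
    rho p x = inner ℂ (modL2 p (embL2 x)) (embL2 x) := by
  rw [rho, inner_gramL2_right, embL2_modH1]

lemma rho_neg (p : Freq d) (x : Seq d) : rho (-p) x = conj (rho p x) := by
  rw [rho_eq, rho_eq, inner_conj_symm, inner_modL2_left, neg_neg]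

/-- The bound involves the mass only. This is why the nonlinearity grows linearly in `H¹` at fixed
mass. -/
lemma norm_rho_le (p : Freq d) (x : Seq d) : ‖rho p x‖ ≤ ‖embL2 x‖ ^ 2 := by
  rw [rho_eq, sq]
  exact (norm_inner_le_norm _ _).trans
    (mul_le_mul_of_nonneg_right (norm_modL2_le _ _) (norm_nonneg _))

lemma norm_rho_sub_le (p : Freq d) (x y : Seq d) :
    ‖rho p x - rho p y‖ ≤ (‖x‖ + ‖y‖) * ‖x - y‖ := by
  have h : rho p x - rho p y = inner ℂ (modL2 p (embL2 (x - y))) (embL2 x)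
      + inner ℂ (modL2 p (embL2 y)) (embL2 (x - y)) := by
    rw [rho_eq, rho_eq, map_sub, map_sub, inner_sub_left, inner_sub_right]
    ring
  have h1 : ∀ a b : Seq d, ‖inner ℂ (modL2 p (embL2 a)) (embL2 b)‖ ≤ ‖a‖ * ‖b‖ := fun a b =>
    (norm_inner_le_norm _ _).trans (mul_le_mul ((norm_modL2_le _ _).trans (norm_embL2_le a))
      (norm_embL2_le b) (norm_nonneg _) (norm_nonneg _))
  rw [h]
  refine (norm_add_le _ _).trans ((add_le_add (h1 _ _) (h1 _ _)).trans_eq ?_)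
  ring

lemma rho_zero (x : Seq d) : rho 0 x = (‖embL2 x‖ ^ 2 : ℝ) := by
  have h : modL2 0 (embL2 x) = embL2 x := by
    ext m
    rw [modL2_apply, sub_zero]
  rw [rho_eq, h, inner_self_eq_norm_sq_to_K]
  simp

/-- The Fourier coefficients of an admissible interaction kernel. -/
structure IsKernel (s : Freq d → ℝ) : Prop where
  nonneg : ∀ p, 0 ≤ s p
  even : ∀ p, s (-p) = s p
  summable : Summable fun p => s p * br p ^ 2

/-- The convolution constant of a kernel. -/
def kernelConst (s : Freq d → ℝ) : ℝ := ∑' p, s p * (2 * br p ^ 2)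

/-- Multiplication by the convolution of the kernel with `|u|²`, on `H¹`. -/
def hartreeOp (s : Freq d → ℝ) (x : Seq d) : Seq d →L[ℂ] Seq d :=
  ∑' p, ((s p : ℂ) * rho p x) • modH1 p

namespace IsKernel

variable {s : Freq d → ℝ}

lemma hasSum_const (hs : IsKernel s) : HasSum (fun p => s p * (2 * br p ^ 2)) (kernelConst s) := by
  have h : Summable fun p => s p * (2 * br p ^ 2) := by
    refine (hs.summable.mul_left 2).congr fun p => ?_
    ring
  exact h.hasSum

lemma const_nonneg (hs : IsKernel s) : 0 ≤ kernelConst s :=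
  hs.hasSum_const.nonneg fun p => mul_nonneg (hs.nonneg p) (by positivity)

lemma norm_term_le (hs : IsKernel s) (p : Freq d) (c : ℂ) :
    ‖((s p : ℂ) * c) • modH1 p‖ ≤ s p * (2 * br p ^ 2) * ‖c‖ := by
  rw [norm_smul, norm_mul, Complex.norm_real, Real.norm_of_nonneg (hs.nonneg p)]
  calc s p * ‖c‖ * ‖modH1 p‖ ≤ s p * ‖c‖ * (2 * br p ^ 2) :=
        mul_le_mul_of_nonneg_left (norm_modH1_le p)
          (mul_nonneg (hs.nonneg p) (norm_nonneg _))
    _ = _ := by ring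

lemma hasSum_of_bound (hs : IsKernel s) {c : Freq d → ℂ} {B : ℝ} (hc : ∀ p, ‖c p‖ ≤ B) :
    Summable (fun p => ((s p : ℂ) * c p) • modH1 p) ∧
      ‖∑' p, ((s p : ℂ) * c p) • modH1 p‖ ≤ kernelConst s * B := by
  have h1 : ∀ p, ‖((s p : ℂ) * c p) • modH1 p‖ ≤ s p * (2 * br p ^ 2) * B := fun p =>
    (hs.norm_term_le p (c p)).trans (mul_le_mul_of_nonneg_left (hc p)
      (mul_nonneg (hs.nonneg p) (by positivity)))
  exact ⟨.of_norm_bounded (hs.hasSum_const.mul_right B).summable h1,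
    tsum_of_norm_bounded (hs.hasSum_const.mul_right B) h1⟩

lemma hasSum_hartreeOp (hs : IsKernel s) (x : Seq d) :
    HasSum (fun p => ((s p : ℂ) * rho p x) • modH1 p) (hartreeOp s x) :=
  (hs.hasSum_of_bound fun p => norm_rho_le p x).1.hasSum

lemma norm_hartreeOp_le (hs : IsKernel s) (x : Seq d) :
    ‖hartreeOp s x‖ ≤ kernelConst s * ‖embL2 x‖ ^ 2 :=
  (hs.hasSum_of_bound fun p => norm_rho_le p x).2

lemma norm_hartreeOp_sub_le (hs : IsKernel s) (x y : Seq d) :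
    ‖hartreeOp s x - hartreeOp s y‖ ≤ kernelConst s * ((‖x‖ + ‖y‖) * ‖x - y‖) := by
  have h := ((hs.hasSum_hartreeOp x).sub (hs.hasSum_hartreeOp y)).tsum_eq
  rw [← h]
  refine le_trans (le_of_eq ?_) (hs.hasSum_of_bound fun p => norm_rho_sub_le p x y).2
  congr 1
  refine tsum_congr fun p => ?_
  rw [← sub_smul, mul_sub]

lemma continuous_hartreeOp (hs : IsKernel s) : Continuous (hartreeOp s) := by
  refine continuous_iff_continuousAt.2 fun y => ?_
  rw [ContinuousAt, tendsto_iff_norm_sub_tendsto_zero]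
  have h : Tendsto (fun x : Seq d => kernelConst s * ((‖x‖ + ‖y‖) * ‖x - y‖)) (𝓝 y) (𝓝 0) := by
    have : Continuous fun x : Seq d => kernelConst s * ((‖x‖ + ‖y‖) * ‖x - y‖) := by fun_prop
    simpa using this.tendsto y
  exact squeeze_zero (fun _ => norm_nonneg _) (fun x => hs.norm_hartreeOp_sub_le x y) h

lemma hasSum_hartreeOp_apply (hs : IsKernel s) (x y : Seq d) :
    HasSum (fun p => ((s p : ℂ) * rho p x) • modH1 p y) (hartreeOp s x y) := by
  simpa using (ContinuousLinearMap.apply ℂ (Seq d) y).hasSum (hs.hasSum_hartreeOp x)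

lemma hasSum_inner_hartreeOp (hs : IsKernel s) (x y z : Seq d) :
    HasSum (fun p => (s p : ℂ) * rho p x * inner ℂ z (modH1 p y))
      (inner ℂ z (hartreeOp s x y)) := by
  simpa [inner_smul_right] using (innerSL ℂ z).hasSum (hs.hasSum_hartreeOp_apply x y)

/-- Multiplication by a real potential is symmetric for the `L²` inner product. -/
lemma inner_gramL2_hartreeOp (hs : IsKernel s) (x y z : Seq d) :
    inner ℂ (gramL2 y) (hartreeOp s x z) = inner ℂ (hartreeOp s x y) (gramL2 z) := by
  have h1 := hs.hasSum_inner_hartreeOp x z (gramL2 y)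
  have h2 := (Complex.hasSum_conj'.2 (hs.hasSum_inner_hartreeOp x y (gramL2 z)))
  rw [inner_conj_symm] at h2
  refine h1.unique (((Equiv.neg (Freq d)).hasSum_iff.2 h2).congr_fun fun p => ?_)
  simp only [Function.comp_apply, Equiv.neg_apply, map_mul, Complex.conj_ofReal, hs.even,
    rho_neg, Complex.conj_conj, inner_conj_symm]
  rw [inner_gramL2_modH1]

lemma hasSum_density_pairing (hs : IsKernel s) (x y : Seq d) :
    HasSum (fun p => (s p : ℂ) * rho p x * conj (rho p y))
      (inner ℂ (gramL2 y) (hartreeOp s x y)) := by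
  refine (hs.hasSum_inner_hartreeOp x y (gramL2 y)).congr_fun fun p => ?_
  rw [rho, rho, inner_conj_symm]

/-- Both sides are `∫ (Σ ⋆ |x|²)|y|²`; exchanging the densities amounts to `p ↦ -p`, under which the
kernel is even. -/
lemma inner_hartreeOp_symm (hs : IsKernel s) (x y : Seq d) :
    inner ℂ (gramL2 y) (hartreeOp s x y) = inner ℂ (gramL2 x) (hartreeOp s y x) := by
  have h2 := (Equiv.neg (Freq d)).hasSum_iff.2 (hs.hasSum_density_pairing y x)
  refine (hs.hasSum_density_pairing x y).unique (h2.congr_fun fun p => ?_)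
  simp only [Function.comp_apply, Equiv.neg_apply, hs.even, rho_neg, Complex.conj_conj]
  ring

lemma im_inner_gramL2_hartreeOp (hs : IsKernel s) (x y : Seq d) :
    (inner ℂ (gramL2 y) (hartreeOp s x y)).im = 0 := by
  rw [← Complex.conj_eq_iff_im, inner_conj_symm, ← hs.inner_gramL2_hartreeOp]

end IsKernel

/-- The commutator of `-i k·∇` with `e^{ip·x}` is the scalar `k·p` times `e^{ip·x}`; here it appears
as `k·m = k·(m - p) + k·p` under the sum. -/
lemma inner_freqDot_modH1 (k p : Freq d) (x : Seq d) :
    inner ℂ (formOp (freqDot k) x) (modH1 p x)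
      = inner ℂ (modH1 (-p) x) (formOp (freqDot k) x) + freqDot k p * conj (rho p x) := by
  have h1 := hasSum_seq_inner (formOp (freqDot k) x) (modH1 p x)
  have h2 := (Equiv.subRight p).hasSum_iff.2
    (hasSum_seq_inner (modH1 (-p) x) (formOp (freqDot k) x))
  have h3 := (hasSum_seq_inner (embL2 x) (modL2 p (embL2 x))).mul_left (freqDot k p : ℂ)
  rw [rho_eq, inner_conj_symm]
  refine h1.unique ((h2.add h3).congr_fun fun m => ?_)
  have e1 := br_ne_zero m
  have e2 := br_ne_zero (m - p)
  simp only [Function.comp_apply, Equiv.subRight_apply, formOp_apply (abs_freqDot_le_br k),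
    modH1_apply, modL2_apply, embL2_apply, map_mul, map_div₀, map_inv₀, Complex.conj_ofReal,
    sub_neg_eq_add, sub_add_cancel, freqDot_sub]
  push_cast
  field_simp
  ring

/-- Conservation of momentum. -/
lemma IsKernel.im_inner_freqDot_hartreeOp {s : Freq d → ℝ} (hs : IsKernel s) (k : Freq d)
    (x : Seq d) : (inner ℂ (formOp (freqDot k) x) (hartreeOp s x x)).im = 0 := by
  have h1 := hs.hasSum_inner_hartreeOp x x (formOp (freqDot k) x)
  have h2 := (Equiv.neg (Freq d)).hasSum_iff.2 (Complex.hasSum_conj'.2 h1)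
  have h3 : HasSum (fun p => (s p : ℂ) * rho p x * (freqDot k p * conj (rho p x)))
      (inner ℂ (formOp (freqDot k) x) (hartreeOp s x x)
        - conj (inner ℂ (formOp (freqDot k) x) (hartreeOp s x x))) := by
    refine (h1.sub h2).congr_fun fun p => ?_
    simp only [Function.comp_apply, Equiv.neg_apply, map_mul, Complex.conj_ofReal, hs.even,
      rho_neg, Complex.conj_conj, inner_conj_symm]
    rw [inner_freqDot_modH1 k p]
    ring
  have h4 := (Equiv.neg (Freq d)).hasSum_iff.2 h3
  -- The summand `s_p (k·p) |ρ_p|²` is odd in `p`, so adding the series to its reflection gives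
  -- zero.
  have h5 := (h3.add h4).unique (f := fun p => (s p : ℂ) * rho p x * (freqDot k p * conj (rho p x))
    + ((fun p => (s p : ℂ) * rho p x * (freqDot k p * conj (rho p x))) ∘ Equiv.neg (Freq d)) p)
    (hasSum_zero.congr_fun fun p => by
      simp only [Function.comp_apply, Equiv.neg_apply, hs.even, rho_neg, Complex.conj_conj,
        freqDot_neg, Complex.ofReal_neg]
      ring)
  rw [← two_mul, mul_eq_zero, or_iff_right two_ne_zero, sub_eq_zero] at h5
  exact Complex.conj_eq_iff_im.1 h5.symm

/-! ### The free evolution -/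

lemma norm_exp_neg_I_mul (r : ℝ) : ‖Complex.exp (-(Complex.I * r))‖ = 1 := by
  rw [Complex.norm_exp]
  simp

/-- The free Schrödinger evolution. -/
def free (k : Freq d) (t : ℝ) : Seq d →L[ℂ] Seq d :=
  wshift (fun m => Complex.exp (-(Complex.I * (t * disp k m : ℝ)))) 0

lemma free_apply (k : Freq d) (t : ℝ) (x : Seq d) (m : Freq d) :
    free k t x m = Complex.exp (-(Complex.I * (t * disp k m : ℝ))) * x m := by
  rw [free, wshift_apply ⟨1, fun m => (norm_exp_neg_I_mul _).le⟩, sub_zero]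

lemma free_zero (k : Freq d) (x : Seq d) : free k 0 x = x := by
  ext m
  simp [free_apply]

lemma free_add (k : Freq d) (t r : ℝ) (x : Seq d) : free k t (free k r x) = free k (t + r) x := by
  ext m
  rw [free_apply, free_apply, free_apply, ← mul_assoc, ← Complex.exp_add]
  congr 2
  push_cast
  ring

lemma free_neg_free (k : Freq d) (t : ℝ) (x : Seq d) : free k (-t) (free k t x) = x := by
  rw [free_add, neg_add_cancel, free_zero]

lemma free_free_neg (k : Freq d) (t : ℝ) (x : Seq d) : free k t (free k (-t) x) = x := by
  rw [free_add, add_neg_cancel, free_zero]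

lemma norm_free (k : Freq d) (t : ℝ) (x : Seq d) : ‖free k t x‖ = ‖x‖ := by
  have h : ∀ r (y : Seq d), ‖free k r y‖ ≤ ‖y‖ := fun r y => by
    have := norm_wshift_apply_le (C := 1)
      (a := fun m : Freq d => Complex.exp (-(Complex.I * (r * disp k m : ℝ))))
      (fun m => (norm_exp_neg_I_mul _).le) 0 y
    rwa [one_mul] at this
  refine le_antisymm (h t x) ?_
  conv_lhs => rw [← free_neg_free k t x]
  exact h _ _

lemma inner_free_left (k : Freq d) (t : ℝ) (x y : Seq d) :
    inner ℂ (free k t x) y = inner ℂ x (free k (-t) y) := by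
  have h := inner_wshift_left (d := d)
    (a := fun m : Freq d => Complex.exp (-(Complex.I * (t * disp k m : ℝ))))
    (b := fun m : Freq d => Complex.exp (-(Complex.I * (-t * disp k m : ℝ))))
    ⟨1, fun m => (norm_exp_neg_I_mul _).le⟩ ⟨1, fun m => (norm_exp_neg_I_mul _).le⟩ 0
    (fun m => by
      rw [← Complex.exp_conj, map_neg, map_mul, Complex.conj_I, Complex.conj_ofReal, add_zero]
      congr 1
      push_cast
      ring) x y
  rwa [neg_zero] at h

lemma formOp_free {a : Freq d → ℝ} {C : ℝ} (ha : ∀ m, |a m| ≤ C * br m ^ 2) (k : Freq d) (t : ℝ)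
    (x : Seq d) : formOp a (free k t x) = free k t (formOp a x) := by
  ext m
  rw [formOp_apply ha, free_apply, free_apply, formOp_apply ha]
  ring

lemma embL2_free (k : Freq d) (t : ℝ) (x : Seq d) : embL2 (free k t x) = free k t (embL2 x) := by
  ext m
  rw [embL2_apply, free_apply, free_apply, embL2_apply]
  ring

lemma continuous_free_apply (k : Freq d) (x : Seq d) : Continuous fun t => free k t x := by
  refine continuous_iff_continuousAt.2 fun t => ?_
  refine tendsto_wshift (C := 1) (fun r m => (norm_exp_neg_I_mul _).le)
    (fun m => (norm_exp_neg_I_mul _).le) (fun m => ?_) x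
  have : Continuous fun r : ℝ => Complex.exp (-(Complex.I * (r * disp k m : ℝ))) := by fun_prop
  exact this.tendsto t

/-- The flow is only strongly continuous in time; being isometric, it is nevertheless jointly
continuous. -/
lemma tendsto_free {ι : Type*} {l : Filter ι} (k : Freq d) {τ : ι → ℝ} {t : ℝ} {x : ι → Seq d}
    {y : Seq d} (hτ : Tendsto τ l (𝓝 t)) (hx : Tendsto x l (𝓝 y)) :
    Tendsto (fun i => free k (τ i) (x i)) l (𝓝 (free k t y)) := by
  have h1 : Tendsto (fun i => free k (τ i) (x i - y)) l (𝓝 0) := by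
    rw [tendsto_zero_iff_norm_tendsto_zero]
    simp only [norm_free]
    exact tendsto_iff_norm_sub_tendsto_zero.1 hx
  have h2 := h1.add (((continuous_free_apply k y).tendsto t).comp hτ)
  simpa [Function.comp_def, map_sub] using h2

lemma continuousOn_free {S : Set ℝ} (k : Freq d) {τ : ℝ → ℝ} {x : ℝ → Seq d}
    (hτ : ContinuousOn τ S) (hx : ContinuousOn x S) :
    ContinuousOn (fun t => free k (τ t) (x t)) S := fun t ht => tendsto_free k (hτ t ht) (hx t ht)

lemma norm_exp_neg_I_sub_le (a b : ℝ) :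
    ‖Complex.exp (-(Complex.I * a)) - Complex.exp (-(Complex.I * b))‖ ≤ |a - b| := by
  have h : Complex.exp (-(Complex.I * a)) - Complex.exp (-(Complex.I * b))
      = Complex.exp (-(Complex.I * b)) * (Complex.exp (Complex.I * (b - a : ℝ)) - 1) := by
    rw [mul_sub, ← Complex.exp_add, mul_one]
    congr 2
    push_cast
    ring
  rw [h, norm_mul, norm_exp_neg_I_mul, one_mul, abs_sub_comm]
  exact Real.norm_exp_I_mul_ofReal_sub_one_le

/-- The free evolution is differentiable with values in `H⁻¹`. -/
lemma hasDerivAt_gramL2_free (k : Freq d) (x : Seq d) (t : ℝ) :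
    HasDerivAt (fun r => gramL2 (free k r x)) (-(Complex.I • formOp (disp k) (free k t x))) t := by
  rw [hasDerivAt_iff_tendsto_slope]
  -- The difference quotient and its limit are multipliers. The two powers of `⟨m⟩⁻¹` from `gramL2`
  -- absorb the quadratic growth of `disp`, so they are bounded uniformly in `r` and pointwise
  -- convergence suffices.
  let a : ℝ → Freq d → ℂ := fun r m => ((r - t)⁻¹ : ℝ) *
    (Complex.exp (-(Complex.I * (r * disp k m : ℝ)))
      - Complex.exp (-(Complex.I * (t * disp k m : ℝ)))) * (br m : ℂ)⁻¹ ^ 2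
  let b : Freq d → ℂ := fun m => -(Complex.I * (disp k m / br m ^ 2 : ℝ)
    * Complex.exp (-(Complex.I * (t * disp k m : ℝ))))
  have hbr : ∀ m : Freq d, ‖(br m : ℂ)⁻¹ ^ 2‖ = (br m ^ 2)⁻¹ := fun m => by
    rw [norm_pow, norm_inv, Complex.norm_real, Real.norm_of_nonneg (br_pos m).le, inv_pow]
  have hdiv : ∀ m : Freq d, |disp k m| * (br m ^ 2)⁻¹ ≤ 2 + 2 * normSq k := fun m => by
    have := br_pos m
    rw [← div_eq_mul_inv, div_le_iff₀ (by positivity)]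
    exact abs_disp_le_br k m
  have ha : ∀ r m, ‖a r m‖ ≤ 2 + 2 * normSq k := by
    intro r m
    have h1 := norm_exp_neg_I_sub_le (r * disp k m) (t * disp k m)
    rw [← sub_mul, abs_mul] at h1
    simp only [a]
    rw [norm_mul, norm_mul, hbr, Complex.norm_real, Real.norm_eq_abs, abs_inv]
    refine le_trans ?_ (hdiv m)
    have h2 : |r - t|⁻¹ * (|r - t| * |disp k m|) ≤ |disp k m| := by
      rw [← mul_assoc]
      exact mul_le_of_le_one_left (abs_nonneg _) inv_mul_le_one
    have h3 := (mul_le_mul_of_nonneg_left h1 (inv_nonneg.2 (abs_nonneg (r - t)))).trans h2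
    exact mul_le_mul_of_nonneg_right h3 (by positivity)
  have hb : ∀ m, ‖b m‖ ≤ 2 + 2 * normSq k := by
    intro m
    simp only [b]
    rw [norm_neg, norm_mul, norm_mul, norm_exp_neg_I_mul, Complex.norm_I, Complex.norm_real,
      Real.norm_eq_abs, one_mul, mul_one, abs_div, abs_of_nonneg (sq_nonneg (br m)),
      div_eq_mul_inv]
    exact hdiv m
  have hab : ∀ m, Tendsto (fun r => a r m) (𝓝[≠] t) (𝓝 (b m)) := by
    intro m
    have h1 : HasDerivAt (fun r : ℝ => Complex.exp (-(Complex.I * (r * disp k m : ℝ))))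
        (Complex.exp (-(Complex.I * (t * disp k m : ℝ))) * (-(Complex.I * (disp k m : ℝ)))) t := by
      have h0 : HasDerivAt (fun r : ℝ => ((r * disp k m : ℝ) : ℂ)) ((disp k m : ℝ) : ℂ) t := by
        have := ((hasDerivAt_id t).mul_const (disp k m)).ofReal_comp
        simpa using this
      exact ((h0.const_mul Complex.I).neg).cexp
    have h2 := (hasDerivAt_iff_tendsto_slope.1 h1).mul_const ((br m : ℂ)⁻¹ ^ 2)
    refine (h2.congr fun r => ?_).trans (le_of_eq ?_)
    · simp only [a, slope_def_module, Complex.real_smul]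
    · congr 1
      simp only [b]
      push_cast
      have := br_ne_zero m
      field_simp
  have h := tendsto_wshift ha hb hab x
  refine (h.congr' ?_).trans (le_of_eq ?_)
  · refine Eventually.of_forall fun r => ?_
    ext m
    rw [wshift_apply ⟨_, ha r⟩, slope_def_module, lp.coeFn_smul, Pi.smul_apply, lp.coeFn_sub,
      Pi.sub_apply, gramL2_apply, gramL2_apply, free_apply, free_apply, Complex.real_smul, sub_zero]
    simp only [a]
    ring
  · congr 1
    ext m
    rw [wshift_apply ⟨_, hb⟩, lp.coeFn_neg, Pi.neg_apply, lp.coeFn_smul, Pi.smul_apply,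
      formOp_apply (abs_disp_le_br k), free_apply, smul_eq_mul, sub_zero]
    simp only [b]
    ring

lemma seq_map_real_smul (L : Seq d →L[ℂ] Seq d) (c : ℝ) (x : Seq d) : L (c • x) = c • L x :=
  (L.restrictScalars ℝ).map_smul c x

lemma hasDerivWithinAt_clm_seq (L : Seq d →L[ℂ] Seq d) {w : ℝ → Seq d} {w' : Seq d} {S : Set ℝ}
    {t : ℝ} (hw : HasDerivWithinAt w w' S t) : HasDerivWithinAt (fun r => L (w r)) (L w') S t :=
  (L.restrictScalars ℝ).hasFDerivAt.comp_hasDerivWithinAt t hw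

/-- A Leibniz rule: the slope is that of the free orbit of the frozen vector `w t` plus `free k r`
applied to the slope of `w`. -/
lemma hasDerivWithinAt_gramL2_free (k : Freq d) {w : ℝ → Seq d} {w' : Seq d} {S : Set ℝ} {t : ℝ}
    (hw : HasDerivWithinAt w w' S t) :
    HasDerivWithinAt (fun r => gramL2 (free k r (w r)))
      (-(Complex.I • formOp (disp k) (free k t (w t))) + gramL2 (free k t w')) S t := by
  have h1 := (hasDerivAt_gramL2_free k (w t) t).hasDerivWithinAt (s := S)
  rw [hasDerivWithinAt_iff_tendsto_slope] at h1 hw ⊢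
  have hid : Tendsto (fun r : ℝ => r) (𝓝[S \ {t}] t) (𝓝 t) := tendsto_id.mono_left nhdsWithin_le_nhds
  have h2 := (gramL2.continuous.tendsto _).comp (tendsto_free k hid hw)
  refine (h1.add h2).congr fun r => ?_
  simp only [Function.comp_apply, slope_def_module, seq_map_real_smul, map_sub]
  module

/-! ### The equation on sequences -/

/-- The field of the equation in the interaction picture. -/
def interactionField (k : Freq d) (g : ℝ) (s : Freq d → ℝ) (t : ℝ) (x : Seq d) : Seq d :=
  (Complex.I * g) • free k (-t) (hartreeOp s (free k t x) (free k t x))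

lemma seq_real_inner_eq (x y : Seq d) : inner ℝ x y = (inner ℂ x y).re := by
  have h1 := lp.hasSum_inner (𝕜 := ℝ) x y
  have h2 := Complex.hasSum_re (lp.hasSum_inner (𝕜 := ℂ) x y)
  exact h1.unique h2

/-! ### Estimates for the interaction field and global existence -/

namespace IsKernel

variable {s : Freq d → ℝ}

lemma norm_cubic_sub_le (hs : IsKernel s) {R : ℝ} {x y : Seq d} (hx : ‖x‖ ≤ R) (hy : ‖y‖ ≤ R) :
    ‖hartreeOp s x x - hartreeOp s y y‖ ≤ kernelConst s * (3 * R ^ 2) * ‖x - y‖ := by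
  have h : hartreeOp s x x - hartreeOp s y y
      = (hartreeOp s x - hartreeOp s y) x + hartreeOp s y (x - y) := by
    rw [sub_apply, map_sub]
    abel
  have hR : 0 ≤ R := (norm_nonneg x).trans hx
  have h1 : ‖(hartreeOp s x - hartreeOp s y) x‖ ≤ kernelConst s * ((R + R) * ‖x - y‖) * R := by
    refine ((hartreeOp s x - hartreeOp s y).le_opNorm x).trans ?_
    refine mul_le_mul ((hs.norm_hartreeOp_sub_le x y).trans ?_) hx (norm_nonneg _)
      (mul_nonneg hs.const_nonneg (by positivity))
    exact mul_le_mul_of_nonneg_left (mul_le_mul_of_nonneg_right (add_le_add hx hy)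
      (norm_nonneg _)) hs.const_nonneg
  have h2 : ‖hartreeOp s y (x - y)‖ ≤ kernelConst s * R ^ 2 * ‖x - y‖ := by
    refine ((hartreeOp s y).le_opNorm _).trans (mul_le_mul_of_nonneg_right ?_ (norm_nonneg _))
    refine (hs.norm_hartreeOp_le y).trans (mul_le_mul_of_nonneg_left ?_ hs.const_nonneg)
    exact pow_le_pow_left₀ (norm_nonneg _) ((norm_embL2_le y).trans hy) 2
  rw [h]
  refine (norm_add_le _ _).trans ((add_le_add h1 h2).trans_eq ?_)
  ring

lemma lipschitz_interactionField (hs : IsKernel s) (k : Freq d) (g : ℝ) (R : ℝ) :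
    ∃ K : ℝ≥0, ∀ t, LipschitzOnWith K (interactionField k g s t) (Metric.closedBall 0 R) := by
  refine ⟨⟨|g| * (kernelConst s * (3 * R ^ 2)), mul_nonneg (abs_nonneg _)
    (mul_nonneg hs.const_nonneg (by positivity))⟩, fun t => ?_⟩
  refine LipschitzOnWith.of_dist_le_mul fun x hx y hy => ?_
  rw [mem_closedBall_zero_iff] at hx hy
  rw [dist_eq_norm, dist_eq_norm, interactionField, interactionField, ← smul_sub, norm_smul,
    ← map_sub, norm_free, norm_mul, Complex.norm_I, one_mul, Complex.norm_real, Real.norm_eq_abs]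
  have h := hs.norm_cubic_sub_le (R := R) (x := free k t x) (y := free k t y)
    (by rwa [norm_free]) (by rwa [norm_free])
  rw [← map_sub, norm_free] at h
  calc _ ≤ |g| * (kernelConst s * (3 * R ^ 2) * ‖x - y‖) :=
        mul_le_mul_of_nonneg_left h (abs_nonneg _)
    _ = |g| * (kernelConst s * (3 * R ^ 2)) * ‖x - y‖ := by ring

lemma continuousOn_cubic (hs : IsKernel s) {S : Set ℝ} {x : ℝ → Seq d} (hx : ContinuousOn x S) :
    ContinuousOn (fun t => hartreeOp s (x t) (x t)) S :=
  (hs.continuous_hartreeOp.comp_continuousOn hx).clm_apply hx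

lemma continuousOn_interactionField (hs : IsKernel s) (k : Freq d) (g : ℝ) {S : Set ℝ}
    {w : ℝ → Seq d} (hw : ContinuousOn w S) :
    ContinuousOn (fun t => interactionField k g s t (w t)) S :=
  (continuousOn_free k continuousOn_id.neg
    (hs.continuousOn_cubic (continuousOn_free k continuousOn_id hw))).fun_const_smul _

/-- Conservation of mass: the field is `i` times an operator symmetric in `L²`, applied to `x`. -/
lemma inner_embL2_interactionField (hs : IsKernel s) (k : Freq d) (g t : ℝ) (x : Seq d) :
    inner ℝ (embL2 x) (embL2 (interactionField k g s t x)) = 0 := by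
  rw [seq_real_inner_eq, ← inner_gramL2_left, interactionField, inner_smul_right,
    ← inner_free_left, gramL2, ← formOp_free abs_one_le_br, ← gramL2]
  simp [Complex.mul_re, hs.im_inner_gramL2_hartreeOp]

lemma norm_interactionField_le (hs : IsKernel s) (k : Freq d) (g t : ℝ) (x : Seq d) :
    ‖interactionField k g s t x‖ ≤ |g| * kernelConst s * ‖embL2 x‖ ^ 2 * ‖x‖ := by
  rw [interactionField, norm_smul, norm_free, norm_mul, Complex.norm_I, one_mul,
    Complex.norm_real, Real.norm_eq_abs, mul_assoc, mul_assoc]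
  refine mul_le_mul_of_nonneg_left ?_ (abs_nonneg _)
  rw [← mul_assoc]
  refine ((hartreeOp s _).le_opNorm _).trans ?_
  rw [norm_free]
  refine mul_le_mul_of_nonneg_right ((hs.norm_hartreeOp_le _).trans ?_) (norm_nonneg _)
  rw [embL2_free, norm_free]

theorem exists_interaction_solution (hs : IsKernel s) (k : Freq d) (g : ℝ) (x₀ : Seq d) :
    ∃ w, SolvesODE (interactionField k g s) w ∧ w 0 = x₀ :=
  exists_solvesODE (J := embL2.restrictScalars ℝ) (mul_nonneg (abs_nonneg g) hs.const_nonneg)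
    (fun x => by
      rw [← continuousOn_univ]
      exact hs.continuousOn_interactionField k g continuousOn_const)
    (hs.lipschitz_interactionField k g) (hs.inner_embL2_interactionField k g)
    (hs.norm_interactionField_le k g) x₀

end IsKernel

lemma seq_apply_eq_inner (x : Seq d) (m : Freq d) :
    inner ℂ (lp.single 2 m (1 : ℂ) : Seq d) x = x m := by
  classical
  rw [lp.inner_single_left]
  simp

/-- A curve whose coordinates have a continuous derivative is differentiable. -/
lemma hasDerivWithinAt_of_coord {w G : ℝ → Seq d} (hG : ContinuousOn G (Ici 0))
    (h : ∀ m t, 0 ≤ t → HasDerivWithinAt (fun r => w r m) (G t m) (Ici 0) t) (t : ℝ) (ht : 0 ≤ t) :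
    HasDerivWithinAt w (G t) (Ici 0) t := by
  -- Freezing `G` on the negative axis gives a continuous function on the line, so the fundamental
  -- theorem of calculus also applies at `0`.
  have hc : Continuous fun r => G (max r 0) := by
    rw [← continuousOn_univ]
    exact hG.comp (by fun_prop) fun r _ => le_max_right r 0
  have hW : ∀ r, HasDerivAt (fun r => w 0 + ∫ τ in (0 : ℝ)..r, G (max τ 0)) (G (max r 0)) r :=
    fun r => (hc.integral_hasStrictDerivAt 0 r).hasDerivAt.const_add _
  have heq : ∀ r ∈ Ici (0 : ℝ), w r = w 0 + ∫ τ in (0 : ℝ)..r, G (max τ 0) := by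
    intro r hr
    ext m
    have hd : ∀ τ ∈ Ici (0 : ℝ), HasDerivWithinAt
        (fun τ => w τ m - (w 0 + ∫ τ in (0 : ℝ)..τ, G (max τ 0) : Seq d) m) 0 (Ici 0) τ := by
      intro τ hτ
      have h1 := ((innerSL ℂ (lp.single 2 m (1 : ℂ) : Seq d)).restrictScalars
        ℝ).hasFDerivAt.comp_hasDerivAt τ (hW τ)
      simp only [ContinuousLinearMap.coe_restrictScalars', innerSL_apply_apply,
        Function.comp_def, seq_apply_eq_inner, max_eq_left (mem_Ici.1 hτ)] at h1
      simpa using (h m τ hτ).fun_sub h1.hasDerivWithinAt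
    have := (convex_Ici (0 : ℝ)).norm_image_sub_le_of_norm_hasDerivWithin_le (C := 0) hd
      (by simp) (self_mem_Ici : (0 : ℝ) ∈ Ici 0) hr
    simpa [sub_eq_zero] using this
  have h2 := (hW t).hasDerivWithinAt (s := Ici 0)
  rw [max_eq_left ht] at h2
  exact h2.congr heq (heq t ht)

/-- In each coordinate `e^{it disp}` is an integrating factor. It removes the unbounded linear term,
and what remains is continuous with values in `H¹`. -/
lemma solvesODE_of_coord {s : Freq d → ℝ} (hs : IsKernel s) (k : Freq d) (g : ℝ) {x : ℝ → Seq d}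
    (hx : ContinuousOn x (Ici 0))
    (h : ∀ m t, 0 ≤ t → HasDerivWithinAt (fun r => x r m)
      (-(Complex.I * disp k m * x t m) + Complex.I * g * hartreeOp s (x t) (x t) m) (Ici 0) t) :
    SolvesODE (interactionField k g s) fun t => free k (-t) (x t) := by
  refine hasDerivWithinAt_of_coord (hs.continuousOn_interactionField k g
    (continuousOn_free k continuousOn_id.neg hx)) fun m t ht => ?_
  simp only [free_apply, interactionField, free_free_neg, lp.coeFn_smul, Pi.smul_apply,
    smul_eq_mul]
  have h1 : HasDerivAt (fun r : ℝ => Complex.exp (-(Complex.I * (-r * disp k m : ℝ))))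
      (Complex.exp (-(Complex.I * (-t * disp k m : ℝ))) * (Complex.I * disp k m)) t := by
    have h0 : HasDerivAt (fun r : ℝ => -(Complex.I * ((-r * disp k m : ℝ) : ℂ)))
        (Complex.I * disp k m) t := by
      have := (((hasDerivAt_id t).neg.mul_const (disp k m)).ofReal_comp.const_mul Complex.I).fun_neg
      simpa using this
    exact h0.cexp
  refine (h1.hasDerivWithinAt.mul (h m t ht)).congr_deriv ?_
  ring

lemma SolvesODE.hasDerivWithinAt_gramL2 {s : Freq d → ℝ} {k : Freq d} {g : ℝ} {w : ℝ → Seq d}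
    (hw : SolvesODE (interactionField k g s) w) {t : ℝ} (ht : 0 ≤ t) :
    HasDerivWithinAt (fun r => gramL2 (free k r (w r)))
      (-(Complex.I • formOp (disp k) (free k t (w t))) + (Complex.I * g) •
        gramL2 (hartreeOp s (free k t (w t)) (free k t (w t)))) (Ici 0) t := by
  refine (hasDerivWithinAt_gramL2_free k (hw t ht)).congr_deriv ?_
  rw [interactionField, map_smul, map_smul, free_free_neg]

/-! ### Conservation laws -/

/-- `½ ‖∇u‖²`. -/
def kinetic (x : Seq d) : ℝ := (inner ℂ (formOp (fun m => normSq m / 2) x) x).re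

/-- `∫ (Σ ⋆ |u|²) |u|²`. -/
def potEnergy (s : Freq d → ℝ) (x : Seq d) : ℝ := (inner ℂ (gramL2 x) (hartreeOp s x x)).re

/-- The Hartree energy. -/
def hartreeEnergy (g : ℝ) (s : Freq d → ℝ) (x : Seq d) : ℝ :=
  kinetic x / 2 - g / 4 * potEnergy s x

lemma kinetic_free (k : Freq d) (t : ℝ) (x : Seq d) : kinetic (free k t x) = kinetic x := by
  rw [kinetic, kinetic, formOp_free abs_normSq_half_le, inner_free_left, free_neg_free]

lemma continuous_kinetic : Continuous (kinetic : Seq d → ℝ) :=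
  Complex.continuous_re.comp ((ContinuousLinearMap.continuous _).inner continuous_id)

lemma hasDerivWithinAt_kinetic {w : ℝ → Seq d} {w' : Seq d} {S : Set ℝ} {t : ℝ}
    (hw : HasDerivWithinAt w w' S t) : HasDerivWithinAt (fun r => kinetic (w r))
      (2 * (inner ℂ (formOp (fun m => normSq m / 2) (w t)) w').re) S t := by
  have h := (hasDerivWithinAt_clm_seq (formOp fun m => normSq m / 2) hw).inner ℂ hw
  have h2 := Complex.reCLM.hasFDerivAt.comp_hasDerivWithinAt t h
  refine h2.congr_deriv ?_
  rw [Complex.reCLM_apply, Complex.add_re, inner_formOp_left abs_normSq_half_le w',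
    ← inner_conj_symm w', Complex.conj_re]
  ring

/-- This puts the increment into `gramL2 x - gramL2 y`. The quartic energy can thus be
differentiated along curves that are continuous in `H¹` but differentiable only in `H⁻¹`. -/
lemma potEnergy_sub {s : Freq d → ℝ} (hs : IsKernel s) (x y : Seq d) :
    potEnergy s x - potEnergy s y
      = (inner ℂ (gramL2 x - gramL2 y) ((hartreeOp s x + hartreeOp s y) (x + y))).re := by
  have h1 := congrArg Complex.re (hs.inner_hartreeOp_symm x y)
  have h2 : ∀ z, (inner ℂ (gramL2 x) (hartreeOp s z y)).re
      = (inner ℂ (gramL2 y) (hartreeOp s z x)).re := fun z => by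
    rw [hs.inner_gramL2_hartreeOp, ← inner_conj_symm, Complex.conj_re]
  have h3 := h2 x
  have h4 := h2 y
  simp only [potEnergy, add_apply, map_add, inner_sub_left, inner_add_right, Complex.add_re,
    Complex.sub_re]
  linarith

lemma seq_coe_smul (c : ℝ) (x : Seq d) : (c : ℂ) • x = c • x := by
  ext m
  rw [lp.coeFn_smul, lp.coeFn_smul, Pi.smul_apply, Pi.smul_apply, Complex.real_smul, smul_eq_mul]

lemma hasDerivWithinAt_potEnergy {s : Freq d → ℝ} (hs : IsKernel s) {x : ℝ → Seq d} {z' : Seq d}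
    {S : Set ℝ} {t : ℝ} (hx : ContinuousWithinAt x S t)
    (hz : HasDerivWithinAt (fun r => gramL2 (x r)) z' S t) :
    HasDerivWithinAt (fun r => potEnergy s (x r))
      (4 * (inner ℂ z' (hartreeOp s (x t) (x t))).re) S t := by
  rw [hasDerivWithinAt_iff_tendsto_slope] at hz ⊢
  have hx' : Tendsto x (𝓝[S \ {t}] t) (𝓝 (x t)) := hx.mono_left (nhdsWithin_mono _ sdiff_subset)
  have hQ : Tendsto (fun r => (hartreeOp s (x r) + hartreeOp s (x t)) (x r + x t)) (𝓝[S \ {t}] t)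
      (𝓝 ((hartreeOp s (x t) + hartreeOp s (x t)) (x t + x t))) := by
    have hA : Tendsto (fun r => hartreeOp s (x r) + hartreeOp s (x t)) (𝓝[S \ {t}] t)
        (𝓝 (hartreeOp s (x t) + hartreeOp s (x t))) :=
      ((hs.continuous_hartreeOp.tendsto _).comp hx').add_const _
    exact (isBoundedBilinearMap_apply.continuous.tendsto _).comp
      (hA.prodMk_nhds (hx'.add_const (x t)))
  have h := (Complex.continuous_re.tendsto _).comp (hz.inner hQ (𝕜 := ℂ))
  refine (h.congr fun r => ?_).trans (le_of_eq ?_)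
  · rw [Function.comp_apply, slope_def_module, slope_def_module, potEnergy_sub hs]
    rw [← seq_coe_smul, inner_smul_left, Complex.conj_ofReal, Complex.re_ofReal_mul,
      smul_eq_mul]
  · congr 1
    simp only [add_apply, map_add, inner_add_right, Complex.add_re]
    ring

lemma formOp_disp (k : Freq d) (x : Seq d) :
    formOp (disp k) x = formOp (fun m => normSq m / 2) x + formOp (freqDot k) x
      + ((normSq k / 2 : ℝ) : ℂ) • gramL2 x := by
  ext m
  rw [lp.coeFn_add, Pi.add_apply, lp.coeFn_add, Pi.add_apply, lp.coeFn_smul, Pi.smul_apply,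
    smul_eq_mul, formOp_apply (abs_disp_le_br k), formOp_apply abs_normSq_half_le,
    formOp_apply (abs_freqDot_le_br k), gramL2_apply, disp]
  have := br_ne_zero m
  push_cast
  field_simp

/-- The kinetic energy is invariant under the free flow, so its derivative sees only the
nonlinearity. In the derivative of the potential energy the nonlinearity contributes nothing and the
dispersion yields the same imaginary part. -/
theorem SolvesODE.hartreeEnergy_eq {s : Freq d → ℝ} (hs : IsKernel s) {k : Freq d} {g : ℝ}
    {w : ℝ → Seq d} (hw : SolvesODE (interactionField k g s) w) {t : ℝ} (ht : 0 ≤ t) :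
    hartreeEnergy g s (free k t (w t)) = hartreeEnergy g s (w 0) := by
  have hd : ∀ r ∈ Ici (0 : ℝ), HasDerivWithinAt
      (fun r => hartreeEnergy g s (free k r (w r))) 0 (Ici 0) r := by
    intro r hr
    have h1 := (hasDerivWithinAt_kinetic (hw r hr)).div_const 2
    have hx : ContinuousWithinAt (fun r => free k r (w r)) (Ici 0) r :=
      continuousOn_free k continuousOn_id hw.continuousOn r hr
    have h2 := (hasDerivWithinAt_potEnergy hs hx
      (hw.hasDerivWithinAt_gramL2 hr)).const_mul (g / 4)
    have h3 := h1.fun_sub h2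
    simp only [hartreeEnergy, kinetic_free]
    refine h3.congr_deriv ?_
    set x := free k r (w r) with hxdef
    have e1 : inner ℂ (formOp (fun m => normSq m / 2) (w r)) (interactionField k g s r (w r))
        = Complex.I * g * inner ℂ (formOp (fun m => normSq m / 2) x) (hartreeOp s x x) := by
      rw [interactionField, inner_smul_right, ← inner_free_left,
        ← formOp_free abs_normSq_half_le, ← hxdef]
    have e2 := hs.im_inner_freqDot_hartreeOp k x
    have e3 := hs.im_inner_gramL2_hartreeOp x x
    have e4 := hs.im_inner_gramL2_hartreeOp x (hartreeOp s x x)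
    have e5 : (inner ℂ (gramL2 (hartreeOp s x x)) (hartreeOp s x x)).im = 0 := by
      rw [inner_gramL2_left, inner_self_eq_norm_sq_to_K]
      simp [← Complex.ofReal_pow]
    -- The momentum and mass parts of the dispersion pair with the nonlinearity to real numbers;
    -- only `|m|²/2` survives.
    have e6 := congrArg (fun z => (inner ℂ z (hartreeOp s x x)).im) (formOp_disp k x)
    simp only [inner_add_left, inner_smul_left, Complex.add_im, Complex.conj_ofReal,
      Complex.im_ofReal_mul, e2, e3, mul_zero, add_zero] at e6
    rw [e1, inner_add_left, inner_neg_left, inner_smul_left, inner_smul_left]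
    simp only [map_mul, Complex.conj_I, Complex.conj_ofReal, Complex.add_re, Complex.neg_re,
      Complex.mul_re, Complex.mul_im, Complex.neg_im, Complex.I_re, Complex.I_im,
      Complex.ofReal_re, Complex.ofReal_im, e5, e6]
    ring
  have := (convex_Ici (0 : ℝ)).norm_image_sub_le_of_norm_hasDerivWithin_le (C := 0) hd
    (by simp) (self_mem_Ici : (0 : ℝ) ∈ Ici 0) ht
  simpa [sub_eq_zero, free_zero] using this

theorem SolvesODE.mass_eq {s : Freq d → ℝ} (hs : IsKernel s) {k : Freq d} {g : ℝ}
    {w : ℝ → Seq d} (hw : SolvesODE (interactionField k g s) w) {t : ℝ} (ht : 0 ≤ t) :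
    ‖embL2 (free k t (w t))‖ ^ 2 = ‖embL2 (w 0)‖ ^ 2 := by
  rw [embL2_free, norm_free]
  exact norm_sq_eq_of_orthogonal_field (J := embL2.restrictScalars ℝ) (convex_Ici 0) hw
    (fun t _ => hs.inner_embL2_interactionField k g t (w t)) ht self_mem_Ici

/-! ### Coercivity of the energy near the plane wave -/

/-- The sequence of a constant function. -/
def constSeq (a : ℂ) : Seq d := lp.single 2 0 a

lemma constSeq_apply_zero (a : ℂ) : (constSeq a : Seq d) 0 = a :=
  lp.single_apply_self (E := fun _ : Freq d => ℂ) 2 0 a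

lemma constSeq_apply_ne (a : ℂ) {m : Freq d} (hm : m ≠ 0) : (constSeq a : Seq d) m = 0 :=
  lp.single_apply_ne (E := fun _ : Freq d => ℂ) 2 0 a hm

lemma inner_constSeq_left (a : ℂ) (x : Seq d) : inner ℂ (constSeq a) x = conj a * x 0 := by
  have h := lp.inner_single_left (𝕜 := ℂ) (0 : Freq d) a x
  rwa [RCLike.inner_apply, mul_comm] at h

lemma norm_sq_sub_constSeq (x : Seq d) (a : ℂ) :
    ‖x - constSeq a‖ ^ 2 = ‖x‖ ^ 2 - ‖x 0‖ ^ 2 + ‖x 0 - a‖ ^ 2 := by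
  have h := (hasSum_seq_norm_sq x).add (hasSum_ite_eq (0 : Freq d) (‖x 0 - a‖ ^ 2 - ‖x 0‖ ^ 2))
  refine ((hasSum_seq_norm_sq (x - constSeq a)).unique (h.congr_fun fun m => ?_)).trans ?_
  · rw [lp.coeFn_sub, Pi.sub_apply]
    split_ifs with hm
    · subst hm
      rw [constSeq_apply_zero]
      ring
    · rw [constSeq_apply_ne _ hm]
      simp
  · ring

lemma normSq_zero : normSq (0 : Freq d) = 0 := by simp [normSq]

lemma br_zero : br (0 : Freq d) = 1 := by simp [br, normSq_zero]

lemma one_le_normSq {m : Freq d} (hm : m ≠ 0) : 1 ≤ normSq m := by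
  obtain ⟨j, hj⟩ := Function.ne_iff.1 hm
  have h1 : (0 : ℤ) < m j ^ 2 := by
    have : m j ≠ 0 := hj
    positivity
  have h2 : (1 : ℝ) ≤ (m j : ℝ) ^ 2 := by exact_mod_cast Int.add_one_le_iff.2 h1
  exact h2.trans (Finset.single_le_sum (f := fun j => (m j : ℝ) ^ 2)
    (fun _ _ => sq_nonneg _) (Finset.mem_univ j))

lemma embL2_apply_zero (x : Seq d) : embL2 x 0 = x 0 := by
  rw [embL2_apply, br_zero]
  simp

lemma hasSum_mass (x : Seq d) : HasSum (fun m => ‖x m‖ ^ 2 / br m ^ 2) (‖embL2 x‖ ^ 2) := by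
  refine (hasSum_seq_norm_sq (embL2 x)).congr_fun fun m => ?_
  rw [embL2_apply, norm_mul, norm_inv, Complex.norm_real, Real.norm_of_nonneg (br_pos m).le,
    mul_pow, inv_pow]
  field_simp

lemma hasSum_two_kinetic (x : Seq d) :
    HasSum (fun m => normSq m * (‖x m‖ ^ 2 / br m ^ 2)) (2 * kinetic x) := by
  have h := (Complex.hasSum_re (hasSum_seq_inner (formOp (fun m => normSq m / 2) x) x)).mul_left 2
  refine h.congr_fun fun m => ?_
  rw [formOp_apply abs_normSq_half_le, map_mul, Complex.conj_ofReal, mul_assoc,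
    Complex.conj_mul', ← Complex.ofReal_pow, ← Complex.ofReal_mul, Complex.ofReal_re]
  ring

lemma norm_sq_eq_mass_add (x : Seq d) : ‖x‖ ^ 2 = ‖embL2 x‖ ^ 2 + 2 * kinetic x := by
  refine (hasSum_seq_norm_sq x).unique (((hasSum_mass x).add (hasSum_two_kinetic x)).congr_fun
    fun m => ?_)
  have := br_pos m
  have h := br_sq m
  field_simp
  rw [h]
  try ring

lemma kinetic_nonneg (x : Seq d) : 0 ≤ kinetic x := by
  have := (hasSum_two_kinetic x).nonneg fun m => mul_nonneg (normSq_nonneg m) (by positivity)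
  linarith

/-- The Poincaré inequality. -/
lemma mass_sub_le (x : Seq d) : ‖embL2 x‖ ^ 2 - ‖x 0‖ ^ 2 ≤ 2 * kinetic x := by
  have h := (hasSum_two_kinetic x).add (hasSum_ite_eq (0 : Freq d) (‖x 0‖ ^ 2))
  rw [sub_le_iff_le_add]
  refine hasSum_le (fun m => ?_) (hasSum_mass x) h
  have h1 : 0 ≤ ‖x m‖ ^ 2 / br m ^ 2 := by positivity
  split_ifs with hm
  · subst hm
    simp [br_zero, normSq_zero]
  · nlinarith [one_le_normSq hm]

lemma norm_apply_zero_sq_le (x : Seq d) : ‖x 0‖ ^ 2 ≤ ‖embL2 x‖ ^ 2 := by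
  rw [← embL2_apply_zero]
  exact le_hasSum (hasSum_seq_norm_sq (embL2 x)) 0 fun _ _ => by positivity

/-- Split off the mean: for `p ≠ 0` the constant has no density at frequency `p`, the two cross
terms are linear in the remainder, and the last term is at most its mass `R²`. -/
lemma norm_rho_le_of_ne {p : Freq d} (hp : p ≠ 0) (x : Seq d) {R : ℝ}
    (hR : R ^ 2 = ‖embL2 x‖ ^ 2 - ‖x 0‖ ^ 2) :
    ‖rho p x‖ ≤ ‖x 0‖ * (‖embL2 x p‖ + ‖embL2 x (-p)‖) + R ^ 2 := by
  set c := embL2 x with hc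
  have hc0 : c 0 = x 0 := embL2_apply_zero x
  set e : Seq d := constSeq (c 0) with he
  set r : Seq d := c - e with hr
  have hsplit : c = e + r := by rw [hr]; abel
  have hrn : ‖r‖ ^ 2 = R ^ 2 := by
    rw [hr, he, norm_sq_sub_constSeq, hR, hc0]
    simp
  have hrp : ∀ q : Freq d, q ≠ 0 → r q = c q := fun q hq => by
    rw [hr, he, lp.coeFn_sub, Pi.sub_apply, constSeq_apply_ne _ hq, sub_zero]
  have hep : e p = 0 := by rw [he, constSeq_apply_ne _ hp]
  have hl : ∀ z : Seq d, inner ℂ (modL2 p e) z = conj (c 0) * z p := fun z => by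
    rw [inner_modL2_left, he, inner_constSeq_left, modL2_apply]
    simp
  have h1 : rho p x = conj (c 0) * r p + c 0 * conj (r (-p)) + inner ℂ (modL2 p r) r := by
    have h2 : inner ℂ (modL2 p r) e = c 0 * conj (r (-p)) := by
      rw [he, ← inner_conj_symm, inner_constSeq_left, modL2_apply]
      simp
    have h3 : inner ℂ (modL2 p c) c = inner ℂ (modL2 p e) e + inner ℂ (modL2 p e) r
        + inner ℂ (modL2 p r) e + inner ℂ (modL2 p r) r := by
      conv_lhs => rw [hsplit]
      rw [map_add, inner_add_left, inner_add_right, inner_add_right]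
      ring
    rw [rho_eq, ← hc, h3, hl, hl, h2, hep]
    ring
  rw [h1, hrp p hp, hrp (-p) (neg_ne_zero.2 hp), hc0]
  have h4 : ‖inner ℂ (modL2 p r) r‖ ≤ R ^ 2 := by
    rw [← hrn, sq]
    exact (norm_inner_le_norm _ _).trans
      (mul_le_mul_of_nonneg_right (norm_modL2_le _ _) (norm_nonneg _))
  refine (norm_add_le _ _).trans (add_le_add ((norm_add_le _ _).trans_eq ?_) h4)
  rw [norm_mul, norm_mul, RCLike.norm_conj, RCLike.norm_conj]
  ring

namespace IsKernel

variable {s : Freq d → ℝ}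

lemma hasSum_potEnergy (hs : IsKernel s) (x : Seq d) :
    HasSum (fun p => s p * ‖rho p x‖ ^ 2) (potEnergy s x) := by
  refine (Complex.hasSum_re (hs.hasSum_density_pairing x x)).congr_fun fun p => ?_
  rw [mul_assoc, Complex.mul_conj', ← Complex.ofReal_pow, ← Complex.ofReal_mul,
    Complex.ofReal_re]

lemma le_potEnergy (hs : IsKernel s) (x : Seq d) :
    s 0 * (‖embL2 x‖ ^ 2) ^ 2 ≤ potEnergy s x := by
  have h := le_hasSum (hs.hasSum_potEnergy x) 0 fun p _ => mul_nonneg (hs.nonneg p) (by positivity)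
  rwa [rho_zero, Complex.norm_real, Real.norm_of_nonneg (by positivity)] at h

/-- The part of `ρ_p` linear in the oscillation is square-summable, so it costs only the supremum
`σ`; this gives the `4σ` of the smallness condition. Terms of higher order in `y` may cost the full
sum of the kernel. -/
lemma potEnergy_le (hs : IsKernel s) {σ : ℝ} (hσ : ∀ p, s p ≤ σ) (x : Seq d) {y : ℝ}
    (hy : 0 ≤ y) (hxy : y ^ 2 = 2 * kinetic x) :
    potEnergy s x ≤ s 0 * (‖embL2 x‖ ^ 2) ^ 2
      + y ^ 2 * (4 * σ * ‖embL2 x‖ ^ 2 + kernelConst s * (4 * ‖embL2 x‖ * y + y ^ 2)) := by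
  have hσ0 : 0 ≤ σ := (hs.nonneg 0).trans (hσ 0)
  set c := embL2 x with hc
  have hR0 : 0 ≤ ‖c‖ ^ 2 - ‖x 0‖ ^ 2 := by linarith [norm_apply_zero_sq_le x]
  set R := √(‖c‖ ^ 2 - ‖x 0‖ ^ 2) with hRdef
  have hR : R ^ 2 = ‖c‖ ^ 2 - ‖x 0‖ ^ 2 := Real.sq_sqrt hR0
  have hRy : R ≤ y := by
    refine le_of_sq_le_sq ?_ hy
    rw [hR, hxy]
    exact mass_sub_le x
  have hRnn : 0 ≤ R := Real.sqrt_nonneg _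
  have hx0 : ‖x 0‖ ≤ ‖c‖ := le_of_sq_le_sq (norm_apply_zero_sq_le x) (norm_nonneg _)
  have hcsum := hasSum_seq_norm_sq (c - constSeq (x 0))
  have hcn : ‖(c - constSeq (x 0))‖ ^ 2 = R ^ 2 := by
    rw [norm_sq_sub_constSeq, hc, embL2_apply_zero, ← hc, hR]
    simp
  rw [hcn] at hcsum
  have hcne : ∀ p : Freq d, p ≠ 0 → (c - constSeq (x 0) : Seq d) p = c p := fun p hp => by
    rw [lp.coeFn_sub, Pi.sub_apply, constSeq_apply_ne _ hp, sub_zero]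
  have hcR : ∀ p : Freq d, p ≠ 0 → ‖c p‖ ≤ R := fun p hp => by
    have h := le_hasSum hcsum p fun _ _ => by positivity
    rw [hcne p hp] at h
    exact le_of_sq_le_sq h hRnn
  -- The majorant, term by term: the zero mode, the quadratic part controlled by `σ`, and the cubic
  -- and quartic remainder controlled by the kernel sum.
  have hsum := ((hasSum_ite_eq (0 : Freq d) (s 0 * (‖c‖ ^ 2) ^ 2)).add
    ((hcsum.add ((Equiv.neg (Freq d)).hasSum_iff.2 hcsum)).mul_left
      (σ * (2 * ‖x 0‖ ^ 2)))).add (hs.hasSum_const.mul_right (4 * ‖x 0‖ * R * R ^ 2 + R ^ 4))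
  have hle := hasSum_le (fun p => ?_) (hs.hasSum_potEnergy x) hsum
  · refine hle.trans ?_
    have hK := hs.const_nonneg
    have h1 : R ^ 2 ≤ y ^ 2 := pow_le_pow_left₀ hRnn hRy 2
    have h2 : ‖x 0‖ ^ 2 ≤ ‖c‖ ^ 2 := norm_apply_zero_sq_le x
    have h3 : σ * (2 * ‖x 0‖ ^ 2) * (R ^ 2 + R ^ 2) ≤ y ^ 2 * (4 * σ * ‖c‖ ^ 2) := by
      have : ‖x 0‖ ^ 2 * R ^ 2 ≤ ‖c‖ ^ 2 * y ^ 2 :=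
        mul_le_mul h2 h1 (by positivity) (by positivity)
      nlinarith [mul_le_mul_of_nonneg_left this hσ0]
    have h4 : 4 * ‖x 0‖ * R * R ^ 2 + R ^ 4 ≤ y ^ 2 * (4 * ‖c‖ * y + y ^ 2) := by
      have e1 : ‖x 0‖ * R * R ^ 2 ≤ ‖c‖ * y * y ^ 2 :=
        mul_le_mul (mul_le_mul hx0 hRy hRnn (norm_nonneg _)) h1 (by positivity) (by positivity)
      have e2 : R ^ 4 ≤ y ^ 4 := pow_le_pow_left₀ hRnn hRy 4
      nlinarith
    have h5 := mul_le_mul_of_nonneg_left h4 hK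
    linarith
  · have hsp := hs.nonneg p
    have hbr : s p ≤ s p * (2 * br p ^ 2) := by
      nlinarith [one_le_br p, mul_nonneg hsp (sub_nonneg.2 (one_le_br p)),
        mul_nonneg hsp (mul_nonneg (br_pos p).le (sub_nonneg.2 (one_le_br p)))]
    simp only [Function.comp_apply, Equiv.neg_apply]
    by_cases hp : p = 0
    · subst hp
      rw [rho_zero, Complex.norm_real, Real.norm_of_nonneg (by positivity), if_pos rfl, ← hc]
      have h0 : 0 ≤ s 0 * (2 * br (0 : Freq d) ^ 2) * (4 * ‖x 0‖ * R * R ^ 2 + R ^ 4) := by positivity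
      have h1 : 0 ≤ σ * (2 * ‖x 0‖ ^ 2) * (‖(c - constSeq (x 0) : Seq d) 0‖ ^ 2
        + ‖(c - constSeq (x 0) : Seq d) (-0)‖ ^ 2) := by positivity
      linarith
    · rw [if_neg hp, hcne p hp, hcne (-p) (neg_ne_zero.2 hp), zero_add]
      have h1 := norm_rho_le_of_ne hp x hR
      rw [← hc] at h1
      have ha := hcR p hp
      have hb := hcR (-p) (neg_ne_zero.2 hp)
      set a := ‖c p‖
      set b := ‖c (-p)‖
      have ha0 : 0 ≤ a := norm_nonneg _
      have hb0 : 0 ≤ b := norm_nonneg _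
      have hn0 := norm_nonneg (x 0)
      have h2 : ‖rho p x‖ ^ 2 ≤ (‖x 0‖ * (a + b) + R ^ 2) ^ 2 :=
        pow_le_pow_left₀ (norm_nonneg _) h1 2
      have h3 : (‖x 0‖ * (a + b) + R ^ 2) ^ 2
          ≤ 2 * ‖x 0‖ ^ 2 * (a ^ 2 + b ^ 2) + (4 * ‖x 0‖ * R * R ^ 2 + R ^ 4) := by
        have e1 : ‖x 0‖ * (a + b) * R ^ 2 ≤ ‖x 0‖ * (2 * R) * R ^ 2 := by
          gcongr
          linarith
        have e2 : 0 ≤ ‖x 0‖ ^ 2 * (a - b) ^ 2 := by positivity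
        nlinarith
      have h4 : 0 ≤ 4 * ‖x 0‖ * R * R ^ 2 + R ^ 4 := by positivity
      have h5 : 0 ≤ 2 * ‖x 0‖ ^ 2 * (a ^ 2 + b ^ 2) := by positivity
      calc s p * ‖rho p x‖ ^ 2
          ≤ s p * (2 * ‖x 0‖ ^ 2 * (a ^ 2 + b ^ 2) + (4 * ‖x 0‖ * R * R ^ 2 + R ^ 4)) :=
            mul_le_mul_of_nonneg_left (h2.trans h3) hsp
        _ = s p * (2 * ‖x 0‖ ^ 2 * (a ^ 2 + b ^ 2)) + s p * (4 * ‖x 0‖ * R * R ^ 2 + R ^ 4) := by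
            ring
        _ ≤ σ * (2 * ‖x 0‖ ^ 2 * (a ^ 2 + b ^ 2))
            + s p * (2 * br p ^ 2) * (4 * ‖x 0‖ * R * R ^ 2 + R ^ 4) :=
            add_le_add (mul_le_mul_of_nonneg_right (hσ p) h5) (mul_le_mul_of_nonneg_right hbr h4)
        _ = _ := by ring

end IsKernel

/-! ### Orbital stability of constants -/

lemma embL2_constSeq (a : ℂ) : embL2 (constSeq a : Seq d) = constSeq a := by
  ext m
  rw [embL2_apply]
  by_cases hm : m = 0
  · subst hm
    simp [br_zero]
  · rw [constSeq_apply_ne a hm, mul_zero]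

lemma norm_constSeq (a : ℂ) : ‖(constSeq a : Seq d)‖ = ‖a‖ := by
  have h := norm_sq_sub_constSeq (d := d) 0 a
  simp only [zero_sub, norm_neg, norm_zero, lp.coeFn_zero, Pi.zero_apply] at h
  refine (pow_left_inj₀ (norm_nonneg _) (norm_nonneg _) two_ne_zero).1 (h.trans ?_)
  ring

lemma kinetic_constSeq (a : ℂ) : kinetic (constSeq a : Seq d) = 0 := by
  have h := norm_sq_eq_mass_add (constSeq a : Seq d)
  rw [embL2_constSeq] at h
  linarith

/-- The best phase is the argument of the mean. The nonzero modes are controlled by Poincaré, and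
`|‖x 0‖² - N|` by the mass defect plus the oscillation. -/
lemma exists_phase_norm_sub_sq_le (x : Seq d) {N : ℝ} (hN : 0 < N) :
    ∃ θ : ℝ, ‖x - constSeq (Complex.exp (Complex.I * θ) * √N)‖ ^ 2
      ≤ (|‖embL2 x‖ ^ 2 - N| + 2 * kinetic x) ^ 2 / N + 2 * (2 * kinetic x) := by
  refine ⟨(x 0).arg, ?_⟩
  rw [norm_sq_sub_constSeq, norm_sq_eq_mass_add]
  have h1 := mass_sub_le x
  have h2 := norm_apply_zero_sq_le x
  have h3 : ‖x 0 - Complex.exp (Complex.I * (x 0).arg) * √N‖ = |‖x 0‖ - √N| := by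
    have h : x 0 - Complex.exp (Complex.I * (x 0).arg) * √N
        = ((‖x 0‖ - √N : ℝ) : ℂ) * Complex.exp ((x 0).arg * Complex.I) := by
      have h0 := Complex.norm_mul_exp_arg_mul_I (x 0)
      rw [Complex.ofReal_sub, sub_mul, h0, mul_comm Complex.I]
      ring
    rw [h, norm_mul, Complex.norm_exp_ofReal_mul_I, mul_one, Complex.norm_real, Real.norm_eq_abs]
  have h4 : |‖x 0‖ - √N| ^ 2 ≤ (|‖embL2 x‖ ^ 2 - N| + 2 * kinetic x) ^ 2 / N := by
    rw [le_div_iff₀ hN]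
    have e1 : |‖x 0‖ - √N| * √N ≤ |‖embL2 x‖ ^ 2 - N| + 2 * kinetic x := by
      have e2 : |‖x 0‖ - √N| * √N ≤ |‖x 0‖ - √N| * (‖x 0‖ + √N) :=
        mul_le_mul_of_nonneg_left (by linarith [norm_nonneg (x 0)]) (abs_nonneg _)
      have e3 : |‖x 0‖ - √N| * (‖x 0‖ + √N) = |‖x 0‖ ^ 2 - N| := by
        have e5 : ‖x 0‖ ^ 2 - N = (‖x 0‖ - √N) * (‖x 0‖ + √N) := by
          nlinarith [Real.sq_sqrt hN.le]
        rw [e5, abs_mul]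
        congr 1
        exact (abs_of_nonneg (by positivity)).symm
      have e4 : |‖x 0‖ ^ 2 - N| ≤ |‖embL2 x‖ ^ 2 - N| + 2 * kinetic x := by
        have := neg_abs_le (‖embL2 x‖ ^ 2 - N)
        have := le_abs_self (‖embL2 x‖ ^ 2 - N)
        rw [abs_le]
        constructor <;> linarith [kinetic_nonneg x]
      linarith
    calc |‖x 0‖ - √N| ^ 2 * N = (|‖x 0‖ - √N| * √N) ^ 2 := by
          rw [mul_pow, Real.sq_sqrt hN.le]
      _ ≤ _ := pow_le_pow_left₀ (by positivity) e1 2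
  rw [h3]
  linarith

/-- A continuity argument: coercivity holds only for small gradients, but it prevents the gradient
from ever reaching the edge of that region. -/
theorem IsKernel.orbital_stability {s : Freq d → ℝ} (hs : IsKernel s) {σ g N : ℝ}
    (hσ : ∀ p, s p ≤ σ) (hg : 0 ≤ g) (hN : 0 < N) (hsmall : 4 * g * σ * N < 1) (k : Freq d)
    {ε : ℝ} (hε : 0 < ε) :
    ∃ δ, 0 < δ ∧ ∀ w, SolvesODE (interactionField k g s) w → ‖w 0 - constSeq (√N : ℂ)‖ < δ →
      ∀ t, 0 ≤ t → ∃ θ : ℝ,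
        ‖free k t (w t) - constSeq (Complex.exp (Complex.I * θ) * √N)‖ < ε := by
  set β := 1 - 4 * g * σ * N with hβ
  have hβ0 : 0 < β := by linarith
  have hσ0 : 0 ≤ σ := (hs.nonneg 0).trans (hσ 0)
  have hβ1 : β ≤ 1 := by
    have : 0 ≤ 4 * g * σ * N := by positivity
    linarith
  -- At `q = (M, y)`, energy conservation gives `y² · gap q ≤ y(0)²`, and `dst q` bounds the squared
  -- distance to the orbit. Their values at `(N, 0)` are `β` and `0`, and both are continuous.
  let gap : ℝ × ℝ → ℝ := fun q =>
    1 - g * (4 * σ * q.1 + kernelConst s * (4 * √q.1 * q.2 + q.2 ^ 2))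
  let dst : ℝ × ℝ → ℝ := fun q => (|q.1 - N| + q.2 ^ 2) ^ 2 / N + 2 * q.2 ^ 2
  have hgap : Continuous gap := by fun_prop
  have hdst : Continuous dst := by fun_prop
  have hgap0 : gap (N, 0) = β := by
    simp only [gap, hβ]
    ring
  have hdst0 : dst (N, 0) = 0 := by simp [dst]
  have hev : ∀ᶠ q in 𝓝 (N, (0 : ℝ)), β / 2 < gap q ∧ dst q < ε ^ 2 :=
    (hgap.tendsto (N, 0) |>.eventually (lt_mem_nhds (by rw [hgap0]; linarith))).and
      (hdst.tendsto (N, 0) |>.eventually (gt_mem_nhds (by rw [hdst0]; positivity)))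
  obtain ⟨η, hη, hball⟩ := Metric.nhds_basis_closedBall.eventually_iff.1 hev
  have hq : ∀ M y : ℝ, |M - N| ≤ η → 0 ≤ y → y ≤ η →
      β / 2 < gap (M, y) ∧ dst (M, y) < ε ^ 2 := by
    intro M y hM hy0 hy
    refine hball ?_
    rw [Metric.mem_closedBall, Prod.dist_eq, Real.dist_eq, Real.dist_eq, sub_zero,
      abs_of_nonneg hy0]
    exact max_le hM hy
  let e : Seq d := constSeq (√N : ℂ)
  have he1 : ‖embL2 e‖ ^ 2 = N := by
    rw [embL2_constSeq, norm_constSeq, Complex.norm_real, Real.norm_of_nonneg (Real.sqrt_nonneg _),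
      Real.sq_sqrt hN.le]
  have he2 : kinetic e = 0 := kinetic_constSeq _
  have hmcont : Continuous fun x : Seq d => |‖embL2 x‖ ^ 2 - N| := by fun_prop
  -- If the gradient norm reached `η`, then `βη²/2 < η² · gap ≤ 2 * kinetic (w 0)`; the initial
  -- threshold excludes exactly this.
  have hev2 : ∀ᶠ x in 𝓝 e, |‖embL2 x‖ ^ 2 - N| < η ∧ 2 * kinetic x < β * η ^ 2 / 2 :=
    (hmcont.tendsto e |>.eventually (gt_mem_nhds (by rw [he1]; simpa using hη))).and
      ((continuous_kinetic.const_mul 2).tendsto e |>.eventually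
        (gt_mem_nhds (by rw [he2]; simpa using by positivity)))
  obtain ⟨δ, hδ, hball2⟩ := Metric.eventually_nhds_iff.1 hev2
  refine ⟨δ, hδ, fun w hw hw0 t ht => ?_⟩
  obtain ⟨hM0, hK0⟩ := hball2 (by rwa [dist_eq_norm])
  have hclose : ∀ r, 0 ≤ r → 2 * kinetic (w r) < η ^ 2 := by
    by_contra! hcon
    obtain ⟨r, hr, hr2⟩ := hcon
    have hcont : ContinuousOn (fun r => 2 * kinetic (w r)) (Icc 0 r) :=
      ((continuous_kinetic.const_mul 2).comp_continuousOn hw.continuousOn).mono Icc_subset_Ici_self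
    have hη2 : 0 < η ^ 2 := by positivity
    -- Coercivity is known only up to `η`, so the contradiction is sought at a time of equality.
    obtain ⟨τ, hτ, hτη⟩ := intermediate_value_Icc hr hcont
      (⟨by nlinarith, hr2⟩ : η ^ 2 ∈ Icc (2 * kinetic (w 0)) (2 * kinetic (w r)))
    have hE := hw.hartreeEnergy_eq hs hτ.1
    have hM := hw.mass_eq hs hτ.1
    have hkf := kinetic_free k τ (w τ)
    set x := free k τ (w τ)
    have h1 := hs.potEnergy_le hσ x hη.le (by rw [hkf]; exact hτη.symm)
    have h2 := hs.le_potEnergy (w 0)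
    have h3 := (hq (‖embL2 x‖ ^ 2) η (by rw [hM]; exact hM0.le) hη.le le_rfl).1
    simp only [gap, Real.sqrt_sq (norm_nonneg (embL2 x))] at h3
    simp only [hartreeEnergy, hkf] at hE
    rw [hM] at h1
    rw [← hM] at h2
    have h4 := mul_le_mul_of_nonneg_left h1 hg
    have h5 := mul_le_mul_of_nonneg_left h2 hg
    have h6 := mul_lt_mul_of_pos_left h3 hη2
    have hτη' : 2 * kinetic (w τ) = η ^ 2 := hτη
    rw [hM] at h5 h6
    nlinarith
  obtain ⟨θ, hθ⟩ := exists_phase_norm_sub_sq_le (free k t (w t)) hN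
  refine ⟨θ, lt_of_pow_lt_pow_left₀ 2 hε.le (hθ.trans_lt ?_)⟩
  have hy0 : 0 ≤ 2 * kinetic (w t) := by linarith [kinetic_nonneg (w t)]
  have h := (hq (‖embL2 (free k t (w t))‖ ^ 2) (√(2 * kinetic (w t)))
    (by rw [hw.mass_eq hs ht]; exact hM0.le) (Real.sqrt_nonneg _)
    (Real.sqrt_le_iff.2 ⟨hη.le, (hclose t ht).le⟩)).2
  simp only [dst, Real.sq_sqrt hy0] at h
  rw [kinetic_free]
  exact h

/-! ### Fourier series on the torus -/

/-- The exponential `x ↦ e^{i m·x}` on the torus. -/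
def expo (m : Freq d) : C(Torus d, ℂ) where
  toFun x := ∏ i, fourier (m i) (x i)
  continuous_toFun := by fun_prop

lemma expo_apply (m : Freq d) (x : Torus d) : expo m x = ∏ i, fourier (m i) (x i) := rfl

lemma expo_neg (m : Freq d) (x : Torus d) : expo (-m) x = conj (expo m x) := by
  simp only [expo_apply, Pi.neg_apply, fourier_neg, map_prod]

lemma expo_add (m n : Freq d) (x : Torus d) : expo (m + n) x = expo m x * expo n x := by
  simp only [expo_apply, Pi.add_apply, fourier_add, ← Finset.prod_mul_distrib]

lemma expo_zero (x : Torus d) : expo 0 x = 1 := by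
  simp [expo_apply]

lemma norm_expo (m : Freq d) (x : Torus d) : ‖expo m x‖ = 1 := by
  simp only [expo_apply, fourier_apply, norm_prod, Circle.norm_coe, Finset.prod_const_one]

lemma expo_add_right (m : Freq d) (x y : Torus d) : expo m (x + y) = expo m x * expo m y := by
  simp only [expo_apply, Pi.add_apply, fourier_apply, smul_add, AddCircle.toCircle_add,
    Circle.coe_mul, Finset.prod_mul_distrib]

lemma expo_neg_right (m : Freq d) (x : Torus d) : expo m (-x) = conj (expo m x) := by
  rw [← expo_neg]
  simp only [expo_apply, Pi.neg_apply, fourier_apply, smul_neg, neg_smul]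

lemma expo_single (m : Freq d) (j : Fin d) (s : AddCircle (2 * π)) :
    expo m (Pi.single j s) = fourier (m j) s := by
  rw [expo_apply, Finset.prod_eq_single j]
  · simp
  · intro i _ hi
    simp [hi]
  · simp

lemma fourier_coe_two_pi (n : ℤ) (s : ℝ) :
    fourier n (s : AddCircle (2 * π)) = Complex.exp (Complex.I * n * s) := by
  rw [fourier_coe_apply]
  congr 1
  have : (π : ℂ) ≠ 0 := Complex.ofReal_ne_zero.2 Real.pi_ne_zero
  push_cast
  field_simp

lemma isSmooth_expo (m : Freq d) : IsSmooth (expo m) := by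
  have h : (fun x : Fin d → ℝ => expo m (proj d x))
      = fun x => ∏ i, Complex.exp (Complex.I * m i * (x i : ℝ)) := by
    funext x
    simp only [expo_apply, proj, fourier_coe_two_pi]
  rw [IsSmooth, h]
  refine contDiff_prod fun i _ => ContDiff.cexp (contDiff_const.mul ?_)
  exact Complex.ofRealCLM.contDiff.comp (contDiff_apply ℝ ℝ i)

lemma pderiv_expo (j : Fin d) (m : Freq d) (x : Torus d) :
    pderiv j (expo m) x = Complex.I * m j * expo m x := by
  have h1 : HasDerivAt (fun s : ℝ => Complex.exp (Complex.I * m j * s)) (Complex.I * m j) 0 := by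
    have h0 : HasDerivAt (fun s : ℝ => Complex.I * m j * (s : ℂ)) (Complex.I * m j) 0 := by
      simpa using (Complex.ofRealCLM.hasDerivAt (x := (0 : ℝ))).const_mul (Complex.I * m j)
    simpa using h0.cexp
  have h2 : (fun s : ℝ => expo m (x + Pi.single j (s : AddCircle (2 * π))))
      = fun s : ℝ => expo m x * Complex.exp (Complex.I * m j * s) := by
    funext s
    rw [expo_add_right, expo_single, fourier_coe_two_pi]
  rw [pderiv, h2, (h1.const_mul _).deriv]
  ring

/-- The total mass of the torus. -/
def torusMass (d : ℕ) : ℝ := (2 * π) ^ d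

lemma torusMass_pos : 0 < torusMass d := pow_pos Real.two_pi_pos d

lemma sqrt_torusMass_ne_zero : ((√(torusMass d) : ℝ) : ℂ) ≠ 0 :=
  Complex.ofReal_ne_zero.2 (Real.sqrt_pos.2 torusMass_pos).ne'

lemma volume_real_univ_torus : (volume : Measure (Torus d)).real univ = torusMass d := by
  rw [measureReal_def, volume_pi, Measure.pi_univ]
  simp [torusMass, AddCircle.measure_univ, Real.pi_pos.le]

/-- For `m ≠ 0` the exponential is, up to a nonzero factor, one of its own partial derivatives, and
derivatives integrate to zero. -/
lemma integral_expo (m : Freq d) : ∫ x, expo m x = if m = 0 then (torusMass d : ℂ) else 0 := by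
  split_ifs with hm
  · subst hm
    simp only [expo_zero, integral_const, volume_real_univ_torus, Complex.real_smul, mul_one]
  · obtain ⟨j, hj⟩ := Function.ne_iff.1 hm
    have h := (isSmooth_expo m).integral_pderiv j
    simp only [pderiv_expo] at h
    rw [integral_const_mul, mul_eq_zero, mul_eq_zero] at h
    have hj' : (m j : ℂ) ≠ 0 := Int.cast_ne_zero.2 hj
    simpa [hj'] using h

/-- `L²(𝕋^d; ℂ)`. -/
abbrev L2Torus (d : ℕ) : Type := Lp ℂ 2 (volume : Measure (Torus d))

/-- A continuous function, as an element of `L²`. -/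
def contL2 (f : C(Torus d, ℂ)) : L2Torus d := ContinuousMap.toLp (E := ℂ) 2 volume ℂ f

lemma coeFn_contL2 (f : C(Torus d, ℂ)) : contL2 f =ᵐ[volume] f :=
  ContinuousMap.coeFn_toLp volume f

lemma inner_contL2 (f : C(Torus d, ℂ)) (g : L2Torus d) :
    inner ℂ (contL2 f) g = ∫ x, g x * conj (f x) := by
  rw [L2.inner_def]
  refine integral_congr_ae ?_
  filter_upwards [coeFn_contL2 f] with x hx
  rw [RCLike.inner_apply, hx]

/-- The normalised exponentials. -/
def expoL2 (m : Freq d) : L2Torus d := ((√(torusMass d) : ℝ) : ℂ)⁻¹ • contL2 (expo m)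

lemma inner_expoL2 (m : Freq d) (g : L2Torus d) :
    inner ℂ (expoL2 m) g = ((√(torusMass d) : ℝ) : ℂ)⁻¹ * ∫ x, g x * expo (-m) x := by
  rw [expoL2, inner_smul_left, inner_contL2, map_inv₀, Complex.conj_ofReal]
  simp only [expo_neg]

lemma orthonormal_expoL2 : Orthonormal ℂ (expoL2 (d := d)) := by
  classical
  rw [orthonormal_iff_ite]
  intro m n
  have h : ∫ x, (expoL2 n) x * expo (-m) x
      = ((√(torusMass d) : ℝ) : ℂ)⁻¹ * ∫ x, expo (n - m) x := by
    rw [← integral_const_mul]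
    refine integral_congr_ae ?_
    filter_upwards [Lp.coeFn_smul ((√(torusMass d) : ℝ) : ℂ)⁻¹ (contL2 (expo n)),
      coeFn_contL2 (expo n)] with x h1 h2
    rw [expoL2, h1, Pi.smul_apply, h2, sub_eq_add_neg, expo_add, smul_eq_mul, mul_assoc]
  rw [inner_expoL2, h, integral_expo]
  simp only [sub_eq_zero, eq_comm (a := n)]
  split_ifs with hmn
  · have h1 := sqrt_torusMass_ne_zero (d := d)
    have h2 : ((√(torusMass d) : ℝ) : ℂ) * ((√(torusMass d) : ℝ) : ℂ) = (torusMass d : ℂ) := by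
      rw [← Complex.ofReal_mul, Real.mul_self_sqrt torusMass_pos.le]
    rw [← h2]
    field_simp
  · simp

/-- The star subalgebra of continuous functions generated by the exponentials. -/
def expoSubalgebra (d : ℕ) : StarSubalgebra ℂ C(Torus d, ℂ) where
  toSubalgebra := Algebra.adjoin ℂ (range expo)
  star_mem' := by
    change Algebra.adjoin ℂ (range expo) ≤ star (Algebra.adjoin ℂ (range expo))
    refine Algebra.adjoin_le ?_
    rintro _ ⟨n, rfl⟩
    refine Algebra.subset_adjoin ⟨-n, ?_⟩
    ext1 x
    simp only [expo_neg, starRingEnd_apply, ContinuousMap.star_apply]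

lemma expoSubalgebra_coe :
    Subalgebra.toSubmodule (expoSubalgebra d).toSubalgebra = Submodule.span ℂ (range expo) := by
  apply Algebra.adjoin_eq_span_of_subset
  refine .trans (fun x ↦ Submonoid.closure_induction (fun _ ↦ id) ⟨0, ?_⟩ ?_)
    Submodule.subset_span
  · ext z
    simp [expo_zero]
  · rintro _ _ _ _ ⟨m, rfl⟩ ⟨n, rfl⟩
    refine ⟨m + n, ?_⟩
    ext z
    simp [expo_add]

lemma expoSubalgebra_separatesPoints : (expoSubalgebra d).SeparatesPoints := by
  classical
  intro x y hxy
  obtain ⟨i, hi⟩ := Function.ne_iff.1 hxy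
  refine ⟨_, ⟨expo (Pi.single i 1), Algebra.subset_adjoin ⟨Pi.single i 1, rfl⟩, rfl⟩, ?_⟩
  have h : ∀ z : Torus d, expo (Pi.single i 1) z = fourier 1 (z i) := by
    intro z
    rw [expo_apply, Finset.prod_eq_single i]
    · simp
    · intro j _ hj
      simp [hj]
    · simp
  dsimp only
  rw [h, h, fourier_one, fourier_one]
  contrapose hi
  exact AddCircle.injective_toCircle Real.two_pi_pos.ne' (Circle.ext hi)

lemma span_expo_closure_eq_top :
    (Submodule.span ℂ (range <| expo (d := d))).topologicalClosure = ⊤ := by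
  rw [← expoSubalgebra_coe]
  exact congr_arg (Subalgebra.toSubmodule <| StarSubalgebra.toSubalgebra ·)
    (ContinuousMap.starSubalgebra_topologicalClosure_eq_top_of_separatesPoints _
      (expoSubalgebra_separatesPoints (d := d)))

/-- Stone–Weierstrass gives uniform density of trigonometric polynomials; continuous functions are
dense in `L²`. -/
lemma span_expoL2_closure_eq_top :
    (Submodule.span ℂ (range <| expoL2 (d := d))).topologicalClosure = ⊤ := by
  have h : (Submodule.span ℂ (range fun m : Freq d => contL2 (expo m))).topologicalClosure = ⊤ := by
    simpa only [contL2, Submodule.map_span, ContinuousLinearMap.coe_coe, ← range_comp,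
      Function.comp_def] using
      (ContinuousMap.toLp_denseRange ℂ (volume : Measure (Torus d)) ℂ
        (by simp : (2 : ℝ≥0∞) ≠ ∞)).topologicalClosure_map_submodule
        (span_expo_closure_eq_top (d := d))
  refine top_le_iff.1 (h.ge.trans (Submodule.topologicalClosure_mono (Submodule.span_le.2 ?_)))
  rintro _ ⟨m, rfl⟩
  have : contL2 (expo m) = ((√(torusMass d) : ℝ) : ℂ) • expoL2 m := by
    rw [expoL2, smul_smul, mul_inv_cancel₀ sqrt_torusMass_ne_zero, one_smul]
  change contL2 (expo m) ∈ _
  rw [this]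
  exact Submodule.smul_mem _ _ (Submodule.subset_span ⟨m, rfl⟩)

/-- The Fourier basis of `L²(𝕋^d)`. -/
def fourierONB (d : ℕ) : HilbertBasis (Freq d) ℂ (L2Torus d) :=
  HilbertBasis.mk orthonormal_expoL2 span_expoL2_closure_eq_top.ge

/-- The Fourier coefficients, as an isometry from `L²` onto `ℓ²`. -/
def coef : L2Torus d ≃ₗᵢ[ℂ] Seq d := (fourierONB d).repr

lemma coef_apply (f : L2Torus d) (m : Freq d) :
    coef f m = ((√(torusMass d) : ℝ) : ℂ)⁻¹ * ∫ x, f x * expo (-m) x := by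
  rw [coef, HilbertBasis.repr_apply_apply, fourierONB, HilbertBasis.coe_mk, inner_expoL2]

/-! ### Smooth functions -/

lemma IsSmooth.mul {φ ψ : Torus d → ℂ} (hφ : IsSmooth φ) (hψ : IsSmooth ψ) :
    IsSmooth fun x => φ x * ψ x := ContDiff.mul hφ hψ

lemma IsSmooth.conj {φ : Torus d → ℂ} (hφ : IsSmooth φ) : IsSmooth fun x => conj (φ x) :=
  Complex.conjCLE.contDiff.comp hφ

lemma IsSmooth.ofReal {σ : Torus d → ℝ} (hσ : IsSmooth σ) : IsSmooth fun x => (σ x : ℂ) :=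
  Complex.ofRealCLM.contDiff.comp hσ

lemma IsSmooth.hasDerivAt {φ : Torus d → ℂ} (hφ : IsSmooth φ) (j : Fin d) (x : Torus d) :
    HasDerivAt (fun r : ℝ => φ (x + Pi.single j (r : AddCircle (2 * π))))
      (HartreeTorus.pderiv j φ x) 0 := by
  simpa using hφ.hasDerivAt_single j x 0

lemma IsSmooth.pderiv_mul {φ ψ : Torus d → ℂ} (hφ : IsSmooth φ) (hψ : IsSmooth ψ) (j : Fin d)
    (x : Torus d) : HartreeTorus.pderiv j (fun x => φ x * ψ x) x
      = HartreeTorus.pderiv j φ x * ψ x + φ x * HartreeTorus.pderiv j ψ x := by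
  have h := (hφ.hasDerivAt j x).fun_mul (hψ.hasDerivAt j x)
  refine h.deriv.trans ?_
  simp

lemma IsSmooth.pderiv_conj {φ : Torus d → ℂ} (hφ : IsSmooth φ) (j : Fin d) (x : Torus d) :
    HartreeTorus.pderiv j (fun x => Complex.conjCLE (φ x)) x
      = Complex.conjCLE (HartreeTorus.pderiv j φ x) :=
  (Complex.conjCLE.hasFDerivAt.comp_hasDerivAt (0 : ℝ) (hφ.hasDerivAt j x)).deriv

lemma integrable_of_continuous {f : Torus d → ℂ} (hf : Continuous f) : Integrable f volume :=
  Continuous.integrable_of_hasCompactSupport hf (HasCompactSupport.of_compactSpace _)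

lemma IsSmooth.integral_mul_pderiv {φ ψ : Torus d → ℂ} (hφ : IsSmooth φ) (hψ : IsSmooth ψ)
    (j : Fin d) : ∫ x, φ x * HartreeTorus.pderiv j ψ x
      = -∫ x, HartreeTorus.pderiv j φ x * ψ x := by
  have h := (hφ.mul hψ).integral_pderiv j
  simp only [hφ.pderiv_mul hψ] at h
  have h1 : Integrable (fun x => HartreeTorus.pderiv j φ x * ψ x) volume :=
    integrable_of_continuous ((hφ.pderiv j).continuous.mul hψ.continuous)
  have h2 : Integrable (fun x => φ x * HartreeTorus.pderiv j ψ x) volume :=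
    integrable_of_continuous (hφ.continuous.mul (hψ.pderiv j).continuous)
  rw [integral_add h1 h2] at h
  exact eq_neg_of_add_eq_zero_right h

/-- A smooth function, as an element of `L²`. -/
def IsSmooth.toL2 {φ : Torus d → ℂ} (hφ : IsSmooth φ) : L2Torus d := contL2 ⟨φ, hφ.continuous⟩

lemma IsSmooth.coeFn_toL2 {φ : Torus d → ℂ} (hφ : IsSmooth φ) : hφ.toL2 =ᵐ[volume] φ :=
  coeFn_contL2 _

/-- A smooth function, as an element of `H¹`. -/
def IsSmooth.toH1 {φ : Torus d → ℂ} (hφ : IsSmooth φ) : H1 d :=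
  ⟨WithLp.toLp 2 (hφ.toL2, WithLp.toLp 2 fun j => (hφ.pderiv j).toL2), by
    intro j ψ hψ
    refine Eq.trans ?_ ((hφ.integral_mul_pderiv hψ j).trans ?_)
    · refine integral_congr_ae ?_
      filter_upwards [hφ.coeFn_toL2] with x hx
      exact congrArg (· * _) hx
    · congr 1
      refine integral_congr_ae ?_
      filter_upwards [(hφ.pderiv j).coeFn_toL2] with x hx
      exact congrArg (· * _) hx.symm⟩

/-! ### The Fourier model of `H¹` -/

/-- The function underlying an element of `H¹`, in `L²`. -/
def H1.val {d : ℕ} (u : H1 d) : L2Torus d := (u : L2Jet d).fst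

/-- The weak partial derivative of an element of `H¹`. -/
def H1.grad {d : ℕ} (u : H1 d) (j : Fin d) : L2Torus d := (u : L2Jet d).snd j

/-- The weak derivative is tested against `e^{-im·x}`, which is an eigenfunction of `∂_j`. -/
lemma coef_grad (u : H1 d) (j : Fin d) (m : Freq d) :
    coef (u.grad j) m = Complex.I * m j * coef u.val m := by
  have h := u.2 j (expo (-m)) (isSmooth_expo (-m))
  have h1 : ∫ x, (u : L2Jet d).fst x * pderiv j (expo (-m)) x
      = -(Complex.I * m j) * ∫ x, u.val x * expo (-m) x := by
    rw [← integral_const_mul]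
    refine integral_congr_ae (Eventually.of_forall fun x => ?_)
    simp only [pderiv_expo, Pi.neg_apply, Int.cast_neg, H1.val]
    ring
  rw [h1] at h
  rw [coef_apply, coef_apply, H1.grad, ← neg_eq_iff_eq_neg.2 h]
  ring

lemma bddWeight_grad (c : ℂ) (j : Fin d) :
    BddWeight fun m : Freq d => c * m j * (br m : ℂ)⁻¹ :=
  ⟨‖c‖, fun m => by
    have h1 : |(m j : ℝ)| ≤ br m := by
      refine abs_le_of_sq_le_sq ?_ (br_pos m).le
      rw [br_sq]
      have := Finset.single_le_sum (f := fun j => (m j : ℝ) ^ 2) (fun _ _ => sq_nonneg _)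
        (Finset.mem_univ j)
      have h2 : (m j : ℝ) ^ 2 ≤ normSq m := this
      linarith
    have h3 : ‖(m j : ℂ)‖ = |(m j : ℝ)| := by
      rw [← Complex.ofReal_intCast, Complex.norm_real, Real.norm_eq_abs]
    rw [norm_mul, norm_mul, norm_inv, h3, Complex.norm_real, Real.norm_of_nonneg (br_pos m).le,
      mul_assoc, ← div_eq_mul_inv]
    exact mul_le_of_le_one_right (norm_nonneg _) (div_le_one_of_le₀ h1 (br_pos m).le)⟩

/-- The multiplier `c m_j / ⟨m⟩`. -/
def gradOp (c : ℂ) (j : Fin d) : Seq d →L[ℂ] Seq d :=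
  wshift (fun m => c * m j * (br m : ℂ)⁻¹) 0

lemma gradOp_apply (c : ℂ) (j : Fin d) (x : Seq d) (m : Freq d) :
    gradOp c j x m = c * m j * (br m : ℂ)⁻¹ * x m := by
  rw [gradOp, wshift_apply (bddWeight_grad c j), sub_zero]

/-- The weighted Fourier coefficients of an element of `H¹`. -/
def toSeqLinear (d : ℕ) : H1 d →ₗ[ℂ] Seq d where
  -- Since `⟨m⟩ = ⟨m⟩⁻¹ (1 + ∑ m_j²)`, this is `⟨m⟩ û(m)` written with bounded operators, hence
  -- visibly in `ℓ²`.
  toFun u := embL2 (coef u.val) + ∑ j, gradOp (-Complex.I) j (coef (u.grad j))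
  map_add' u v := by
    have h1 : (u + v).val = u.val + v.val := rfl
    have h2 : ∀ j, (u + v).grad j = u.grad j + v.grad j := fun _ => rfl
    simp only [h1, h2, map_add, Finset.sum_add_distrib]
    abel
  map_smul' c u := by
    have h1 : (c • u).val = c • u.val := rfl
    have h2 : ∀ j, (c • u).grad j = c • u.grad j := fun _ => rfl
    simp only [h1, h2, map_smul, ← Finset.smul_sum, smul_add, RingHom.id_apply]

lemma sum_freq_sq (m : Freq d) : (br m : ℂ) ^ 2 = 1 + ∑ j, (m j : ℂ) ^ 2 := by
  rw [← Complex.ofReal_pow, br_sq, normSq]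
  push_cast
  rfl

lemma toSeqLinear_apply (u : H1 d) (m : Freq d) :
    toSeqLinear d u m = br m * coef u.val m := by
  have h : toSeqLinear d u m = embL2 (coef u.val) m
      + ∑ j, gradOp (-Complex.I) j (coef (u.grad j)) m := by
    change (embL2 (coef u.val) + ∑ j, gradOp (-Complex.I) j (coef (u.grad j)) : Seq d) m = _
    rw [lp.coeFn_add, Pi.add_apply, lp.coeFn_sum, Finset.sum_apply]
  have h1 : ∀ j, gradOp (-Complex.I) j (coef (u.grad j)) m
      = (m j : ℂ) ^ 2 * ((br m : ℂ)⁻¹ * coef u.val m) := fun j => by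
    rw [gradOp_apply, coef_grad]
    linear_combination (-(m j : ℂ) ^ 2 * (br m : ℂ)⁻¹ * coef u.val m) * Complex.I_sq
  have h2 := br_ne_zero m
  rw [h, embL2_apply]
  simp only [h1]
  rw [← Finset.sum_mul]
  have h3 := sum_freq_sq m
  field_simp
  rw [h3]
  try ring

lemma norm_toSeqLinear (u : H1 d) : ‖toSeqLinear d u‖ = ‖u‖ := by
  have h1 : ‖u‖ ^ 2 = ‖coef u.val‖ ^ 2 + ∑ j, ‖coef (u.grad j)‖ ^ 2 := by
    simp only [LinearIsometryEquiv.norm_map]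
    rw [← Submodule.norm_coe, WithLp.prod_norm_sq_eq_of_L2, PiLp.norm_sq_eq_of_L2]
    rfl
  have h2 := (hasSum_seq_norm_sq (coef u.val)).add
    (hasSum_sum (s := Finset.univ) fun j _ => hasSum_seq_norm_sq (coef (u.grad j)))
  rw [← h1] at h2
  refine (pow_left_inj₀ (norm_nonneg _) (norm_nonneg _) two_ne_zero).1
    ((hasSum_seq_norm_sq (toSeqLinear d u)).unique (h2.congr_fun fun m => ?_))
  simp only [toSeqLinear_apply, coef_grad, norm_mul, Complex.norm_I, one_mul, mul_pow,
    Complex.norm_real, Real.norm_of_nonneg (br_pos m).le, br_sq, normSq, ← Finset.sum_mul]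
  simp only [Complex.norm_intCast, sq_abs]
  ring

lemma IsSmooth.inner_toL2_conj {φ : Torus d → ℂ} (hφ : IsSmooth φ) (f : L2Torus d) :
    inner ℂ hφ.conj.toL2 f = ∫ x, f x * φ x := by
  rw [IsSmooth.toL2, inner_contL2]
  simp

lemma IsSmooth.grad_toH1_conj {φ : Torus d → ℂ} (hφ : IsSmooth φ) (j : Fin d) :
    hφ.conj.toH1.grad j = (hφ.pderiv j).conj.toL2 := by
  change (hφ.conj.pderiv j).toL2 = _
  congr 1
  ext x
  exact hφ.pderiv_conj j x

/-- The candidate has coefficients `x m / ⟨m⟩` and gradient coefficients `i m_j x m / ⟨m⟩`; Parseval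
against the conjugate test function verifies the weak derivative. -/
lemma toSeqLinear_surjective : Function.Surjective (toSeqLinear d) := by
  intro x
  have hw : ∀ j, IsWeakPDeriv j (coef.symm (embL2 x)) (coef.symm (gradOp Complex.I j x)) := by
    intro j φ hφ
    rw [← (hφ.pderiv j).inner_toL2_conj, ← hφ.inner_toL2_conj, ← hφ.grad_toH1_conj,
      ← coef.inner_map_map, ← coef.inner_map_map (hφ.conj.toL2), coef.apply_symm_apply,
      coef.apply_symm_apply]
    refine ((hasSum_seq_inner _ _).unique
      ((hasSum_seq_inner _ _).neg.congr_fun fun m => ?_))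
    rw [coef_grad, embL2_apply, gradOp_apply]
    simp only [map_mul, Complex.conj_I, map_intCast]
    change _ = -(conj (coef hφ.conj.toH1.val m) * _)
    ring
  refine ⟨⟨WithLp.toLp 2 (coef.symm (embL2 x),
    WithLp.toLp 2 fun j => coef.symm (gradOp Complex.I j x)), hw⟩, ?_⟩
  ext m
  rw [toSeqLinear_apply]
  change (br m : ℂ) * coef (coef.symm (embL2 x)) m = _
  rw [coef.apply_symm_apply, embL2_apply, mul_inv_cancel_left₀ (br_ne_zero m)]

/-- The isometry from `H¹(𝕋^d)` onto `ℓ²(ℤ^d)` given by the weighted Fourier coefficients. -/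
def toSeq (d : ℕ) : H1 d ≃ₗᵢ[ℂ] Seq d :=
  LinearIsometryEquiv.ofSurjective ⟨toSeqLinear d, norm_toSeqLinear⟩ toSeqLinear_surjective

lemma toSeq_apply (u : H1 d) (m : Freq d) : toSeq d u m = br m * coef u.val m :=
  toSeqLinear_apply u m

lemma embL2_toSeq (u : H1 d) : embL2 (toSeq d u) = coef u.val := by
  ext m
  rw [embL2_apply, toSeq_apply, inv_mul_cancel_left₀ (br_ne_zero m)]

lemma gradOp_toSeq (u : H1 d) (j : Fin d) :
    gradOp Complex.I j (toSeq d u) = coef (u.grad j) := by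
  ext m
  rw [gradOp_apply, toSeq_apply, coef_grad]
  have := br_ne_zero m
  field_simp

/-! ### The equation in Fourier variables -/

/-- The element of `ℓ²` that represents the test function `φ`. -/
def IsSmooth.testSeq {φ : Torus d → ℂ} (hφ : IsSmooth φ) : Seq d := toSeq d hφ.conj.toH1

lemma IsSmooth.embL2_testSeq {φ : Torus d → ℂ} (hφ : IsSmooth φ) :
    embL2 hφ.testSeq = coef hφ.conj.toL2 := embL2_toSeq _

lemma IsSmooth.gradOp_testSeq {φ : Torus d → ℂ} (hφ : IsSmooth φ) (j : Fin d) :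
    gradOp Complex.I j hφ.testSeq = coef (hφ.pderiv j).conj.toL2 := by
  rw [IsSmooth.testSeq, gradOp_toSeq, hφ.grad_toH1_conj]

lemma integral_mul_test (u : H1 d) {φ : Torus d → ℂ} (hφ : IsSmooth φ) :
    ∫ x, u.toFun x * φ x = inner ℂ hφ.testSeq (gramL2 (toSeq d u)) := by
  rw [inner_gramL2_right, hφ.embL2_testSeq, embL2_toSeq, coef.inner_map_map, hφ.inner_toL2_conj]
  rfl

lemma integral_mul_pderiv_test (u : H1 d) {φ : Torus d → ℂ} (hφ : IsSmooth φ) (j : Fin d) :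
    ∫ x, u.toFun x * pderiv j φ x
      = inner ℂ (gradOp Complex.I j hφ.testSeq) (embL2 (toSeq d u)) := by
  rw [hφ.gradOp_testSeq, embL2_toSeq, coef.inner_map_map, (hφ.pderiv j).inner_toL2_conj]
  rfl

/-- One of the two derivatives goes back onto `u`, which has just one. -/
lemma integral_mul_pderiv_pderiv_test (u : H1 d) {φ : Torus d → ℂ} (hφ : IsSmooth φ) (j : Fin d) :
    ∫ x, u.toFun x * pderiv j (pderiv j φ) x
      = -inner ℂ (gradOp Complex.I j hφ.testSeq) (gradOp Complex.I j (toSeq d u)) := by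
  rw [hφ.gradOp_testSeq, gradOp_toSeq, coef.inner_map_map, (hφ.pderiv j).inner_toL2_conj]
  exact u.2 j _ (hφ.pderiv j)

lemma IsSmooth.integrable_toFun_mul (u : H1 d) {φ : Torus d → ℂ} (hφ : IsSmooth φ) :
    Integrable (fun x => u.toFun x * φ x) volume := hφ.integrable_mul u.val

/-- The linear part of the equation, tested against `φ`. -/
lemma integral_linear_test (k : Freq d) (u : H1 d) {φ : Torus d → ℂ} (hφ : IsSmooth φ) :
    ∫ x, u.toFun x * (-(1 / 2) * laplacian φ x + (normSq k / 2 : ℝ) * φ x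
        + Complex.I * ∑ j, (k j : ℂ) * pderiv j φ x)
      = inner ℂ hφ.testSeq (formOp (disp k) (toSeq d u)) := by
  set y := hφ.testSeq
  set x := toSeq d u
  have i0 := (hφ.integrable_toFun_mul u)
  have i1 := fun j => ((hφ.pderiv j).integrable_toFun_mul u)
  have i2 := fun j => (((hφ.pderiv j).pderiv j).integrable_toFun_mul u)
  have h1 : ∫ x, u.toFun x * (-(1 / 2) * laplacian φ x + (normSq k / 2 : ℝ) * φ x
        + Complex.I * ∑ j, (k j : ℂ) * pderiv j φ x)
      = -(1 / 2) * ∑ j, (∫ x, u.toFun x * pderiv j (pderiv j φ) x)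
        + (normSq k / 2 : ℝ) * (∫ x, u.toFun x * φ x)
        + Complex.I * ∑ j, (k j : ℂ) * ∫ x, u.toFun x * pderiv j φ x := by
    rw [← integral_finsetSum _ fun j _ => i2 j]
    simp only [← integral_const_mul]
    have t2 := (integrable_finsetSum Finset.univ fun j _ => i2 j).const_mul (-(1 / 2) : ℂ)
    have t0 := i0.const_mul ((normSq k / 2 : ℝ) : ℂ)
    have t1 := (integrable_finsetSum Finset.univ fun j _ =>
      (i1 j).const_mul (k j : ℂ)).const_mul Complex.I
    rw [← integral_finsetSum _ fun j _ => (i1 j).const_mul _, ← integral_const_mul,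
      ← integral_add t2 t0]
    refine Eq.trans ?_ (integral_add (t2.add t0) t1)
    refine integral_congr_ae (Eventually.of_forall fun z => ?_)
    have e1 : ∑ j, u.toFun z * pderiv j (pderiv j φ) z = u.toFun z * laplacian φ z := by
      rw [laplacian, Finset.mul_sum]
    have e2 : ∑ j, (k j : ℂ) * (u.toFun z * pderiv j φ z)
        = u.toFun z * ∑ j, (k j : ℂ) * pderiv j φ z := by
      rw [Finset.mul_sum]
      exact Finset.sum_congr rfl fun j _ => by ring
    beta_reduce
    rw [e1, e2]
    ring
  rw [h1, integral_mul_test u hφ]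
  simp only [integral_mul_pderiv_pderiv_test u hφ, integral_mul_pderiv_test u hφ]
  have s0 := (hasSum_seq_inner y (gramL2 x)).mul_left ((normSq k / 2 : ℝ) : ℂ)
  have s1 := (hasSum_sum (s := Finset.univ) fun j _ =>
    (hasSum_seq_inner (gradOp Complex.I j y) (embL2 x)).mul_left (k j : ℂ)).mul_left Complex.I
  have s2 := (hasSum_sum (s := Finset.univ) fun j _ =>
    (hasSum_seq_inner (gradOp Complex.I j y) (gradOp Complex.I j x)).neg).mul_left (-(1 / 2) : ℂ)
  refine ((s2.add s0).add s1).unique ((hasSum_seq_inner y (formOp (disp k) x)).congr_fun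
    fun m => ?_)
  have e1 : ∀ j, (k j : ℂ) * (conj (gradOp Complex.I j y m) * embL2 x m)
      = (k j * m j : ℂ) * (-Complex.I * ((br m : ℂ)⁻¹ ^ 2 * (conj (y m) * x m))) := fun j => by
    rw [gradOp_apply, embL2_apply]
    simp only [map_mul, Complex.conj_I, map_intCast, map_inv₀, Complex.conj_ofReal]
    ring
  have e2 : ∀ j, -(conj (gradOp Complex.I j y m) * gradOp Complex.I j x m)
      = (m j : ℂ) ^ 2 * -((br m : ℂ)⁻¹ ^ 2 * (conj (y m) * x m)) := fun j => by
    rw [gradOp_apply, gradOp_apply]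
    simp only [map_mul, Complex.conj_I, map_intCast, map_inv₀, Complex.conj_ofReal]
    linear_combination ((m j : ℂ) ^ 2 * (br m : ℂ)⁻¹ ^ 2 * (conj (y m) * x m)) * Complex.I_sq
  simp only [e1, e2]
  rw [← Finset.sum_mul, ← Finset.sum_mul, gramL2_apply, formOp_apply (abs_disp_le_br k), disp,
    freqDot]
  have e3 : (normSq m : ℂ) = ∑ j, (m j : ℂ) ^ 2 := by
    rw [normSq]
    push_cast
    rfl
  rw [← e3]
  have hb := br_ne_zero m
  push_cast
  linear_combination (-(∑ j, (k j : ℂ) * (m j : ℂ)) * ((br m : ℂ)⁻¹ ^ 2 * (conj (y m) * x m)))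
    * Complex.I_sq

/-! ### The convolution potential -/

/-- The Fourier coefficients of `Σ = σ₁ ⋆ σ₁`, for the unnormalised exponentials. -/
def kernelSeq {σ : Torus d → ℝ} (hσ : IsSmooth σ) (p : Freq d) : ℝ := ‖coef hσ.ofReal.toL2 p‖ ^ 2

lemma coef_toL2 {φ : Torus d → ℂ} (hφ : IsSmooth φ) (m : Freq d) :
    coef hφ.toL2 m = ((√(torusMass d) : ℝ) : ℂ)⁻¹ * ∫ x, φ x * expo (-m) x := by
  rw [coef_apply]
  congr 1
  refine integral_congr_ae ?_
  filter_upwards [hφ.coeFn_toL2] with x hx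
  rw [hx]

lemma coef_ofReal_neg {σ : Torus d → ℝ} (hσ : IsSmooth σ) (p : Freq d) :
    coef hσ.ofReal.toL2 (-p) = conj (coef hσ.ofReal.toL2 p) := by
  rw [coef_toL2, coef_toL2, map_mul, map_inv₀, Complex.conj_ofReal, ← integral_conj]
  simp only [map_mul, Complex.conj_ofReal, ← expo_neg]

lemma isKernel_kernelSeq {σ : Torus d → ℝ} (hσ : IsSmooth σ) : IsKernel (kernelSeq hσ) where
  nonneg p := sq_nonneg _
  even p := by rw [kernelSeq, kernelSeq, coef_ofReal_neg hσ, RCLike.norm_conj]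
  summable := by
    -- The sum is the squared `H¹` norm of `σ`, because the coefficients of `σ ⋆ σ` are already
    -- squares.
    refine (hasSum_seq_norm_sq (toSeq d hσ.ofReal.toH1)).summable.congr fun p => ?_
    rw [toSeq_apply, norm_mul, mul_pow, Complex.norm_real, Real.norm_of_nonneg (br_pos p).le,
      mul_comm]
    rfl

lemma kernelSeq_le {σ : Torus d → ℝ} (hσ : IsSmooth σ) (p : Freq d) :
    kernelSeq hσ p ≤ (∫ x, |σ x|) ^ 2 / torusMass d := by
  have h1 : ‖∫ x, (σ x : ℂ) * expo (-p) x‖ ≤ ∫ x, |σ x| := by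
    refine (norm_integral_le_integral_norm _).trans_eq ?_
    simp [norm_expo]
  rw [kernelSeq, coef_toL2, norm_mul, mul_pow, norm_inv, Complex.norm_real,
    Real.norm_of_nonneg (Real.sqrt_nonneg _), inv_pow, Real.sq_sqrt torusMass_pos.le,
    div_eq_inv_mul]
  exact mul_le_mul_of_nonneg_left (pow_le_pow_left₀ (norm_nonneg _) h1 2)
    (inv_nonneg.2 torusMass_pos.le)

lemma IsSmooth.translate {σ : Torus d → ℝ} (hσ : IsSmooth σ) (x : Torus d) :
    IsSmooth fun t => σ (t - x) := by
  obtain ⟨y, rfl⟩ := proj_surjective d x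
  have h0 : ContDiff ℝ (⊤ : ℕ∞) fun z : Fin d → ℝ => σ (proj d z) := hσ
  have h : (fun z : Fin d → ℝ => σ (proj d z - proj d y))
      = (fun z => σ (proj d z)) ∘ fun z => z - y := by
    funext z
    simp only [Function.comp_apply]
    congr 1
  rw [IsSmooth, h]
  exact h0.comp (contDiff_id.sub contDiff_const)

/-- By evenness `(σ ⋆ σ)(x)` is the `L²` product of `σ` with its translate by `x`, and Parseval
applies at every point. -/
lemma hasSum_conv_self {σ : Torus d → ℝ} (hσ : IsSmooth σ) (hsymm : ∀ x, σ (-x) = σ x)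
    (x : Torus d) :
    HasSum (fun p => (kernelSeq hσ p : ℂ) * expo p x) (conv σ σ x : ℂ) := by
  have hx := hσ.translate x
  have hcoef : ∀ p, coef hx.ofReal.toL2 p = coef hσ.ofReal.toL2 p * conj (expo p x) := by
    intro p
    rw [coef_toL2, coef_toL2, mul_assoc, ← integral_mul_const,
      ← integral_add_right_eq_self (fun t => (σ (t - x) : ℂ) * expo (-p) t) x]
    congr 1
    refine integral_congr_ae (Eventually.of_forall fun t => ?_)
    simp only [add_sub_cancel_right, expo_add_right, expo_neg]
    ring
  have h1 := hasSum_seq_inner (coef hx.ofReal.toL2) (coef hσ.ofReal.toL2)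
  have h2 : inner ℂ (coef hx.ofReal.toL2) (coef hσ.ofReal.toL2) = (conv σ σ x : ℂ) := by
    rw [coef.inner_map_map, IsSmooth.toL2, inner_contL2, conv, convolution_def, ← integral_complex_ofReal]
    refine integral_congr_ae ?_
    filter_upwards [hσ.ofReal.coeFn_toL2] with t ht
    have e : σ (x - t) = σ (t - x) := by rw [← hsymm (x - t), neg_sub]
    rw [ht]
    simp [e]
  rw [h2] at h1
  refine h1.congr_fun fun p => ?_
  rw [hcoef, map_mul, Complex.conj_conj, kernelSeq, Complex.ofReal_pow, ← Complex.conj_mul']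
  ring

instance isNegInvariant_volume_torus : (volume : Measure (Torus d)).IsNegInvariant :=
  Measure.IsAddHaarMeasure.isNegInvariant_of_regular _

lemma integrable_norm_sq (u : H1 d) : Integrable (fun x => ‖u.toFun x‖ ^ 2) volume :=
  (Lp.memLp u.val).integrable_norm_pow two_ne_zero

lemma memLp_expo_mul (p : Freq d) (f : L2Torus d) : MemLp (fun x => expo p x * f x) 2 volume :=
  (Lp.memLp f).of_le ((expo p).continuous.aestronglyMeasurable.mul (Lp.aestronglyMeasurable f))
    (Eventually.of_forall fun x => by rw [norm_mul, norm_expo, one_mul])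

lemma coef_expo_mul (p : Freq d) (u : H1 d) :
    coef (memLp_expo_mul p u.val).toLp = modL2 p (embL2 (toSeq d u)) := by
  ext m
  rw [modL2_apply, embL2_toSeq, coef_apply, coef_apply]
  congr 1
  refine integral_congr_ae ?_
  filter_upwards [(memLp_expo_mul p u.val).coeFn_toLp] with x hx
  rw [hx, neg_sub, sub_eq_add_neg, expo_add]
  ring

lemma integral_density_mul_expo (p : Freq d) (u : H1 d) :
    ∫ x, ((‖u.toFun x‖ ^ 2 : ℝ) : ℂ) * expo (-p) x = rho p (toSeq d u) := by
  rw [rho_eq, ← coef_expo_mul, embL2_toSeq, coef.inner_map_map, L2.inner_def]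
  refine integral_congr_ae ?_
  filter_upwards [(memLp_expo_mul p u.val).coeFn_toLp] with x hx
  rw [RCLike.inner_apply, hx, map_mul, expo_neg, H1.toFun, H1.val, Complex.ofReal_pow,
    ← Complex.mul_conj']
  ring

lemma IsKernel.summable_self {s : Freq d → ℝ} (hs : IsKernel s) : Summable s :=
  hs.summable.of_nonneg_of_le hs.nonneg fun p =>
    le_mul_of_one_le_right (hs.nonneg p) (one_le_pow₀ (one_le_br p))

lemma IsKernel.summable_mul_rho {s : Freq d → ℝ} (hs : IsKernel s) (x : Seq d) :
    Summable fun p => s p * ‖rho p x‖ :=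
  (hs.summable_self.mul_right (‖embL2 x‖ ^ 2)).of_nonneg_of_le
    (fun p => mul_nonneg (hs.nonneg p) (norm_nonneg _)) fun p =>
      mul_le_mul_of_nonneg_left (norm_rho_le p x) (hs.nonneg p)

/-- The kernel has summable coefficients and `|u|²` is integrable, so the series of `Σ` is
integrated term by term. -/
lemma hasSum_conv_density {σ : Torus d → ℝ} (hσ : IsSmooth σ) (hsymm : ∀ x, σ (-x) = σ x)
    (u : H1 d) (x : Torus d) :
    HasSum (fun p => (kernelSeq hσ p : ℂ) * rho p (toSeq d u) * expo p x)
      (conv (conv σ σ) (fun y => ‖u.toFun y‖ ^ 2) x : ℂ) := by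
  have hK := isKernel_kernelSeq hσ
  have hi : Integrable (fun t => ((‖u.toFun (x - t)‖ ^ 2 : ℝ) : ℂ)) volume :=
    ((integrable_norm_sq u).comp_sub_left x).ofReal
  have hie : ∀ p, Integrable
      (fun t => (kernelSeq hσ p : ℂ) * expo p t * ((‖u.toFun (x - t)‖ ^ 2 : ℝ) : ℂ)) volume :=
    fun p => hi.bdd_mul (c := |kernelSeq hσ p|)
      ((continuous_const.mul (expo p).continuous).aestronglyMeasurable)
      (Eventually.of_forall fun t => by
        rw [norm_mul, norm_expo, mul_one, Complex.norm_real, Real.norm_eq_abs])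
  have h := hasSum_integral_of_summable_integral_norm hie (by
    simp only [norm_mul, norm_expo, mul_one, integral_const_mul, Complex.norm_real,
      Real.norm_of_nonneg (hK.nonneg _)]
    exact hK.summable_self.mul_right _)
  have h1 : ∫ t, ∑' p, (kernelSeq hσ p : ℂ) * expo p t * ((‖u.toFun (x - t)‖ ^ 2 : ℝ) : ℂ)
      = (conv (conv σ σ) (fun y => ‖u.toFun y‖ ^ 2) x : ℂ) := by
    rw [conv, convolution_def, ← integral_complex_ofReal]
    refine integral_congr_ae (Eventually.of_forall fun t => ?_)
    simp only [tsum_mul_right, (hasSum_conv_self hσ hsymm t).tsum_eq]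
    simp
  rw [h1] at h
  refine h.congr_fun fun p => ?_
  rw [← integral_density_mul_expo, ← integral_sub_left_eq_self _ volume x, mul_assoc,
    ← integral_mul_const, ← integral_const_mul]
  refine integral_congr_ae (Eventually.of_forall fun t => ?_)
  have e : expo p t = expo (-p) (x - t) * expo p x := by
    have e1 : expo p x * conj (expo p x) = 1 := by
      rw [Complex.mul_conj', norm_expo]
      simp
    rw [sub_eq_add_neg, expo_add_right, expo_neg_right, expo_neg, expo_neg, Complex.conj_conj]
    linear_combination (-(expo p t)) * e1
  beta_reduce
  rw [e]
  ring

lemma continuous_conv_density {σ : Torus d → ℝ} (hσ : IsSmooth σ) (hsymm : ∀ x, σ (-x) = σ x)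
    (u : H1 d) :
    Continuous fun x => (conv (conv σ σ) (fun y => ‖u.toFun y‖ ^ 2) x : ℂ) := by
  have hK := isKernel_kernelSeq hσ
  simp only [← (hasSum_conv_density hσ hsymm u _).tsum_eq]
  refine continuous_tsum (fun p => continuous_const.mul (expo p).continuous)
    (hK.summable_mul_rho (toSeq d u)) fun p x => ?_
  rw [norm_mul, norm_mul, norm_expo, mul_one, Complex.norm_real, Real.norm_of_nonneg (hK.nonneg p)]

lemma integrable_toFun_mul_continuous (u : H1 d) {f : Torus d → ℂ} (hf : Continuous f) :
    Integrable (fun x => u.toFun x * f x) volume := by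
  obtain ⟨C, hC⟩ := (isCompact_univ (X := Torus d)).exists_bound_of_continuousOn hf.continuousOn
  exact ((Lp.memLp u.val).integrable (by norm_num)).mul_bdd hf.aestronglyMeasurable
    (Eventually.of_forall fun x => hC x (mem_univ x))

/-- The nonlinear part of the equation, tested against `φ`. -/
lemma integral_potential_test {σ : Torus d → ℝ} (hσ : IsSmooth σ) (hsymm : ∀ x, σ (-x) = σ x)
    (g : ℝ) (u : H1 d) {φ : Torus d → ℂ} (hφ : IsSmooth φ) :
    Integrable (fun x => u.toFun x * ((potential g σ u x : ℂ) * φ x)) volume ∧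
    ∫ x, u.toFun x * ((potential g σ u x : ℂ) * φ x)
      = -(g : ℂ) * inner ℂ hφ.testSeq
        (gramL2 (hartreeOp (kernelSeq hσ) (toSeq d u) (toSeq d u))) := by
  have hK := isKernel_kernelSeq hσ
  set X := toSeq d u
  have hi := hφ.integrable_toFun_mul u
  let F : Freq d → Torus d → ℂ := fun p x =>
    (kernelSeq hσ p : ℂ) * rho p X * (expo p x * (u.toFun x * φ x))
  have hie : ∀ p, Integrable (fun x => expo p x * (u.toFun x * φ x)) volume := fun p =>
    hi.bdd_mul (c := 1) (expo p).continuous.aestronglyMeasurable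
      (Eventually.of_forall fun x => (norm_expo p x).le)
  have hFi : ∀ p, Integrable (F p) volume := fun p => (hie p).const_mul _
  have hFs : Summable fun p => ∫ x, ‖F p x‖ := by
    simp only [F, norm_mul, norm_expo, one_mul, integral_const_mul, Complex.norm_real,
      Real.norm_of_nonneg (hK.nonneg _)]
    exact (hK.summable_mul_rho X).mul_right _
  have hsum : ∀ x, ∑' p, F p x
      = (conv (conv σ σ) (fun y => ‖u.toFun y‖ ^ 2) x : ℂ) * (u.toFun x * φ x) := by
    intro x
    simp only [F, ← mul_assoc ((kernelSeq hσ _ : ℂ) * rho _ X)]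
    rw [tsum_mul_right, (hasSum_conv_density hσ hsymm u x).tsum_eq]
  have hpot : (fun x => u.toFun x * ((potential g σ u x : ℂ) * φ x))
      = fun x => -(g : ℂ) * ∑' p, F p x := by
    funext x
    rw [hsum, potential]
    push_cast
    ring
  have hint : ∀ p, ∫ x, F p x
      = (kernelSeq hσ p : ℂ) * rho p X * inner ℂ (gramL2 hφ.testSeq) (modH1 p X) := by
    intro p
    simp only [F]
    rw [integral_const_mul, inner_gramL2_left, embL2_modH1, ← coef_expo_mul, hφ.embL2_testSeq,
      coef.inner_map_map, hφ.inner_toL2_conj]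
    congr 1
    refine integral_congr_ae ?_
    filter_upwards [(memLp_expo_mul p u.val).coeFn_toLp] with x hx
    rw [hx, H1.toFun, H1.val, mul_assoc]
  constructor
  · refine integrable_toFun_mul_continuous u (Continuous.mul ?_ hφ.continuous)
    simp only [potential, Complex.ofReal_mul]
    exact continuous_const.mul (continuous_conv_density hσ hsymm u)
  rw [hpot]
  have h := hasSum_integral_of_summable_integral_norm hFi hFs
  simp only [hint] at h
  rw [integral_const_mul, h.unique (hK.hasSum_inner_hartreeOp X X (gramL2 hφ.testSeq)),
    inner_gramL2_left, inner_gramL2_right]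

/-- The right-hand side of the equation, tested against `φ`. -/
lemma integral_equation_test {σ : Torus d → ℝ} (hσ : IsSmooth σ) (hsymm : ∀ x, σ (-x) = σ x)
    (k : Freq d) (g : ℝ) (u : H1 d) {φ : Torus d → ℂ} (hφ : IsSmooth φ) :
    -Complex.I * ∫ x, u.toFun x * (-(1 / 2) * laplacian φ x + (normSq k / 2 : ℝ) * φ x
          + Complex.I * ∑ j, (k j : ℂ) * pderiv j φ x + (potential g σ u x : ℂ) * φ x)
      = inner ℂ hφ.testSeq (-(Complex.I • formOp (disp k) (toSeq d u)) + (Complex.I * g) •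
        gramL2 (hartreeOp (kernelSeq hσ) (toSeq d u) (toSeq d u))) := by
  obtain ⟨h1, h2⟩ := integral_potential_test hσ hsymm g u hφ
  have hl : Integrable (fun x => u.toFun x * (-(1 / 2) * laplacian φ x
      + (normSq k / 2 : ℝ) * φ x + Complex.I * ∑ j, (k j : ℂ) * pderiv j φ x)) volume := by
    exact integrable_toFun_mul_continuous u
      (((continuous_const.mul (continuous_finsetSum _ fun j _ =>
        ((hφ.pderiv j).pderiv j).continuous)).add (continuous_const.mul hφ.continuous)).add
        (continuous_const.mul (continuous_finsetSum _ fun j _ =>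
          continuous_const.mul (hφ.pderiv j).continuous)))
  have h3 := integral_add hl h1
  rw [integral_linear_test k u hφ, h2] at h3
  simp only [← mul_add] at h3
  rw [h3, inner_add_right, inner_neg_right, inner_smul_right, inner_smul_right]
  ring

/-! ### Solutions in Fourier variables -/

lemma coef_eq_integral_expo {f : L2Torus d} {n : Freq d} (h : f =ᵐ[volume] expo n) (m : Freq d) :
    coef f m = if n = m then ((√(torusMass d) : ℝ) : ℂ) else 0 := by
  have h1 : ∫ x, f x * expo (-m) x = ∫ x, expo (n - m) x := by
    refine integral_congr_ae ?_
    filter_upwards [h] with x hx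
    rw [hx, sub_eq_add_neg, expo_add]
  rw [coef_apply, h1, integral_expo]
  simp only [sub_eq_zero]
  split_ifs
  · have h2 : ((√(torusMass d) : ℝ) : ℂ) * ((√(torusMass d) : ℝ) : ℂ) = (torusMass d : ℂ) := by
      rw [← Complex.ofReal_mul, Real.mul_self_sqrt torusMass_pos.le]
    rw [← h2, inv_mul_cancel_left₀ sqrt_torusMass_ne_zero]
  · rw [mul_zero]

/-- Testing against `e^{-im·x}` isolates the coordinate `m`; this extracts scalar equations from the
weak formulation. -/
lemma inner_testSeq_expo (m : Freq d) (z : Seq d) :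
    inner ℂ (isSmooth_expo (-m)).testSeq z = br m * (√(torusMass d) : ℝ) * z m := by
  have h : (isSmooth_expo (-m)).testSeq
      = ((br m * √(torusMass d) : ℝ) : ℂ) • (lp.single 2 m (1 : ℂ) : Seq d) := by
    ext q
    have hae : (isSmooth_expo (-m)).conj.toH1.val =ᵐ[volume] expo m := by
      filter_upwards [(isSmooth_expo (-m)).conj.coeFn_toL2] with x hx
      refine hx.trans ?_
      rw [expo_neg, Complex.conj_conj]
    rw [IsSmooth.testSeq, toSeq_apply, coef_eq_integral_expo hae, lp.coeFn_smul, Pi.smul_apply,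
      smul_eq_mul]
    by_cases hq : m = q
    · subst hq
      rw [if_pos rfl, lp.single_apply_self (E := fun _ : Freq d => ℂ)]
      push_cast
      ring
    · rw [if_neg hq, lp.single_apply_ne (E := fun _ : Freq d => ℂ) 2 m 1 (Ne.symm hq)]
      simp
  rw [h, inner_smul_left, Complex.conj_ofReal, seq_apply_eq_inner]
  push_cast
  ring

/-- Solutions of the equation are the curves whose Fourier coefficients, in the interaction
picture, solve an ordinary differential equation. -/
theorem isSolution_iff {σ : Torus d → ℝ} (hσ : IsSmooth σ) (hsymm : ∀ x, σ (-x) = σ x)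
    (k : Freq d) (g : ℝ) (v₀ : H1 d) (v : ℝ → H1 d) :
    IsSolution k g σ v₀ v ↔ v 0 = v₀ ∧
      SolvesODE (interactionField k g (kernelSeq hσ)) fun t => free k (-t) (toSeq d (v t)) := by
  have hK := isKernel_kernelSeq hσ
  constructor
  · intro hv
    refine ⟨hv.initial, solvesODE_of_coord hK k g
      ((toSeq d).continuous.comp_continuousOn hv.continuousOn) fun m t ht => ?_⟩
    have h := hv.equation _ (isSmooth_expo (-m)) t ht
    rw [integral_equation_test hσ hsymm k g (v t) (isSmooth_expo (-m))] at h
    simp only [integral_mul_test _ (isSmooth_expo (-m)), inner_testSeq_expo, gramL2_apply] at h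
    have hb := br_ne_zero m
    have hN := sqrt_torusMass_ne_zero (d := d)
    -- The test contributes `⟨m⟩ √(torusMass d)` and `gramL2` contributes `⟨m⟩⁻²`; this factor
    -- cancels both.
    have h2 := h.const_mul ((br m : ℂ) * ((√(torusMass d) : ℝ) : ℂ)⁻¹)
    refine (h2.congr_deriv ?_).congr_of_eventuallyEq (Eventually.of_forall fun r => ?_) ?_
    · rw [lp.coeFn_add, Pi.add_apply, lp.coeFn_neg, Pi.neg_apply, lp.coeFn_smul, Pi.smul_apply,
        lp.coeFn_smul, Pi.smul_apply, formOp_apply (abs_disp_le_br k), gramL2_apply, smul_eq_mul,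
        smul_eq_mul]
      push_cast
      field_simp
    · beta_reduce
      field_simp
    · beta_reduce
      field_simp
  · rintro ⟨h0, hw⟩
    have hx : ∀ t, free k t (free k (-t) (toSeq d (v t))) = toSeq d (v t) :=
      fun t => free_free_neg k t _
    refine ⟨?_, h0, fun φ hφ t ht => ?_⟩
    · have h1 := continuousOn_free k continuousOn_id hw.continuousOn
      simp only [id, hx] at h1
      have h2 := (toSeq d).symm.continuous.comp_continuousOn h1
      simpa [Function.comp_def] using h2
    -- A smooth test function is an element of `H¹`, so differentiability of `gramL2 ∘ x`, that is
    -- in `H⁻¹`, is enough.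
    · have h1 := hw.hasDerivWithinAt_gramL2 ht
      simp only [hx] at h1
      rw [integral_equation_test hσ hsymm k g (v t) hφ]
      simp only [integral_mul_test _ hφ]
      exact ((innerSL ℂ hφ.testSeq).restrictScalars
        ℝ).hasFDerivAt.comp_hasDerivWithinAt t h1

/-! ### The plane wave -/

lemma smul_constSeq (c a : ℂ) : c • (constSeq a : Seq d) = constSeq (c * a) := by
  ext m
  rw [lp.coeFn_smul, Pi.smul_apply, smul_eq_mul]
  by_cases hm : m = 0
  · subst hm
    rw [constSeq_apply_zero, constSeq_apply_zero]
  · rw [constSeq_apply_ne _ hm, constSeq_apply_ne _ hm, mul_zero]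

lemma toSeq_one : toSeq d (H1.one d) = constSeq ((√(torusMass d) : ℝ) : ℂ) := by
  ext m
  have hae : (H1.one d).val =ᵐ[volume] expo 0 := by
    filter_upwards [Lp.coeFn_const (p := 2) (μ := (volume : Measure (Torus d)))
      (c := (1 : ℂ))] with x hx
    refine hx.trans ?_
    rw [expo_zero]
    rfl
  rw [toSeq_apply, coef_eq_integral_expo hae]
  by_cases hm : m = 0
  · subst hm
    rw [constSeq_apply_zero, if_pos rfl, br_zero, Complex.ofReal_one, one_mul]
  · rw [constSeq_apply_ne _ hm, if_neg (Ne.symm hm), mul_zero]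

lemma rho_constSeq {p : Freq d} (hp : p ≠ 0) (a : ℂ) : rho p (constSeq a) = 0 := by
  rw [rho_eq, embL2_constSeq, inner_modL2_left, inner_constSeq_left, modL2_apply, zero_sub,
    neg_neg, constSeq_apply_ne a hp, mul_zero]

lemma modH1_zero (x : Seq d) : modH1 0 x = x := by
  ext m
  rw [modH1_apply, sub_zero, div_self (br_ne_zero m), one_mul]

/-- The density of a constant has only its zero mode. -/
lemma IsKernel.hartreeOp_constSeq {s : Freq d → ℝ} (hs : IsKernel s) (a : ℂ) :
    hartreeOp s (constSeq a) (constSeq a) = ((s 0 * ‖a‖ ^ 2 : ℝ) : ℂ) • constSeq a := by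
  refine (hs.hasSum_hartreeOp_apply _ _).unique ?_
  have h := hasSum_single (f := fun p => ((s p : ℂ) * rho p (constSeq a)) • modH1 p (constSeq a))
    (0 : Freq d) fun p hp => by rw [rho_constSeq hp, mul_zero, zero_smul]
  rwa [modH1_zero, rho_zero, embL2_constSeq, norm_constSeq, ← Complex.ofReal_mul] at h

lemma kernelSeq_zero_mul {σ : Torus d → ℝ} (hσ : IsSmooth σ) :
    kernelSeq hσ 0 * torusMass d = (∫ x, σ x) ^ 2 := by
  have h := torusMass_pos (d := d)
  rw [kernelSeq, coef_toL2]
  simp only [neg_zero, expo_zero, mul_one]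
  rw [integral_complex_ofReal, norm_mul, norm_inv, Complex.norm_real, Complex.norm_real, mul_pow,
    inv_pow, Real.norm_of_nonneg (Real.sqrt_nonneg _), Real.sq_sqrt h.le, Real.norm_eq_abs, sq_abs]
  field_simp

/-- Only the zero mode moves. Since `s_0 (2π)^d = ⟨σ₁⟩²`, its scalar equation is the dispersion
relation. -/
theorem isSolution_planeWave {σ : Torus d → ℝ} (hσ : IsSmooth σ) (hsymm : ∀ x, σ (-x) = σ x)
    {k : Freq d} {g ω : ℝ} (hω : ω + normSq k / 2 - g * (∫ x, σ x) ^ 2 = 0) :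
    IsSolution k g σ (H1.one d) (planeWave d ω) := by
  have hK := isKernel_kernelSeq hσ
  rw [isSolution_iff hσ hsymm]
  refine ⟨by simp [planeWave], ?_⟩
  set N := torusMass d with hN
  have hx : ∀ t : ℝ, toSeq d (planeWave d ω t)
      = constSeq (Complex.exp (Complex.I * (ω * t : ℝ)) * (√N : ℝ)) := fun t => by
    rw [planeWave, map_smul, toSeq_one, smul_constSeq]
  have hexp : ∀ t : ℝ, HasDerivAt
      (fun t : ℝ => Complex.exp (Complex.I * (ω * t : ℝ)) * ((√N : ℝ) : ℂ))
      (Complex.I * ω * (Complex.exp (Complex.I * (ω * t : ℝ)) * ((√N : ℝ) : ℂ))) t := by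
    intro t
    have h0 : HasDerivAt (fun t : ℝ => Complex.I * ((ω * t : ℝ) : ℂ)) (Complex.I * ω) t := by
      have := (((hasDerivAt_id t).const_mul ω).ofReal_comp).const_mul Complex.I
      simpa using this
    refine (h0.cexp.mul_const _).congr_deriv ?_
    ring
  simp only [hx]
  refine solvesODE_of_coord hK k g ?_ fun m t ht => ?_
  · have h1 : Continuous fun t : ℝ =>
        (Complex.exp (Complex.I * (ω * t : ℝ)) * (√N : ℝ)) • (constSeq 1 : Seq d) := by fun_prop
    simp only [smul_constSeq, mul_one] at h1
    exact h1.continuousOn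
  · rw [hK.hartreeOp_constSeq, lp.coeFn_smul, Pi.smul_apply, smul_eq_mul]
    by_cases hm : m = 0
    · subst hm
      simp only [constSeq_apply_zero]
      refine (hexp t).hasDerivWithinAt.congr_deriv ?_
      have e1 : ‖Complex.exp (Complex.I * (ω * t : ℝ)) * ((√N : ℝ) : ℂ)‖ ^ 2 = N := by
        rw [norm_mul, mul_comm Complex.I, Complex.norm_exp_ofReal_mul_I, one_mul,
          Complex.norm_real, Real.norm_of_nonneg (Real.sqrt_nonneg _),
          Real.sq_sqrt torusMass_pos.le]
      rw [e1, hN, kernelSeq_zero_mul]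
      have e2 : disp k 0 = normSq k / 2 := by simp [disp, normSq_zero, freqDot]
      have e3 : (ω : ℂ) = -((normSq k / 2 : ℝ) : ℂ) + (g : ℂ) * (((∫ x, σ x) ^ 2 : ℝ) : ℂ) := by
        rw [← Complex.ofReal_neg, ← Complex.ofReal_mul, ← Complex.ofReal_add]
        congr 1
        linarith
      rw [e2]
      linear_combination (Complex.I * (Complex.exp (Complex.I * (ω * t : ℝ)) * ((√N : ℝ) : ℂ))) * e3
    · simp only [constSeq_apply_ne _ hm, mul_zero, neg_zero, add_zero]
      exact hasDerivWithinAt_const _ _ _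

/-! ### Well-posedness and stability on the torus -/

lemma kappa_nonneg {n : ℕ} (σ₂ : EuclideanSpace ℝ (Fin n) → ℝ) : 0 ≤ kappa σ₂ :=
  div_nonneg (integral_nonneg fun _ => by positivity) (by positivity)

theorem exists_isSolution_unique {σ : Torus d → ℝ} (hσ : IsSmooth σ) (hsymm : ∀ x, σ (-x) = σ x)
    (k : Freq d) (g : ℝ) (v₀ : H1 d) :
    ∃ v, IsSolution k g σ v₀ v ∧ ∀ v', IsSolution k g σ v₀ v' → EqOn v' v (Ici 0) := by
  have hK := isKernel_kernelSeq hσ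
  obtain ⟨w, hw, hw0⟩ := hK.exists_interaction_solution k g (toSeq d v₀)
  have hwv : (fun t => free k (-t) (toSeq d ((toSeq d).symm (free k t (w t))))) = w := by
    funext t
    rw [LinearIsometryEquiv.apply_symm_apply, free_neg_free]
  have hsol : IsSolution k g σ v₀ fun t => (toSeq d).symm (free k t (w t)) := by
    refine (isSolution_iff hσ hsymm k g _ _).2 ⟨?_, by rwa [hwv]⟩
    beta_reduce
    rw [free_zero, hw0, LinearIsometryEquiv.symm_apply_apply]
  refine ⟨_, hsol, fun v' hv' t ht => ?_⟩
  have h1 := (isSolution_iff hσ hsymm k g _ _).1 hv'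
  have h2 := h1.2.unique (hK.lipschitz_interactionField k g) hw
    (by beta_reduce; rw [neg_zero, free_zero, h1.1, hw0]) ht
  beta_reduce at h2 ⊢
  rw [← h2, free_free_neg, LinearIsometryEquiv.symm_apply_apply]

theorem phaseOrbit_stable {σ : Torus d → ℝ} (hσ : IsSmooth σ) (hsymm : ∀ x, σ (-x) = σ x)
    (k : Freq d) {g : ℝ} (hg : 0 ≤ g) (hsmall : 4 * g * (∫ x, |σ x|) ^ 2 < 1)
    {ε : ℝ} (hε : 0 < ε) :
    ∃ δ : ℝ, 0 < δ ∧ ∀ v₀ : H1 d, ‖v₀ - H1.one d‖ < δ → ∀ v, IsSolution k g σ v₀ v →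
      ⨆ t ∈ Ici (0 : ℝ), Metric.infEDist (v t) (phaseOrbit d) < ENNReal.ofReal ε := by
  have hK := isKernel_kernelSeq hσ
  have hN := torusMass_pos (d := d)
  -- Here `σ = ‖σ₁‖²_{L¹}/(2π)^d` and `N = (2π)^d`, so the torus volume cancels in the smallness
  -- condition. Using `ε / 2` keeps the inequality strict after the supremum over time.
  obtain ⟨δ, hδ, hstab⟩ := hK.orbital_stability (kernelSeq_le hσ) hg hN
    (by rwa [mul_assoc (4 * g), div_mul_cancel₀ _ hN.ne']) k (half_pos hε)
  refine ⟨δ, hδ, fun v₀ hv₀ v hv => ?_⟩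
  have h1 := (isSolution_iff hσ hsymm k g _ _).1 hv
  have h2 := hstab _ h1.2 (by
    beta_reduce
    rw [neg_zero, free_zero, h1.1, ← toSeq_one, ← map_sub, LinearIsometryEquiv.norm_map]
    exact hv₀)
  refine lt_of_le_of_lt (iSup₂_le fun t ht => ?_)
    ((ENNReal.ofReal_lt_ofReal_iff hε).2 (half_lt_self hε))
  obtain ⟨θ, hθ⟩ := h2 t ht
  have hmem : Complex.exp (Complex.I * θ) • H1.one d ∈ phaseOrbit d := ⟨θ, rfl⟩
  refine (Metric.infEDist_le_edist_of_mem hmem).trans ?_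
  rw [edist_dist, dist_eq_norm, ← (toSeq d).norm_map, map_sub, map_smul, toSeq_one,
    smul_constSeq]
  beta_reduce at hθ
  rw [free_free_neg] at hθ
  exact ENNReal.ofReal_le_ofReal hθ.le

end HartreeTorus

end

theorem mainTheorem3 {d n : ℕ} (hd : 1 ≤ d) (hn : 3 ≤ n)
    (γ : ℝ) (hγ : 0 < γ)
    (σ₁ : HartreeTorus.Torus d → ℝ)
    (hσ₁_nonneg : ∀ x, 0 ≤ σ₁ x)
    (hσ₁_smooth : HartreeTorus.IsSmooth σ₁)
    (hσ₁_symm : ∀ x, σ₁ (-x) = σ₁ x)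
    (hσ₁_mean : (∫ x, σ₁ x) ≠ 0)
    (σ₂ : EuclideanSpace ℝ (Fin n) → ℝ)
    (hσ₂_nonneg : ∀ z, 0 ≤ σ₂ z)
    (hσ₂_smooth : ContDiff ℝ (⊤ : ℕ∞) σ₂)
    (hσ₂_radial : ∀ z z', ‖z‖ = ‖z'‖ → σ₂ z = σ₂ z')
    (hσ₂_supp : HasCompactSupport σ₂)
    (hσ₂_L2 : MemLp (fun ξ => HartreeTorus.fourierHat σ₂ ξ / (‖ξ‖ : ℂ)) 2 volume)
    (hσ₂_hat : ∀ ξ, HartreeTorus.fourierHat σ₂ ξ ≠ 0)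
    (k : Fin d → ℤ) (ω : ℝ)
    (hdisp : ω + HartreeTorus.normSq k / 2
      - γ ^ 2 * HartreeTorus.kappa σ₂ * (∫ x, σ₁ x) ^ 2 = 0)
    (hsmall : 4 * γ ^ 2 * HartreeTorus.kappa σ₂ * (∫ x, |σ₁ x|) ^ 2 < 1) :
    -- the plane wave solves the equation
    HartreeTorus.IsSolution k (γ ^ 2 * HartreeTorus.kappa σ₂) σ₁ (HartreeTorus.H1.one d)
      (HartreeTorus.planeWave d ω) ∧
    -- every datum in `H¹` has a unique global solution
    (∀ v₀ : HartreeTorus.H1 d,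
      ∃ v, HartreeTorus.IsSolution k (γ ^ 2 * HartreeTorus.kappa σ₂) σ₁ v₀ v ∧
        ∀ v', HartreeTorus.IsSolution k (γ ^ 2 * HartreeTorus.kappa σ₂) σ₁ v₀ v' →
          Set.EqOn v' v (Set.Ici 0)) ∧
    -- the plane wave is orbitally stable
    (∀ ε : ℝ, 0 < ε → ∃ δ : ℝ, 0 < δ ∧ ∀ v₀ : HartreeTorus.H1 d,
      ‖v₀ - HartreeTorus.H1.one d‖ < δ →
      ∀ v, HartreeTorus.IsSolution k (γ ^ 2 * HartreeTorus.kappa σ₂) σ₁ v₀ v →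
        ⨆ t ∈ Set.Ici (0 : ℝ), Metric.infEDist (v t) (HartreeTorus.phaseOrbit d)
          < ENNReal.ofReal ε) := by
  have hg : 0 ≤ γ ^ 2 * HartreeTorus.kappa σ₂ :=
    mul_nonneg (sq_nonneg _) (HartreeTorus.kappa_nonneg σ₂)
  refine ⟨HartreeTorus.isSolution_planeWave hσ₁_smooth hσ₁_symm hdisp,
    HartreeTorus.exists_isSolution_unique hσ₁_smooth hσ₁_symm k _,
    fun ε hε => HartreeTorus.phaseOrbit_stable hσ₁_smooth hσ₁_symm k hg ?_ hε⟩
  rwa [← mul_assoc 4]
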